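/- Let $V=\{x_1,\dots,x_n\}$ be the set of variables. A literal is $x^1=x$ or $x^0=\bar x$ for $x\in V$, a clause is a set of literals in which no variable appears together with its negation, and a CNF $\tau$ is a finite set of clauses, $|\tau|$ being their number. $C|_t$ denotes the restriction of a clause $C$ by the partial assignment $t$: it is $1$ if $t$ satisfies a literal of $C$, and otherwise $C$ without the literals falsified by $t$. A resolution refutation $\Pi$ of $\tau$ is a sequence of lines, each of which is a clause of $\tau$ or is derived from two earlier lines $C\lor x^a$, $D\lor x^{1-a}$ as the clause $C\lor D$ (there is no weakening rule; each line comes with its premises), such that the empty clause $0$ appears; $|\Pi|$ is the number of lines and $\mathrm{Var}(\Pi)$ the set of variables appearing in them. $\Pi$ is connected if its graph (an edge from each premise to the line derived from it) has exactly one sink. For an order $\pi$ of $V$, a $\pi$-$P_0$ proof from $\tau$ is a sequence of lines which are clauses or trails, a trail being a list of assignments $x=a$ to distinct variables, each annotated $d$ or $u$. Every line is a clause of $\tau$, or the empty trail, or follows from earlier lines by one of the rules * Decision: from a trail $t$ derive $[t, x\stackrel{d}{=}a]$, where $x$ is the $\pi$-smallest variable not appearing in $t$ and $a\in\{0,1\}$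 is arbitrary; * Unit propagation: from a trail $t$ and a clause $C$ with $C|_t=x^a$ derive $[t,x\stackrel{u}{=}a]$; * Learning: from $C\lor x^a$, $D\lor x^{1-a}$ and a trail $t$ such that $(C\lor D)|_t=0$, $t$ assigns $x=a$ (with either annotation), and all other variables of $C$ appear in $t$ before $x$, derive the clause $C\lor D$. Its size is the number of its lines. Theorem. There is a polynomial-time algorithm that, given $n$, an order $\pi$ of the $n$ variables, a CNF $\tau$ and a connected resolution refutation $\Pi$ of $\tau$, outputs a $\pi$-$P_0$ proof from $\tau$ of size $O(n^2|\tau||\Pi|)$, with an absolute constant, in which both unit clauses $x^0$ and $x^1$ appear for every $x\in\mathrm{Var}(\Pi)$. -/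

import Mathlib

namespace CDCL

/-! ### Literals, clauses, CNFs over the variables `x_0, …, x_{n-1}` -/

/-- The literal `(i, a)` is `x_i ^ a`: the variable `x_i` for `a = true`, its negation for
`a = false`. -/
abbrev Lit (n : ℕ) := Fin n × Bool

/-- A clause: a set of literals in which no variable appears together with its negation. -/
abbrev Clause (n : ℕ) :=
  {s : Finset (Lit n) // ∀ i : Fin n, ¬ ((i, true) ∈ s ∧ (i, false) ∈ s)}

/-- A CNF: a (finite) set of clauses. Its size `|τ|` is the number of its clauses. -/
abbrev CNF (n : ℕ) := Finset (Clause n)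

/-- The set of variables of a clause. -/
def Clause.vars {n : ℕ} (C : Clause n) : Finset (Fin n) := C.1.image Prod.fst

/-- The empty clause `0`. -/
def Clause.empty (n : ℕ) : Clause n := ⟨∅, by simp⟩

/-- The unit clause consisting of the literal `l`. -/
def Clause.unit {n : ℕ} (l : Lit n) : Clause n :=
  ⟨{l}, by
    intro i h
    have h1 := Finset.mem_singleton.1 h.1
    have h2 := Finset.mem_singleton.1 h.2
    exact absurd (congrArg Prod.snd (h1.trans h2.symm)) (by simp)⟩

/-- `R` is the result of resolving `P = C ∨ x_i ^ a` with `Q = D ∨ x_i ^ (1 - a)`,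
that is, `R = C ∨ D`. As `R` is a clause, `C` and `D` do not clash. -/
def IsResolvent {n : ℕ} (i : Fin n) (a : Bool) (P Q R : Clause n) : Prop :=
  (i, a) ∈ P.1 ∧ (i, !a) ∈ Q.1 ∧ R.1 = P.1.erase (i, a) ∪ Q.1.erase (i, !a)

/-! ### Resolution proofs and their graphs -/

/-- A line of a resolution proof: a clause with its justification, `none` for an axiom and
`some (j, k)` for a clause resolved from the lines number `j` and `k`. -/
abbrev ResLine (n : ℕ) := Clause n × Option (ℕ × ℕ)

/-- A resolution proof together with its graph: the nodes are the positions in the list,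
listed in a topological order. The size `|Π|` is the number of lines, that is, the length. The
same clause may occur at several nodes. -/
abbrev ResProof (n : ℕ) := List (ResLine n)

/-- `Pf` is a resolution proof from `τ`. -/
def IsResProof {n : ℕ} (τ : CNF n) (Pf : ResProof n) : Prop :=
  ∀ (v : ℕ) (C : Clause n) (jst : Option (ℕ × ℕ)), Pf[v]? = some (C, jst) →
    match jst with
    | none => C ∈ τ
    | some (j, k) => j < v ∧ k < v ∧
        ∃ (P Q : Clause n) (jP jQ : Option (ℕ × ℕ)) (i : Fin n) (a : Bool),
          Pf[j]? = some (P, jP) ∧ Pf[k]? = some (Q, jQ) ∧ IsResolvent i a P Q C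

/-- A resolution refutation of `τ`: a resolution proof from `τ` in which `0` is derived. -/
def IsRefutation {n : ℕ} (τ : CNF n) (Pf : ResProof n) : Prop :=
  IsResProof τ Pf ∧ ∃ L ∈ Pf, L.1 = Clause.empty n

/-- The edges of the resolution graph: `u` is a parent of `v`. -/
def IsParent {n : ℕ} (Pf : ResProof n) (u v : ℕ) : Prop :=
  ∃ C j k, Pf[v]? = some (C, some (j, k)) ∧ (u = j ∨ u = k)

/-- The partial order on the nodes: `u < v` if there is a directed path from `u` to `v`. -/
def NodeLT {n : ℕ} (Pf : ResProof n) : ℕ → ℕ → Prop := Relation.TransGen (IsParent Pf)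

/-- The set of maximal nodes of the resolution graph. -/
def maxNodes {n : ℕ} (Pf : ResProof n) : Set ℕ :=
  {v | v < Pf.length ∧ ∀ u < Pf.length, ¬ NodeLT Pf v u}

/-- The resolution graph is connected: there is a unique sink. -/
def IsConnected {n : ℕ} (Pf : ResProof n) : Prop := ∃! v, v ∈ maxNodes Pf

/-- The variables appearing in a resolution proof. -/
def ResProof.vars {n : ℕ} (Pf : ResProof n) : Set (Fin n) := {i | ∃ L ∈ Pf, i ∈ Clause.vars L.1}

/-! ### Trails and the proof system `π-P₀` -/

/-- The annotation of an assignment: `d` (decision) or `u` (unit propagation). -/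
inductive Ann
  | d
  | u

/-- The annotated assignment `x_i = a`. -/
structure AnnAssign (n : ℕ) where
  var : Fin n
  ann : Ann
  val : Bool

/-- A trail: an ordered list of annotated assignments. That the variables are pairwise distinct
is maintained by the rules of inference below, which start from the empty trail and only append
assignments to variables that do not appear yet. -/
abbrev Trail (n : ℕ) := List (AnnAssign n)

/-- The variables appearing in a trail. -/
def Trail.vars {n : ℕ} (t : Trail n) : List (Fin n) := t.map AnnAssign.var

/-- The trail assigns the value `a` to `x_i`. -/
def Trail.Sets {n : ℕ} (t : Trail n) (i : Fin n) (a : Bool) : Prop :=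
  ∃ s ∈ t, s.var = i ∧ s.val = a

open Classical in
/-- The restriction `C|_t`: it is `none`, standing for the constant `1`, if `t` satisfies a literal
of `C`; otherwise it is the set of literals of `C` that are not falsified by `t`. -/
noncomputable def Clause.restrict {n : ℕ} (C : Clause n) (t : Trail n) : Option (Finset (Lit n)) :=
  if ∃ l ∈ C.1, Trail.Sets t l.1 l.2 then none
  else some (C.1.filter fun l => ¬ Trail.Sets t l.1 (!l.2))

/-- The lines of a `π-P₀` proof are clauses and trails. -/
inductive P0Line (n : ℕ)
  | clause (C : Clause n)
  | trail (t : Trail n)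

/-- `P0Step π τ prev L`: the line `L` is an axiom (a clause of `τ`, or the empty trail) or follows
by a rule of `π-P₀` from lines in `prev`. The order is given by `π`: the variable `x_i` comes
before `x_j` if `π i < π j`. -/
inductive P0Step {n : ℕ} (π : Equiv.Perm (Fin n)) (τ : CNF n) (prev : List (P0Line n)) :
    P0Line n → Prop
  | axiomClause (C : Clause n) (hC : C ∈ τ) : P0Step π τ prev (.clause C)
  | emptyTrail : P0Step π τ prev (.trail [])
  /-- Decision rule: `x_i` is the `π`-smallest variable not appearing in `t`. -/
  | decision (t : Trail n) (i : Fin n) (a : Bool)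
      (ht : .trail t ∈ prev)
      (hi : i ∉ Trail.vars t)
      (hmin : ∀ j, j ∉ Trail.vars t → π i ≤ π j) :
      P0Step π τ prev (.trail (t ++ [⟨i, .d, a⟩]))
  /-- Unit propagation rule: `C|_t = x_i ^ a`. -/
  | unitProp (t : Trail n) (C : Clause n) (i : Fin n) (a : Bool)
      (ht : .trail t ∈ prev)
      (hC : .clause C ∈ prev)
      (hunit : Clause.restrict C t = some {(i, a)}) :
      P0Step π τ prev (.trail (t ++ [⟨i, .u, a⟩]))
  /-- Learning rule: `R = C ∨ D` is obtained from `P = C ∨ x_i ^ a` and `Q = D ∨ x_i ^ (1 - a)`,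
  where `(C ∨ D)|_t = 0`, the trail `t` contains the assignment `x_i = a`, and all other variables
  of `P` appear in `t` before `x_i`. -/
  | learning (P Q R : Clause n) (i : Fin n) (a : Bool) (ann : Ann) (t₁ t₂ : Trail n)
      (hP : .clause P ∈ prev)
      (hQ : .clause Q ∈ prev)
      (ht : .trail (t₁ ++ ⟨i, ann, a⟩ :: t₂) ∈ prev)
      (hres : IsResolvent i a P Q R)
      (hzero : Clause.restrict R (t₁ ++ ⟨i, ann, a⟩ :: t₂) = some ∅)
      (hbefore : ∀ j ∈ Clause.vars P, j ≠ i → j ∈ Trail.vars t₁) :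
      P0Step π τ prev (.clause R)

/-- `G` is a `π-P₀` proof from `τ`. Its size is the number of lines (clauses and trails). -/
def IsP0Proof {n : ℕ} (π : Equiv.Perm (Fin n)) (τ : CNF n) (G : List (P0Line n)) : Prop :=
  ∀ v L, G[v]? = some L → P0Step π τ (G.take v) L

/-! ### Algorithms and running time

Algorithms are programs of a first-order functional language with recursion over binary trees.
The cost of an evaluation counts the evaluation steps, and reading a variable costs the size of
its value (so nothing is shared for free and a value never outgrows the cost of producing it).
This cost is polynomially related to the number of steps of a Turing machine. -/

/-- The data: finite binary trees. -/
inductive Data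
  | nil
  | cons (a b : Data)

/-- The number of nodes of a tree. -/
def Data.size : Data → ℕ
  | .nil => 1
  | .cons a b => a.size + b.size + 1

/-- Expressions; variables are de Bruijn indices into the environment. -/
inductive Expr
  /-- the value of a variable -/
  | var (i : ℕ)
  | nil
  | cons (e₁ e₂ : Expr)
  /-- case distinction on the value of `e`; `eCons` is evaluated with the two components of the
  value bound to the variables `0` and `1` -/
  | case (e eNil eCons : Expr)
  /-- comparison of two values -/
  | ifEq (e₁ e₂ eThen eElse : Expr)
  /-- local definition: `e₂` is evaluated with the value of `e₁` bound to the variable `0` -/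
  | letIn (e₁ e₂ : Expr)
  /-- call of the function number `f` with the value of `e` as its argument -/
  | call (f : ℕ) (e : Expr)

/-- A program: a finite list of (mutually recursive) function bodies. The argument of a function
is the only variable of its body. -/
abbrev Program := List Expr

/-- `Eval prog env e v t`: in the environment `env`, the expression `e` evaluates to `v` at
cost `t` (call by value). -/
inductive Eval (prog : Program) : List Data → Expr → Data → ℕ → Prop
  | var {env : List Data} {i : ℕ} {v : Data} (h : env[i]? = some v) :
      Eval prog env (.var i) v (v.size + 1)
  | nil {env : List Data} : Eval prog env .nil .nil 1
  | cons {env : List Data} {e₁ e₂ : Expr} {v₁ v₂ : Data} {t₁ t₂ : ℕ}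
      (h₁ : Eval prog env e₁ v₁ t₁) (h₂ : Eval prog env e₂ v₂ t₂) :
      Eval prog env (.cons e₁ e₂) (.cons v₁ v₂) (t₁ + t₂ + 1)
  | caseNil {env : List Data} {e eNil eCons : Expr} {v : Data} {t t₁ : ℕ}
      (h : Eval prog env e .nil t) (h₁ : Eval prog env eNil v t₁) :
      Eval prog env (.case e eNil eCons) v (t + t₁ + 1)
  | caseCons {env : List Data} {e eNil eCons : Expr} {a b v : Data} {t t₁ : ℕ}
      (h : Eval prog env e (.cons a b) t) (h₁ : Eval prog (a :: b :: env) eCons v t₁) :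
      Eval prog env (.case e eNil eCons) v (t + t₁ + 1)
  | ifEqTrue {env : List Data} {e₁ e₂ eThen eElse : Expr} {w v : Data} {t₁ t₂ t₃ : ℕ}
      (h₁ : Eval prog env e₁ w t₁) (h₂ : Eval prog env e₂ w t₂) (h₃ : Eval prog env eThen v t₃) :
      Eval prog env (.ifEq e₁ e₂ eThen eElse) v (t₁ + t₂ + t₃ + 1)
  | ifEqFalse {env : List Data} {e₁ e₂ eThen eElse : Expr} {w₁ w₂ v : Data} {t₁ t₂ t₃ : ℕ}
      (h₁ : Eval prog env e₁ w₁ t₁) (h₂ : Eval prog env e₂ w₂ t₂) (hne : w₁ ≠ w₂)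
      (h₃ : Eval prog env eElse v t₃) :
      Eval prog env (.ifEq e₁ e₂ eThen eElse) v (t₁ + t₂ + t₃ + 1)
  | letIn {env : List Data} {e₁ e₂ : Expr} {w v : Data} {t₁ t₂ : ℕ}
      (h₁ : Eval prog env e₁ w t₁) (h₂ : Eval prog (w :: env) e₂ v t₂) :
      Eval prog env (.letIn e₁ e₂) v (t₁ + t₂ + 1)
  | call {env : List Data} {f : ℕ} {e body : Expr} {w v : Data} {t₁ t₂ : ℕ}
      (h₁ : Eval prog env e w t₁) (hf : prog[f]? = some body) (h₂ : Eval prog [w] body v t₂) :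
      Eval prog env (.call f e) v (t₁ + t₂ + 1)

/-- On input `x`, the program halts with output `y` after exactly `t` time steps; execution starts
with a call of the function number `0`. -/
def Program.RunsTo (prog : Program) (x y : Data) (t : ℕ) : Prop :=
  Eval prog [x] (.call 0 (.var 0)) y t

/-! ### Encodings of the inputs and outputs as trees -/

/-- Lists. -/
def encList : List Data → Data
  | [] => .nil
  | a :: l => .cons a (encList l)

/-- Natural numbers, in unary. -/
def encNat (k : ℕ) : Data := encList (List.replicate k .nil)

/-- Truth values. -/
def encBool : Bool → Data
  | false => .nil
  | true => .cons .nil .nil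

/-- A clause is encoded as the list which says, for each of the `n` variables, whether it occurs
positively, negatively, or not at all. -/
def encClause {n : ℕ} (C : Clause n) : Data :=
  encList (List.ofFn fun i : Fin n =>
    if (i, true) ∈ C.1 then .cons .nil (encBool true)
    else if (i, false) ∈ C.1 then .cons .nil (encBool false)
    else .nil)

/-- The order is encoded as the list of the positions of the `n` variables. -/
def encPerm {n : ℕ} (π : Equiv.Perm (Fin n)) : Data :=
  encList (List.ofFn fun i : Fin n => encNat (π i))

/-- Justifications in a resolution proof. -/
def encJust : Option (ℕ × ℕ) → Data
  | none => .nil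
  | some (j, k) => .cons (encNat j) (encNat k)

/-- Resolution proofs. -/
def encResProof {n : ℕ} (Pf : ResProof n) : Data :=
  encList (Pf.map fun L => .cons (encClause L.1) (encJust L.2))

/-- The input: the order, a list of the clauses of the CNF, and the resolution proof. -/
def encInput {n : ℕ} (π : Equiv.Perm (Fin n)) (cls : List (Clause n)) (Pf : ResProof n) : Data :=
  .cons (encPerm π) (.cons (encList (cls.map encClause)) (encResProof Pf))

/-- Annotations. -/
def encAnn : Ann → Data
  | .d => .nil
  | .u => .cons .nil .nil

/-- Annotated assignments. -/
def encAnnAssign {n : ℕ} (s : AnnAssign n) : Data :=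
  .cons (encNat s.var) (.cons (encAnn s.ann) (encBool s.val))

/-- Lines of `π-P₀` proofs. -/
def encP0Line {n : ℕ} : P0Line n → Data
  | .clause C => .cons .nil (encClause C)
  | .trail t => .cons (.cons .nil .nil) (encList (t.map encAnnAssign))

/-- The output: a `π-P₀` proof. -/
def encP0Proof {n : ℕ} (G : List (P0Line n)) : Data := encList (G.map encP0Line)

end CDCL

namespace CDCL

/-! ### Encoded types and polynomial time functions -/

/-! A resolvent of P and Q on z can be learned as soon as some trail falsifies all literals of P and
Q other than those on z, and assigns z after the other variables of P. The order restricts such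
trails, since decisions must follow it. Fix an initial segment K of the order and set it to zero by
decisions. A derived clause is a fact for z^b over K if its remaining literals are positive and lie
in K, so that it propagates z = b. If facts of opposite sign are known for the literals of P outside
K other than the pivot, then these propagate, P propagates z, and all remaining variables are
decided against Q (`Good.learn`). A fact used as P needs no other facts, so literals can always be
resolved away with facts (`strip_spec`). Once facts of both signs are known for all variables
outside K, whole derivations can be replayed (`simE_spec`). Over the empty segment a fact is a unit
clause, so the goal is to obtain facts of both signs over the empty segment.

A task consists of a segment `pre` and a connected derivation of a clause with no literal outside
`pre`; x is the first variable of its axioms outside `pre`, and K is the segment that ends with x.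
Set x to zero as well. Axioms with x^0 are dropped and the other axioms are shortened by the known
facts over K. If an axiom shrinks to x^1, this is a fact for x^1 over `pre`, and from then on x^0 is
resolved away instead of dropping axioms. Otherwise the derivation is evaluated on the shortened
axioms. The first resolution step that ends in a contradiction modulo K, pruned to the lines it
depends on, is a task over K without variables that already have facts; solving it yields facts for
at least one new variable. If there is no such step, connectedness forces every variable outside K
to have been removed and, while axioms are being dropped, x to be absent altogether
(`Skel.of_noconf`). As x does occur, x^1 is learned before this happens, and in the end all other
variables of the task have facts of both signs over K.

For x^0, drop the axioms with x^1 and resolve x^0 away from the others. Then x is gone, so the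
derivation can be replayed over K, and the two premises of its first contradiction are opposite
facts over `pre` for some z. They remove z from all axioms, and the search repeats; as each round
removes a new variable different from x, some axiom shrinks to x^0 within n rounds (`round_spec`,
`search_spec`). Resolving with it removes x from the facts over K, which become facts over `pre`,
and the task is complete.

A task with a set V of variables takes at most 3|V| - 1 steps: one for learning x^1, one for
completion, and for each subtask its own steps and one more to open it, which is three for each
variable that gains facts (`FrameOK.complete`). A step makes O(n|Π|) resolvents, at O(n) lines each.
Finally |V| ≤ |τ|: if the axioms had fewer elements than variables, Hall's theorem would give an
assignment that satisfies every axiom it touches, and at least one; but resolution along a connected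
graph would carry a satisfied literal down to the empty clause (`card_biUnion_vars_le`). Polynomial
time follows from closure properties of `PT`; the only real issue is to bound the state of each
loop. -/

/-- Types whose elements are encoded as binary trees. -/
class Enc (α : Type) where
  /-- the encoding -/
  enc : α → Data

open Enc

instance : Enc Data := ⟨id⟩
instance : Enc Unit := ⟨fun _ => .nil⟩
instance : Enc Bool := ⟨encBool⟩
instance : Enc ℕ := ⟨encNat⟩
instance {α : Type} [Enc α] : Enc (Option α) :=
  ⟨fun o => match o with | none => .nil | some a => .cons .nil (enc a)⟩
instance {α β : Type} [Enc α] [Enc β] : Enc (α × β) := ⟨fun p => .cons (enc p.1) (enc p.2)⟩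
instance {α β : Type} [Enc α] [Enc β] : Enc (α ⊕ β) :=
  ⟨fun s => match s with | .inl a => .cons .nil (enc a) | .inr b => .cons (.cons .nil .nil) (enc b)⟩
instance {α : Type} [Enc α] : Enc (List α) := ⟨fun l => encList (l.map enc)⟩
-- The proof component is invisible in the encoding. A subtype can therefore express an invariant of
-- an intermediate state of a recursion without changing the program.
instance {α : Type} [Enc α] (P : α → Prop) : Enc {a // P a} := ⟨fun a => enc a.1⟩

/-- The size of the encoding. -/
def sz {α : Type} [Enc α] (a : α) : ℕ := (enc a).size

theorem Data.size_pos (d : Data) : 0 < d.size := by cases d <;> simp [Data.size]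

section encodings
variable {α β : Type} [Enc α] [Enc β]

theorem sz_pos (a : α) : 0 < sz a := Data.size_pos _
@[simp] theorem enc_nil : enc ([] : List α) = .nil := rfl
@[simp] theorem enc_cons (a : α) (l : List α) : enc (a :: l) = .cons (enc a) (enc l) := rfl
@[simp] theorem enc_pair (a : α) (b : β) : enc (a, b) = .cons (enc a) (enc b) := rfl
@[simp] theorem enc_none : enc (none : Option α) = .nil := rfl
@[simp] theorem enc_some (a : α) : enc (some a) = .cons .nil (enc a) := rfl
@[simp] theorem enc_inl (a : α) : enc (Sum.inl a : α ⊕ β) = .cons .nil (enc a) := rfl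
@[simp] theorem enc_inr (b : β) : enc (Sum.inr b : α ⊕ β) = .cons (.cons .nil .nil) (enc b) := rfl
@[simp] theorem enc_zero : enc (0 : ℕ) = .nil := rfl
@[simp] theorem enc_succ (k : ℕ) : enc (k + 1) = .cons .nil (enc k) := by
  simp [enc, encNat, List.replicate_succ, encList]
@[simp] theorem enc_false : enc false = .nil := rfl
@[simp] theorem enc_true : enc true = .cons .nil .nil := rfl
@[simp] theorem enc_unit (u : Unit) : enc u = .nil := rfl
@[simp] theorem enc_data (d : Data) : enc d = d := rfl

@[simp] theorem sz_nil : sz ([] : List α) = 1 := rfl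
@[simp] theorem sz_cons (a : α) (l : List α) : sz (a :: l) = sz a + sz l + 1 := rfl
@[simp] theorem sz_pair (a : α) (b : β) : sz (a, b) = sz a + sz b + 1 := rfl
@[simp] theorem sz_none : sz (none : Option α) = 1 := rfl
@[simp] theorem sz_some (a : α) : sz (some a) = sz a + 2 := by simp [sz, Data.size]; omega
@[simp] theorem sz_inl (a : α) : sz (Sum.inl a : α ⊕ β) = sz a + 2 := by
  simp [sz, Data.size]; omega
@[simp] theorem sz_inr (b : β) : sz (Sum.inr b : α ⊕ β) = sz b + 4 := by
  simp [sz, Data.size]; omega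
@[simp] theorem sz_nat (k : ℕ) : sz k = 2 * k + 1 := by
  induction k with
  | zero => rfl
  | succ k ih => simp only [sz, enc_succ, Data.size] at *; omega
@[simp] theorem sz_unit (u : Unit) : sz u = 1 := rfl
@[simp] theorem sz_subtype (P : α → Prop) (a : {a // P a}) : sz a = sz a.1 := rfl
theorem sz_bool (b : Bool) : sz b ≤ 3 := by cases b <;> simp [sz, Data.size]

theorem sz_append (l l' : List α) : sz (l ++ l') + 1 = sz l + sz l' := by
  induction l with
  | nil => simp; omega
  | cons a l ih => simp only [List.cons_append, sz_cons]; omega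

theorem length_lt_sz (l : List α) : l.length < sz l := by
  induction l with
  | nil => simp
  | cons a l ih => have := sz_pos a; simp only [List.length_cons, sz_cons]; omega

theorem sz_mem_lt {a : α} {l : List α} (h : a ∈ l) : sz a < sz l := by
  induction l with
  | nil => simp at h
  | cons b l ih =>
    simp only [sz_cons]
    rcases List.mem_cons.1 h with rfl | h
    · omega
    · have := ih h; omega

theorem sz_list_le {l : List α} {B : ℕ} (h : ∀ a ∈ l, sz a ≤ B) :
    sz l ≤ l.length * (B + 1) + 1 := by
  induction l with
  | nil => simp
  | cons a l ih =>
    have h1 := h a (by simp)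
    have h2 := ih fun b hb => h b (by simp [hb])
    simp only [sz_cons, List.length_cons, Nat.succ_mul]; omega

theorem sz_sublist {l l' : List α} (h : l.Sublist l') : sz l ≤ sz l' := by
  induction h with
  | slnil => simp
  | cons a _ ih => simp; omega
  | cons_cons a _ ih => simp; omega

end encodings

/-- Types whose encoding is injective. -/
class EncInj (α : Type) [Enc α] : Prop where
  /-- the encoding is injective -/
  inj : Function.Injective (enc : α → Data)

instance : EncInj Bool := ⟨by intro a b h; cases a <;> cases b <;> simp_all⟩
instance : EncInj ℕ := ⟨by
  intro a
  induction a with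
  | zero => intro b h; cases b <;> simp_all
  | succ a ih =>
    intro b h
    cases b with
    | zero => simp at h
    | succ b => simp only [enc_succ, Data.cons.injEq, true_and] at h; rw [ih h]⟩
instance {α : Type} [Enc α] [EncInj α] : EncInj (Option α) := ⟨by
  intro a b h
  cases a <;> cases b <;> simp_all
  exact EncInj.inj h⟩

theorem eval_mono (q : Polynomial ℕ) {a b : ℕ} (h : a ≤ b) : q.eval a ≤ q.eval b := by
  rw [Polynomial.eval_eq_sum, Polynomial.eval_eq_sum, Polynomial.sum, Polynomial.sum]
  exact Finset.sum_le_sum fun i _ => Nat.mul_le_mul_left _ (Nat.pow_le_pow_left h i)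

/-- A quantity that is polynomially bounded in the size of the input. -/
def PB {α : Type} [Enc α] (f : α → ℕ) : Prop := ∃ q : Polynomial ℕ, ∀ a, f a ≤ q.eval (sz a)

namespace PB
variable {α β : Type} [Enc α] [Enc β] {f g : α → ℕ}

theorem const (c : ℕ) : PB fun _ : α => c := ⟨Polynomial.C c, fun a => by simp⟩
theorem size : PB (sz : α → ℕ) := ⟨Polynomial.X, fun a => by simp⟩
theorem add (hf : PB f) (hg : PB g) : PB fun a => f a + g a := by
  obtain ⟨p, hp⟩ := hf
  obtain ⟨q, hq⟩ := hg
  exact ⟨p + q, fun a => by rw [Polynomial.eval_add]; exact Nat.add_le_add (hp a) (hq a)⟩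
theorem mul (hf : PB f) (hg : PB g) : PB fun a => f a * g a := by
  obtain ⟨p, hp⟩ := hf
  obtain ⟨q, hq⟩ := hg
  exact ⟨p * q, fun a => by rw [Polynomial.eval_mul]; exact Nat.mul_le_mul (hp a) (hq a)⟩
theorem poly (p : Polynomial ℕ) (hf : PB f) : PB fun a => p.eval (f a) := by
  obtain ⟨q, hq⟩ := hf
  exact ⟨p.comp q, fun a => by rw [Polynomial.eval_comp]; exact eval_mono p (hq a)⟩

end PB

/-! ### Relocatable code and polynomial time functions. -/

/-- The code `L` is present in the program from the position `k` on. -/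
def Loaded (prog : Program) (k : ℕ) (L : List Expr) : Prop :=
  ∀ (i : ℕ) (b : Expr), L[i]? = some b → prog[k + i]? = some b

theorem Loaded.left {prog : Program} {k : ℕ} {L₁ L₂ : List Expr} (h : Loaded prog k (L₁ ++ L₂)) :
    Loaded prog k L₁ := by
  intro i b hb
  exact h i b (by
    rw [List.getElem?_append_left]
    · exact hb
    · exact (List.getElem?_eq_some_iff.1 hb).1)

theorem Loaded.right {prog : Program} {k : ℕ} {L₁ L₂ : List Expr}
    (h : Loaded prog k (L₁ ++ L₂)) : Loaded prog (k + L₁.length) L₂ := by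
  intro i b hb
  rw [add_assoc]
  exact h _ b (by rw [List.getElem?_append_right (by omega)]; simpa using hb)

/-- `f` is computable in polynomial time, by code that can be placed anywhere in a program. -/
def PT {α β : Type} [Enc α] [Enc β] (f : α → β) : Prop :=
  ∃ (code : ℕ → List Expr) (len : ℕ) (q : Polynomial ℕ), (∀ k, (code k).length = len) ∧
    ∀ prog k, Loaded prog k (code k) → ∀ a, ∃ t ≤ q.eval (sz a), ∃ body,
      prog[k]? = some body ∧ Eval prog [enc a] body (enc (f a)) t

/-- Calls of the function number `k` compute `f` within the time bound `q`. -/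
def Calls {α β : Type} [Enc α] [Enc β] (prog : Program) (k : ℕ) (f : α → β)
    (q : Polynomial ℕ) : Prop :=
  ∀ env e a t₀, Eval prog env e (enc a) t₀ →
    ∃ t ≤ t₀ + q.eval (sz a), Eval prog env (.call k e) (enc (f a)) t

/-- Every node of a value is paid for when it is built or read. So a time bound is also a bound on
the size of the output, which is what makes compositions polynomial. -/
theorem Eval.size_le {prog : Program} {env : List Data} {e : Expr} {v : Data} {t : ℕ}
    (h : Eval prog env e v t) : v.size ≤ t := by
  induction h <;> (try simp only [Data.size] at *) <;> omega

/-! ### Closure properties: composition, pairs, case distinctions, equality, folds. -/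

namespace PT
variable {α β γ δ : Type} [Enc α] [Enc β] [Enc γ] [Enc δ]

/-- The only place where code is laid out: the new body comes first, followed by the code of the two
functions it may call. As the body also knows its own position, it may be recursive. -/
theorem link {ι κ : Type} [Enc ι] [Enc κ] {f : α → β} {g : γ → δ} {h : ι → κ}
    (hf : PT f) (hg : PT g) (body : ℕ → ℕ → ℕ → Expr)
    (H : ∀ qf qg : Polynomial ℕ, ∃ q : Polynomial ℕ, ∀ prog self kf kg,
      prog[self]? = some (body self kf kg) → Calls prog kf f qf → Calls prog kg g qg →
      ∀ a, ∃ t ≤ q.eval (sz a), Eval prog [enc a] (body self kf kg) (enc (h a)) t) : PT h := by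
  obtain ⟨cf, lf, qf, hlf, hf⟩ := hf
  obtain ⟨cg, lg, qg, hlg, hg⟩ := hg
  -- A call costs one more than the evaluation of the body that it runs.
  obtain ⟨q, hq⟩ := H (qf + 1) (qg + 1)
  refine ⟨fun k => [body k (k + 1) (k + 1 + lf)] ++ (cf (k + 1) ++ cg (k + 1 + lf)),
    1 + (lf + lg), q, fun k => by simp only [List.length_append, hlf, hlg]; rfl, ?_⟩
  intro prog k hl a
  have h0 : prog[k]? = some (body k (k + 1) (k + 1 + lf)) := hl 0 _ (by simp)
  have h1 := hl.right.left
  have h2 := hl.right.right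
  rw [hlf] at h2
  obtain ⟨t, ht, hev⟩ := hq prog k (k + 1) (k + 1 + lf) h0
    (fun env e a t₀ he => by
      obtain ⟨t, ht, b, hb, hev⟩ := hf _ _ h1 a
      exact ⟨_, by simp; omega, .call he hb hev⟩)
    (fun env e a t₀ he => by
      obtain ⟨t, ht, b, hb, hev⟩ := hg _ _ h2 a
      exact ⟨_, by simp; omega, .call he hb hev⟩) a
  exact ⟨t, ht, _, h0, hev⟩

theorem of_expr {f : α → β} (e : Expr) (q : Polynomial ℕ)
    (h : ∀ prog a, ∃ t ≤ q.eval (sz a), Eval prog [enc a] e (enc (f a)) t) : PT f :=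
  ⟨fun _ => [e], 1, q, fun _ => rfl, fun prog k hl a => by
    obtain ⟨t, ht, hev⟩ := h prog a
    exact ⟨t, ht, e, hl 0 e rfl, hev⟩⟩

theorem cast {f g : α → β} (hf : PT f) (h : ∀ a, g a = f a) : PT g := by
  rwa [show g = f from funext h]

/-- Programs see nothing but encodings, so the same code serves for any other types with the same
encodings. -/
theorem recode {f : α → β} {g : γ → δ} (hf : PT f) (e : γ → α) (he : ∀ c, enc (e c) = enc c)
    (h : ∀ c, enc (g c) = enc (f (e c))) : PT g := by
  obtain ⟨cf, lf, qf, hlf, hf⟩ := hf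
  refine ⟨cf, lf, qf, hlf, fun prog k hl c => ?_⟩
  have := hf prog k hl (e c)
  simpa only [sz, he, h] using this

theorem id : PT fun a : α => a :=
  of_expr (.var 0) (Polynomial.X + 1) fun prog a => ⟨_, by simp [sz], .var (by simp)⟩

/-- A closed expression whose value is `d`. -/
def constExpr : Data → Expr
  | .nil => .nil
  | .cons a b => .cons (constExpr a) (constExpr b)

theorem eval_constExpr (prog : Program) (env : List Data) (d : Data) :
    Eval prog env (constExpr d) d d.size := by
  induction d with
  | nil => exact .nil
  | cons a b ha hb => exact .cons ha hb

theorem const (b : β) : PT fun _ : α => b :=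
  of_expr (constExpr (enc b)) (Polynomial.C (sz b)) fun prog a =>
    ⟨_, by simp [sz], eval_constExpr _ _ _⟩

theorem comp {f : β → γ} {g : α → β} (hf : PT f) (hg : PT g) : PT fun a => f (g a) := by
  refine link (f := f) (g := g) (h := fun a => f (g a)) hf hg
    (fun _ kf kg => .call kf (.call kg (.var 0))) ?_
  · intro qf qg
    refine ⟨Polynomial.X + 1 + qg + qf.comp (Polynomial.X + 1 + qg), ?_⟩
    intro prog self kf kg _ hF hG a
    obtain ⟨t, ht, h1⟩ := hG [enc a] (.var 0) a _ (.var (by simp))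
    obtain ⟨t', ht', h2⟩ := hF _ _ _ _ h1
    refine ⟨t', ht'.trans ?_, h2⟩
    have h3 : sz (g a) ≤ t := h1.size_le
    simp only [Polynomial.eval_add, Polynomial.eval_X, Polynomial.eval_one, Polynomial.eval_comp]
    have h4 : t ≤ sz a + 1 + qg.eval (sz a) := ht
    have := eval_mono qf (h3.trans h4)
    omega

theorem pair {f : α → β} {g : α → γ} (hf : PT f) (hg : PT g) : PT fun a => (f a, g a) := by
  refine link (f := f) (g := g) (h := fun a => (f a, g a)) hf hg
    (fun _ kf kg => .cons (.call kf (.var 0)) (.call kg (.var 0))) ?_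
  · intro qf qg
    refine ⟨2 * (Polynomial.X + 1) + qg + qf + 1, ?_⟩
    intro prog self kf kg _ hF hG a
    obtain ⟨t, ht, h1⟩ := hG [enc a] (.var 0) a _ (.var (by simp))
    obtain ⟨t', ht', h2⟩ := hF [enc a] (.var 0) a _ (.var (by simp))
    refine ⟨_, ?_, .cons h2 h1⟩
    simp only [Polynomial.eval_add, Polynomial.eval_X, Polynomial.eval_one, Polynomial.eval_mul,
      Polynomial.eval_ofNat]
    simp only [sz] at *
    omega

theorem pb {f : α → β} (hf : PT f) : PB fun a => sz (f a) := by
  obtain ⟨cf, lf, qf, hlf, hf⟩ := hf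
  refine ⟨qf, fun a => ?_⟩
  obtain ⟨t, ht, b, -, hev⟩ := hf (cf 0) 0 (fun i b h => by simpa using h) a
  exact hev.size_le.trans ht

theorem fst_aux : PT fun p : α × β => p.1 :=
  of_expr (.case (.var 0) .nil (.var 0)) (2 * Polynomial.X + 3) fun prog ⟨a, b⟩ =>
    ⟨_, by simp [sz, Data.size]; omega, .caseCons (.var (v := .cons (enc a) (enc b)) (by simp))
      (.var (by simp))⟩

theorem snd_aux : PT fun p : α × β => p.2 :=
  of_expr (.case (.var 0) .nil (.var 1)) (2 * Polynomial.X + 3) fun prog ⟨a, b⟩ =>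
    ⟨_, by simp [sz, Data.size]; omega, .caseCons (.var (v := .cons (enc a) (enc b)) (by simp))
      (.var (by simp))⟩

theorem fst {f : α → β × γ} (hf : PT f) : PT fun a => (f a).1 := comp fst_aux hf
theorem snd {f : α → β × γ} (hf : PT f) : PT fun a => (f a).2 := comp snd_aux hf

theorem inl {f : α → β} (hf : PT f) : PT fun a => (Sum.inl (f a) : β ⊕ γ) :=
  (pair (const ()) hf).recode (fun a => a) (fun _ => rfl) fun _ => rfl
theorem inr {f : α → γ} (hf : PT f) : PT fun a => (Sum.inr (f a) : β ⊕ γ) :=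
  (pair (const true) hf).recode (fun a => a) (fun _ => rfl) fun _ => rfl
theorem some {f : α → β} (hf : PT f) : PT fun a => Option.some (f a) :=
  (pair (const ()) hf).recode (fun a => a) (fun _ => rfl) fun _ => rfl
theorem cons {f : α → β} {g : α → List β} (hf : PT f) (hg : PT g) : PT fun a => f a :: g a :=
  (pair hf hg).recode (fun a => a) (fun _ => rfl) fun _ => rfl
theorem succ {f : α → ℕ} (hf : PT f) : PT fun a => f a + 1 :=
  (pair (const ()) hf).recode (fun a => a) (fun _ => rfl) fun _ => by simp

theorem cond_aux : PT fun p : Bool × β × β => cond p.1 p.2.1 p.2.2 :=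
  of_expr (.case (.var 0) .nil (.case (.var 1) .nil
      (.case (.var 2) (.var 1) (.var 2)))) (4 * Polynomial.X + 7)
    fun prog ⟨b, x, y⟩ => by
      cases b
      · exact ⟨_, by simp [sz, Data.size]; omega,
          .caseCons (.var (v := .cons .nil (.cons (enc x) (enc y))) (by simp))
          (.caseCons (.var (v := .cons (enc x) (enc y)) (by simp))
            (.caseNil (.var (by simp)) (.var (by simp))))⟩
      · exact ⟨_, by simp [sz, Data.size]; omega,
          .caseCons (.var (v := .cons (.cons .nil .nil) (.cons (enc x) (enc y))) (by simp))
          (.caseCons (.var (v := .cons (enc x) (enc y)) (by simp))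
            (.caseCons (.var (v := .cons .nil .nil) (by simp)) (.var (by simp))))⟩

theorem cond {b : α → Bool} {f g : α → β} (hb : PT b) (hf : PT f) (hg : PT g) :
    PT fun a => bif b a then f a else g a := comp cond_aux (pair hb (pair hf hg))

theorem not {b : α → Bool} (hb : PT b) : PT fun a => !b a :=
  (cond hb (const false) (const true)).cast fun a => by cases b a <;> rfl
theorem and {b c : α → Bool} (hb : PT b) (hc : PT c) : PT fun a => b a && c a :=
  (cond hb hc (const false)).cast fun a => by cases b a <;> rfl
theorem or {b c : α → Bool} (hb : PT b) (hc : PT c) : PT fun a => b a || c a :=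
  (cond hb (const true) hc).cast fun a => by cases b a <;> rfl

theorem eq_aux [EncInj β] [DecidableEq β] : PT fun p : β × β => decide (p.1 = p.2) :=
  of_expr (.case (.var 0) .nil (.ifEq (.var 0) (.var 1) (constExpr (.cons .nil .nil)) .nil))
    (2 * Polynomial.X + 10) fun prog ⟨x, y⟩ => by
      by_cases h : x = y
      · subst h
        refine ⟨_, ?_, .caseCons (.var (v := .cons (enc x) (enc x)) (by simp))
          (.ifEqTrue (.var (v := enc x) (by simp)) (.var (by simp))
            (by simpa using eval_constExpr prog _ (.cons .nil .nil)))⟩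
        simp [sz, Data.size]; omega
      · refine ⟨_, ?_, .caseCons (.var (v := .cons (enc x) (enc y)) (by simp))
          (.ifEqFalse (.var (by simp)) (.var (by simp)) (fun h' => h (EncInj.inj h'))
            (by simpa [h] using Eval.nil))⟩
        simp [sz, Data.size]; omega

theorem eq [EncInj β] [DecidableEq β] {f g : α → β} (hf : PT f) (hg : PT g) :
    PT fun a => decide (f a = g a) := comp eq_aux (pair hf hg)

theorem tail_aux : PT fun l : List β => l.tail :=
  of_expr (.case (.var 0) .nil (.var 1)) (2 * Polynomial.X + 4) fun prog l => by
    cases l with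
    | nil => exact ⟨_, by simp [sz, Data.size], .caseNil (.var (by simp)) .nil⟩
    | cons x l => exact ⟨_, by simp [sz, Data.size]; omega,
        .caseCons (.var (v := .cons (enc x) (enc l)) (by simp)) (.var (by simp))⟩

theorem tail {f : α → List β} (hf : PT f) : PT fun a => (f a).tail := comp tail_aux hf

theorem headD_aux : PT fun p : List β × β => p.1.headD p.2 :=
  of_expr (.case (.var 0) .nil (.case (.var 0) (.var 1) (.var 0)))
    (3 * Polynomial.X + 5) fun prog ⟨l, d⟩ => by
    cases l with
    | nil => exact ⟨_, by simp [sz, Data.size]; omega,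
        .caseCons (.var (v := .cons .nil (enc d)) (by simp))
          (.caseNil (.var (by simp)) (.var (by simp)))⟩
    | cons x l => exact ⟨_, by simp [sz, Data.size]; omega,
        .caseCons (.var (v := .cons (.cons (enc x) (enc l)) (enc d)) (by simp))
          (.caseCons (.var (v := .cons (enc x) (enc l)) (by simp)) (.var (by simp)))⟩

theorem headD {f : α → List β} {g : α → β} (hf : PT f) (hg : PT g) :
    PT fun a => (f a).headD (g a) := comp headD_aux (pair hf hg)

theorem elim_aux {s : γ × β → δ} (hs : PT s) :
    PT fun p : γ × Option β × δ => p.2.1.elim p.2.2 fun b => s (p.1, b) := by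
  refine link hs hs (fun _ kf _ => .case (.var 0) .nil (.case (.var 1) .nil
      (.case (.var 0) (.var 1) (.call kf (.cons (.var 4) (.var 1)))))) ?_
  intro q _
  refine ⟨6 * Polynomial.X + 12 + q, ?_⟩
  rintro prog self kf kg - hF - ⟨c, o, d⟩
  cases o with
  | none => exact ⟨_, by simp [sz, Data.size]; omega,
      .caseCons (.var (v := .cons (enc c) (.cons .nil (enc d))) (by simp))
      (.caseCons (.var (v := .cons .nil (enc d)) (by simp))
        (.caseNil (.var (by simp)) (.var (by simp))))⟩
  | some b =>
    obtain ⟨t, ht, h⟩ := hF [.nil, enc b, .cons .nil (enc b), enc d, enc c,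
      .cons (.cons .nil (enc b)) (enc d), enc (c, Option.some b, d)] (.cons (.var 4) (.var 1))
      (c, b) _ (.cons (.var (by simp)) (.var (by simp)))
    refine ⟨_, ?_, .caseCons (.var (v := .cons (enc c) (.cons (.cons .nil (enc b)) (enc d)))
        (by simp))
      (.caseCons (.var (v := .cons (.cons .nil (enc b)) (enc d)) (by simp))
        (.caseCons (.var (v := .cons .nil (enc b)) (by simp)) h))⟩
    have := eval_mono q (show sz (c, b) ≤ sz (c, Option.some b, d) by simp; omega)
    simp [sz, Data.size] at *
    omega

theorem elim {o : α → Option β} {n : α → δ} {s : α → β → δ} (ho : PT o) (hn : PT n)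
    (hs : PT fun p : α × β => s p.1 p.2) : PT fun a => (o a).elim (n a) (s a) :=
  comp (elim_aux hs) (pair id (pair ho hn))

theorem sumElim_aux {s : γ × α → δ} {r : γ × β → δ} (hs : PT s) (hr : PT r) :
    PT fun p : γ × (α ⊕ β) => p.2.elim (fun a => s (p.1, a)) fun b => r (p.1, b) := by
  refine link hs hr (fun _ kf kg => .case (.var 0) .nil (.case (.var 1) .nil
      (.case (.var 0) (.call kf (.cons (.var 2) (.var 1)))
        (.call kg (.cons (.var 4) (.var 3)))))) ?_
  intro qs qr
  refine ⟨6 * Polynomial.X + 12 + qs + qr, ?_⟩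
  rintro prog self kf kg - hF hG ⟨c, o⟩
  cases o with
  | inl b =>
    obtain ⟨t, ht, h⟩ := hF [.nil, enc b, enc c, .cons .nil (enc b), enc (c, (Sum.inl b : α ⊕ β))]
      (.cons (.var 2) (.var 1)) (c, b) _ (.cons (.var (by simp)) (.var (by simp)))
    refine ⟨_, ?_, .caseCons (.var (v := .cons (enc c) (.cons .nil (enc b))) (by simp))
      (.caseCons (.var (v := .cons .nil (enc b)) (by simp))
        (.caseNil (.var (by simp)) h))⟩
    have := eval_mono qs (show sz (c, b) ≤ sz (c, (Sum.inl b : α ⊕ β)) by simp)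
    simp [sz, Data.size] at *
    omega
  | inr b =>
    obtain ⟨t, ht, h⟩ := hG [.nil, .nil, .cons .nil .nil, enc b, enc c,
      .cons (.cons .nil .nil) (enc b), enc (c, (Sum.inr b : α ⊕ β))]
      (.cons (.var 4) (.var 3)) (c, b) _ (.cons (.var (by simp)) (.var (by simp)))
    refine ⟨_, ?_, .caseCons (.var (v := .cons (enc c) (.cons (.cons .nil .nil) (enc b)))
        (by simp))
      (.caseCons (.var (v := .cons (.cons .nil .nil) (enc b)) (by simp))
        (.caseCons (.var (v := .cons .nil .nil) (by simp)) h))⟩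
    have := eval_mono qr (show sz (c, b) ≤ sz (c, (Sum.inr b : α ⊕ β)) by simp)
    simp [sz, Data.size] at *
    omega

theorem sumElim {o : α → β ⊕ γ} {s : α → β → δ} {r : α → γ → δ} (ho : PT o)
    (hs : PT fun p : α × β => s p.1 p.2) (hr : PT fun p : α × γ => r p.1 p.2) :
    PT fun a => (o a).elim (s a) (r a) :=
  comp (sumElim_aux hs hr) (pair id ho)

/-- The recursion runs on states made of the remaining list, the parameter and the accumulator. Only
accumulators reached by folding a prefix have bounded size, so the domain is the subtype of
reachable states. -/
theorem foldl_aux {g : α → List β} {i : α → γ} {h : α → γ → β → γ}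
    (hg : PT g) (hh : PT fun p : α × γ × β => h p.1 p.2.1 p.2.2)
    (hB : ∃ B : α → ℕ, PB B ∧ ∀ a l l', g a = l ++ l' → sz (l.foldl (h a) (i a)) ≤ B a) :
    PT fun p : {p : List β × α × γ // ∃ l, g p.2.1 = l ++ p.1 ∧
      p.2.2 = l.foldl (h p.2.1) (i p.2.1)} => p.1.1.foldl (h p.1.2.1) p.1.2.2 := by
  refine link hh hh (fun self kh _ => .case (.var 0) .nil (.case (.var 1) .nil
      (.case (.var 2) (.var 1) (.call self (.cons (.var 1) (.cons (.var 2)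
        (.call kh (.cons (.var 2) (.cons (.var 3) (.var 0)))))))))) ?_
  intro qh _
  obtain ⟨B, ⟨qB, hqB⟩, hB⟩ := hB
  obtain ⟨qG, hqG⟩ := hg.pb
  -- The factor `X` bounds the number of iterations. The other factor bounds one iteration, at a
  -- size that dominates the remaining list, the parameter and every reachable accumulator.
  refine ⟨Polynomial.X * ((qh + 20 * Polynomial.X + 40).comp
    (2 * qG + 2 * Polynomial.X + 2 * qB + 5)), ?_⟩
  intro prog self kh _ hself hH _
  have key : ∀ (a : α) (l' l : List β) (hl : g a = l ++ l'),
      ∃ t ≤ (l'.length + 1) *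
        (qh + 20 * Polynomial.X + 40).eval (2 * qG.eval (sz a) + 2 * sz a + 2 * qB.eval (sz a) + 5),
      Eval prog [.cons (enc l') (.cons (enc a) (enc (l.foldl (h a) (i a))))]
        (.case (.var 0) .nil (.case (.var 1) .nil
      (.case (.var 2) (.var 1) (.call self (.cons (.var 1) (.cons (.var 2)
        (.call kh (.cons (.var 2) (.cons (.var 3) (.var 0))))))))))
        (enc (l'.foldl (h a) (l.foldl (h a) (i a)))) t := by
    intro a l'
    induction l' with
    | nil =>
      intro l hl
      have h1 := (hB a l [] hl).trans (hqB a)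
      refine ⟨_, ?_, .caseCons (.var rfl) (.caseCons (.var rfl)
        (.caseNil (.var rfl) (.var rfl)))⟩
      simp [Data.size]
      simp only [sz] at *
      omega
    | cons x l' ih =>
      intro l hl
      have h1 := (hB a l _ hl).trans (hqB a)
      have hl' : g a = (l ++ [x]) ++ l' := by simp [hl]
      have h2 := (hB a _ _ hl').trans (hqB a)
      obtain ⟨t, ht, hev⟩ := ih _ hl'
      have h3 : sz (x :: l') ≤ qG.eval (sz a) := by
        refine le_trans ?_ (hqG a)
        simp only [hl]
        exact sz_sublist (List.sublist_append_right _ _)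
      simp only [sz_cons] at h3
      rw [List.foldl_append, List.foldl_cons, List.foldl_nil] at hev h2
      obtain ⟨t', ht', hev'⟩ := hH [enc x, enc l', enc a, enc (l.foldl (h a) (i a)),
        enc (x :: l'), .cons (enc a) (enc (l.foldl (h a) (i a))),
        .cons (enc (x :: l')) (.cons (enc a) (enc (l.foldl (h a) (i a))))]
        (.cons (.var 2) (.cons (.var 3) (.var 0))) (a, l.foldl (h a) (i a), x) _
        (.cons (.var rfl) (.cons (.var rfl) (.var rfl)))
      refine ⟨_, ?_, .caseCons (.var rfl) (.caseCons (.var rfl)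
        (.caseCons (.var rfl) (.call (.cons (.var rfl)
          (.cons (.var rfl) hev')) hself hev)))⟩
      have h4 := eval_mono qh (show sz (a, l.foldl (h a) (i a), x) ≤
        2 * qG.eval (sz a) + 2 * sz a + 2 * qB.eval (sz a) + 5 by simp only [sz_pair]; omega)
      rw [List.length_cons, add_mul _ 1, one_mul]
      refine le_trans ?_ (Nat.add_le_add_right ht _)
      simp only [Polynomial.eval_add, Polynomial.eval_mul, Polynomial.eval_X,
        Polynomial.eval_ofNat]
      have h5 : (encList (l'.map enc)).size = (enc l').size := rfl
      simp only [sz, Data.size, enc_cons, enc_pair] at *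
      omega
  rintro ⟨⟨l', a, s⟩, l, hl, hs⟩
  simp only at hl hs
  subst hs
  obtain ⟨t, ht, hev⟩ := key a l' l hl
  refine ⟨t, ht.trans ?_, hev⟩
  simp only [sz_subtype, sz_pair, Polynomial.eval_mul, Polynomial.eval_X, Polynomial.eval_comp]
  have h5 := length_lt_sz l'
  refine Nat.mul_le_mul (by omega) (eval_mono _ ?_)
  simp only [Polynomial.eval_add, Polynomial.eval_mul, Polynomial.eval_X, Polynomial.eval_ofNat]
  have h6 := eval_mono qG (show sz a ≤ sz l' + (sz a + sz (l.foldl (h a) (i a)) + 1) + 1 by omega)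
  have h7 := eval_mono qB (show sz a ≤ sz l' + (sz a + sz (l.foldl (h a) (i a)) + 1) + 1 by omega)
  omega

theorem foldl {g : α → List β} {i : α → γ} {h : α → γ → β → γ}
    (hg : PT g) (hi : PT i) (hh : PT fun p : α × γ × β => h p.1 p.2.1 p.2.2)
    (hB : ∃ B : α → ℕ, PB B ∧ ∀ a l l', g a = l ++ l' → sz (l.foldl (h a) (i a)) ≤ B a) :
    PT fun a => (g a).foldl (h a) (i a) := by
  have h1 : PT fun a : α => (⟨(g a, a, i a), [], rfl, rfl⟩ :
      {p : List β × α × γ // ∃ l, g p.2.1 = l ++ p.1 ∧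
        p.2.2 = l.foldl (h p.2.1) (i p.2.1)}) :=
    (pair hg (pair id hi)).recode (fun a => a) (fun _ => rfl) fun _ => rfl
  exact comp (foldl_aux hg hh hB) h1

/-- A fold whose accumulator satisfies an invariant that bounds its size. -/
theorem foldl_inv {g : α → List β} {i : α → γ} {h : α → γ → β → γ}
    (hg : PT g) (hi : PT i) (hh : PT fun p : α × γ × β => h p.1 p.2.1 p.2.2)
    (I : α → γ → Prop) (B : α → ℕ) (hB : PB B) (h0 : ∀ a, I a (i a))
    (hs : ∀ a s x, x ∈ g a → I a s → I a (h a s x)) (hI : ∀ a s, I a s → sz s ≤ B a) :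
    PT fun a => (g a).foldl (h a) (i a) := by
  refine foldl hg hi hh ⟨B, hB, fun a l l' hl => hI a _ ?_⟩
  have hmem : ∀ x ∈ l, x ∈ g a := fun x hx => by simp [hl, hx]
  clear hl
  induction l using List.reverseRecOn with
  | nil => exact h0 a
  | append_singleton l x ih =>
    rw [List.foldl_append]
    exact hs a _ x (hmem x (by simp)) (ih fun y hy => hmem y (by simp [hy]))
end PT

/-- A fold that also emits a list. -/
def foldEmit {α β γ : Type} (h : α → β → α) (e : α → β → List γ) (l : List β) (i : α) :
    α × List γ :=
  l.foldl (fun s x => (h s.1 x, s.2 ++ e s.1 x)) (i, [])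

section foldEmit
variable {α β γ : Type} (h : α → β → α) (e : α → β → List γ) (i : α)

@[simp] theorem foldEmit_nil : foldEmit h e [] i = (i, []) := rfl

theorem foldEmit_append_singleton (l : List β) (x : β) :
    foldEmit h e (l ++ [x]) i =
      (h (foldEmit h e l i).1 x, (foldEmit h e l i).2 ++ e (foldEmit h e l i).1 x) := by
  simp [foldEmit]

theorem foldEmit_fst (l : List β) : (foldEmit h e l i).1 = l.foldl h i := by
  induction l using List.reverseRecOn with
  | nil => rfl
  | append_singleton l x ih => rw [foldEmit_append_singleton, List.foldl_append, ih]; rfl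

theorem foldEmit_cons (x : β) (l : List β) :
    foldEmit h e (x :: l) i = ((foldEmit h e l (h i x)).1, e i x ++ (foldEmit h e l (h i x)).2) := by
  induction l using List.reverseRecOn with
  | nil => simp [foldEmit]
  | append_singleton l y ih =>
    rw [← List.cons_append, foldEmit_append_singleton, foldEmit_append_singleton, ih]
    simp

end foldEmit

/-! ### List operations in polynomial time. -/

namespace PT
variable {α β γ δ : Type} [Enc α] [Enc β] [Enc γ] [Enc δ]

theorem reverse_aux : PT fun p : List β × List β => p.1.reverse ++ p.2 := by
  refine (foldl (α := List β × List β) (g := fun p => p.1) (i := fun p => p.2)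
    (h := fun _ acc x => x :: acc) (fst id) (snd id)
    (cons (snd (snd id)) (fst (snd id))) ⟨sz, PB.size, ?_⟩).cast ?_
  · rintro ⟨l₁, l₂⟩ l l' h
    simp only at h
    simp only [List.foldl_flip_cons_eq_append, sz_pair]
    have h1 := sz_append (l.map fun x => x).reverse l₂
    have h2 : sz (l.map fun x => x).reverse = sz l := by
      clear h h1
      induction l with
      | nil => rfl
      | cons x l ih =>
        simp only [List.map_cons, List.reverse_cons, sz_cons]
        have := sz_append (l.map fun x => x).reverse [x]
        simp only [sz_cons, sz_nil] at this
        omega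
    have h3 := sz_append l l'
    have := sz_pos l'
    rw [h]
    simp only [List.map_id_fun'] at *
    simp only [_root_.id] at *
    omega
  · rintro ⟨l₁, l₂⟩
    simp [List.foldl_flip_cons_eq_append]

theorem reverse {f : α → List β} (hf : PT f) : PT fun a => (f a).reverse :=
  (comp reverse_aux (pair hf (const []))).cast fun a => by simp

theorem append {f g : α → List β} (hf : PT f) (hg : PT g) : PT fun a => f a ++ g a :=
  (comp reverse_aux (pair (reverse hf) hg)).cast fun a => by simp

/-- Only the accumulator needs a bound: each element emits a list of size polynomial in the
parameter, the accumulator and the element, so the emitted list is under control automatically. -/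
theorem foldEmit_of_prefix {g : α → List β} {i : α → δ} {h : α → δ → β → δ} {e : α → δ → β → List γ}
    (hg : PT g) (hi : PT i) (hh : PT fun p : α × δ × β => h p.1 p.2.1 p.2.2)
    (he : PT fun p : α × δ × β => e p.1 p.2.1 p.2.2)
    (B : α → ℕ) (hB : PB B)
    (hI : ∀ a l l', g a = l ++ l' → sz (l.foldl (h a) (i a)) ≤ B a) :
    PT fun a => CDCL.foldEmit (h a) (e a) (g a) (i a) := by
  obtain ⟨q, hq⟩ := he.pb
  refine foldl (h := fun a s x => (h a s.1 x, s.2 ++ e a s.1 x)) hg (pair hi (const []))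
    (pair (hh.comp (pair (fst id) (pair (fst (fst (snd id))) (snd (snd id)))))
      (append (snd (fst (snd id)))
        (he.comp (pair (fst id) (pair (fst (fst (snd id))) (snd (snd id)))))))
    ⟨fun a => B a + 2 + sz (g a) * q.eval (sz a + B a + sz (g a) + 2),
      (hB.add (PB.const 2)).add (hg.pb.mul
        (PB.poly q (((PB.size.add hB).add hg.pb).add (PB.const 2)))), ?_⟩
  intro a l l' hl
  have key : sz (CDCL.foldEmit (h a) (e a) l (i a)).1 ≤ B a ∧
      sz (CDCL.foldEmit (h a) (e a) l (i a)).2 ≤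
        1 + l.length * q.eval (sz a + B a + sz (g a) + 2) := by
    refine ⟨by rw [foldEmit_fst]; exact hI a l l' hl, ?_⟩
    induction l using List.reverseRecOn generalizing l' with
    | nil => simp
    | append_singleton l x ih =>
      have hl' : g a = l ++ (x :: l') := by simp [hl]
      have h2 := ih _ hl'
      rw [foldEmit_append_singleton]
      have h3 := sz_append (CDCL.foldEmit (h a) (e a) l (i a)).2
        (e a (CDCL.foldEmit (h a) (e a) l (i a)).1 x)
      have h4 := hq (a, (CDCL.foldEmit (h a) (e a) l (i a)).1, x)
      have h5 := hI a _ _ hl'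
      rw [← foldEmit_fst (h a) (e a)] at h5
      have h6 := sz_mem_lt (show x ∈ g a by simp [hl])
      have h7 := eval_mono q (show sz (a, (CDCL.foldEmit (h a) (e a) l (i a)).1, x) ≤
        sz a + B a + sz (g a) + 2 by simp only [sz_pair]; omega)
      simp only at h4 ⊢
      rw [List.length_append, add_mul, List.length_singleton, one_mul]
      omega
  have h1 := key.1
  have h2 := length_lt_sz (g a)
  have h3 : l.length ≤ (g a).length := by simp [hl]
  have h4 : l.length * q.eval (sz a + B a + sz (g a) + 2) ≤
    sz (g a) * q.eval (sz a + B a + sz (g a) + 2) := Nat.mul_le_mul_right _ (by omega)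
  change sz (CDCL.foldEmit (h a) (e a) l (i a)) ≤ _
  rw [← Prod.mk.eta (p := CDCL.foldEmit (h a) (e a) l (i a)), sz_pair]
  beta_reduce
  omega

theorem foldEmit {g : α → List β} {i : α → δ} {h : α → δ → β → δ} {e : α → δ → β → List γ}
    (hg : PT g) (hi : PT i) (hh : PT fun p : α × δ × β => h p.1 p.2.1 p.2.2)
    (he : PT fun p : α × δ × β => e p.1 p.2.1 p.2.2)
    (I : α → δ → Prop) (B : α → ℕ) (hB : PB B) (h0 : ∀ a, I a (i a))
    (hs : ∀ a s x, x ∈ g a → I a s → I a (h a s x)) (hI : ∀ a s, I a s → sz s ≤ B a) :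
    PT fun a => CDCL.foldEmit (h a) (e a) (g a) (i a) := by
  refine foldEmit_of_prefix hg hi hh he B hB fun a l l' hl => hI a _ ?_
  have hmem : ∀ x ∈ l, x ∈ g a := fun x hx => by simp [hl, hx]
  clear hl
  induction l using List.reverseRecOn with
  | nil => exact h0 a
  | append_singleton l x ih =>
    rw [List.foldl_append]
    exact hs a _ x (hmem x (by simp)) (ih fun y hy => hmem y (by simp [hy]))

theorem flatMap {g : α → List β} {f : α → β → List γ} (hg : PT g)
    (hf : PT fun p : α × β => f p.1 p.2) : PT fun a => (g a).flatMap (f a) := by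
  refine (snd (foldEmit (i := fun _ => ()) (h := fun _ _ _ => ()) (e := fun a _ x => f a x) hg
    (const ()) (const ()) (hf.comp (pair (fst id) (snd (snd id)))) (fun _ _ => True) (fun _ => 1)
    (PB.const 1) (fun _ => trivial) (fun _ _ _ _ _ => trivial) (fun _ _ _ => by simp))).cast ?_
  intro a
  induction g a with
  | nil => rfl
  | cons x l ih => rw [foldEmit_cons, List.flatMap_cons, ih]

theorem map {g : α → List β} {f : α → β → γ} (hg : PT g) (hf : PT fun p : α × β => f p.1 p.2) :
    PT fun a => (g a).map (f a) :=
  (flatMap hg (cons hf (const []))).cast fun a => by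
    rw [List.map_eq_flatMap]

theorem filter {g : α → List β} {f : α → β → Bool} (hg : PT g)
    (hf : PT fun p : α × β => f p.1 p.2) : PT fun a => (g a).filter (f a) :=
  (flatMap (f := fun a x => bif f a x then [x] else []) hg (cond hf (cons (snd id) (const [])) (const []))).cast fun a => by
    induction g a with
    | nil => rfl
    | cons x l ih => rw [List.filter_cons, List.flatMap_cons, ih]; cases f a x <;> rfl

theorem any {g : α → List β} {f : α → β → Bool} (hg : PT g)
    (hf : PT fun p : α × β => f p.1 p.2) : PT fun a => (g a).any (f a) :=
  (foldl_inv (h := fun a s x => s || f a x) hg (const false)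
    (or (fst (snd id)) (hf.comp (pair (fst id) (snd (snd id))))) (fun _ _ => True) (fun _ => 3)
    (PB.const 3) (fun _ => trivial) (fun _ _ _ _ _ => trivial) fun _ s _ => sz_bool s).cast
    fun a => by
      have : ∀ (l : List β) (b : Bool), l.foldl (fun s x => s || f a x) b = (b || l.any (f a)) := by
        intro l
        induction l with
        | nil => simp
        | cons x l ih => intro b; rw [List.foldl_cons, ih, List.any_cons, Bool.or_assoc]
      rw [this]; rfl

theorem all {g : α → List β} {f : α → β → Bool} (hg : PT g)
    (hf : PT fun p : α × β => f p.1 p.2) : PT fun a => (g a).all (f a) :=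
  (not (any hg (not hf))).cast fun a => by rw [List.all_eq_not_any_not]

theorem mem [EncInj β] [DecidableEq β] {f : α → β} {g : α → List β} (hf : PT f) (hg : PT g) :
    PT fun a => decide (f a ∈ g a) :=
  (any (f := fun a y => decide (y = f a)) hg (eq (snd id) (hf.comp (fst id)))).cast fun a => by
    rw [Bool.eq_iff_iff]; simp

/-- A unary number and a list of as many units have the same encoding; this turns numbers into loop
counters. -/
theorem replicate_unit : PT fun k : ℕ => List.replicate k () :=
  (id (α := Data)).recode (fun k => enc k) (fun _ => rfl) fun k => by
    induction k with
    | zero => rfl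
    | succ k ih => simp [List.replicate_succ, ih]

theorem getD_aux : PT fun p : List β × ℕ × β => p.1.getD p.2.1 p.2.2 := by
  refine (headD (foldl_inv (α := List β × ℕ × β) (g := fun p => List.replicate p.2.1 ())
    (i := fun p => p.1) (h := fun _ s _ => s.tail) (replicate_unit.comp (fst (snd id))) (fst id)
    (tail (fst (snd id))) (fun p s => sz s ≤ sz p.1) (fun p => sz p.1) (fst id).pb
    (fun _ => le_rfl) (fun a s x _ h => (sz_sublist (List.tail_sublist s)).trans h)
    fun _ _ h => h) (snd (snd id))).cast ?_
  rintro ⟨l, k, d⟩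
  simp only
  induction k generalizing l with
  | zero => cases l <;> simp
  | succ k ih => rw [List.replicate_succ, List.foldl_cons, ← ih]; cases l <;> simp

theorem getD {f : α → List β} {k : α → ℕ} {d : α → β} (hf : PT f) (hk : PT k) (hd : PT d) :
    PT fun a => (f a).getD (k a) (d a) := comp getD_aux (pair hf (pair hk hd))

theorem length {f : α → List β} (hf : PT f) : PT fun a => (f a).length :=
  (foldl (i := fun _ => 0) (h := fun _ s _ => s + 1) hf (const 0) (succ (fst (snd id)))
    ⟨fun a => 2 * sz (f a), (PB.const 2).mul hf.pb, fun a l l' h => by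
      have h1 := length_lt_sz (f a)
      rw [h, List.length_append] at h1
      rw [List.foldl_add_const]
      simp only [sz_nat, h]
      omega⟩).cast fun a => by rw [List.foldl_add_const]; simp

theorem takeWhile {g : α → List β} {f : α → β → Bool} (hg : PT g)
    (hf : PT fun p : α × β => f p.1 p.2) : PT fun a => (g a).takeWhile (f a) := by
  have hf' : PT fun p : α × Bool × β => f p.1 p.2.2 := hf.comp (pair (fst id) (snd (snd id)))
  refine (snd (foldEmit (i := fun _ => true) (h := fun a s x => s && f a x)
    (e := fun a s x => bif s && f a x then [x] else []) hg (const true)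
    (and (fst (snd id)) hf') (cond (and (fst (snd id)) hf') (cons (snd (snd id)) (const []))
      (const [])) (fun _ _ => True) (fun _ => 3)
    (PB.const 3) (fun _ => trivial) (fun _ _ _ _ _ => trivial) (fun _ s _ => sz_bool s))).cast ?_
  intro a
  have h1 : ∀ l : List β, (CDCL.foldEmit (fun s x => s && f a x)
      (fun s x => bif s && f a x then [x] else []) l false).2 = [] := by
    intro l
    induction l with
    | nil => rfl
    | cons x l ih => rw [foldEmit_cons]; simpa using ih
  induction g a with
  | nil => rfl
  | cons x l ih =>
    rw [foldEmit_cons, List.takeWhile_cons]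
    cases h : f a x
    · simp [h1]
    · simp [ih]

end PT

/-- The elements of a list with their positions. -/
def enum {α : Type} (l : List α) : List (ℕ × α) :=
  (foldEmit (fun (i : ℕ) (_ : α) => i + 1) (fun i x => [(i, x)]) l 0).2

theorem enum_fst {α : Type} (l : List α) :
    (foldEmit (fun (i : ℕ) (_ : α) => i + 1) (fun i x => [(i, x)]) l 0).1 = l.length := by
  rw [foldEmit_fst, List.foldl_add_const]; simp

theorem enum_append_singleton {α : Type} (l : List α) (x : α) :
    enum (l ++ [x]) = enum l ++ [(l.length, x)] := by
  rw [enum, foldEmit_append_singleton, enum_fst]; rfl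

theorem enum_map_fst {α : Type} (l : List α) : (enum l).map Prod.fst = List.range l.length := by
  induction l using List.reverseRecOn with
  | nil => rfl
  | append_singleton l x ih => rw [enum_append_singleton]; simp [ih, List.range_succ]

theorem PT.enum {α β : Type} [Enc α] [Enc β] {f : α → List β} (hf : PT f) :
    PT fun a => enum (f a) := by
  refine PT.comp (f := fun l : List β => CDCL.enum l) ?_ hf
  refine (snd (PT.foldl (α := List β) (g := fun l => l) (i := fun _ => (0, []))
    (h := fun _ (s : ℕ × List (ℕ × β)) x => (s.1 + 1, s.2 ++ [(s.1, x)])) id (const _)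
    (pair (succ (fst (fst (snd id)))) (append (snd (fst (snd id)))
      (cons (pair (fst (fst (snd id))) (snd (snd id))) (const []))))
    ⟨fun l => 2 * sz l + 2 + sz l * (3 * sz l + 2),
      (((PB.const 2).mul PB.size).add (PB.const 2)).add (PB.size.mul
        (((PB.const 3).mul PB.size).add (PB.const 2))), ?_⟩))
  intro a l l' hl
  change sz (CDCL.foldEmit (fun (i : ℕ) (_ : β) => i + 1) (fun i x => [(i, x)]) l 0) ≤ _
  rw [← Prod.mk.eta (p := CDCL.foldEmit _ _ l 0), sz_pair, enum_fst, sz_nat]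
  change _ + sz (CDCL.enum l) + 1 ≤ _
  have h1 : ∀ p ∈ CDCL.enum l, sz p ≤ 3 * sz a + 1 := by
    intro p hp
    have h2 : p.1 < l.length := by
      have := List.mem_map_of_mem (f := Prod.fst) hp
      rw [enum_map_fst] at this
      simpa using this
    have h3 : p.2 ∈ l := by
      clear hl h2
      induction l using List.reverseRecOn with
      | nil => simp [CDCL.enum] at hp
      | append_singleton l x ih =>
        rw [enum_append_singleton] at hp
        rcases List.mem_append.1 hp with hp | hp
        · simp [ih hp]
        · simp_all
    have h4 := sz_mem_lt (show p.2 ∈ a by simp [hl, h3])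
    have h5 := length_lt_sz a
    have h6 : l.length ≤ a.length := by simp [hl]
    rw [← Prod.mk.eta (p := p), sz_pair, sz_nat]
    omega
  have h2 := sz_list_le h1
  have h3 : (CDCL.enum l).length = l.length := by
    have := congrArg List.length (enum_map_fst l)
    simpa using this
  have h5 := length_lt_sz a
  have h6 : l.length ≤ a.length := by simp [hl]
  have h7 : l.length * (3 * sz a + 2) ≤ sz a * (3 * sz a + 2) := Nat.mul_le_mul_right _ (by omega)
  rw [h3, show 3 * sz a + 1 + 1 = 3 * sz a + 2 from rfl] at h2
  beta_reduce
  omega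

attribute [fun_prop] PT PT.id PT.const PT.comp PT.fst PT.snd PT.pair PT.cons PT.some PT.inl PT.inr
  PT.succ PT.cond PT.not PT.and PT.or PT.eq PT.mem PT.tail PT.headD PT.getD PT.elim PT.sumElim
  PT.map PT.filter PT.flatMap PT.any PT.all PT.reverse PT.append PT.length PT.takeWhile PT.enum

@[fun_prop] theorem PT.isSome {α β : Type} [Enc α] [Enc β] {f : α → Option β} (hf : PT f) :
    PT fun a => (f a).isSome :=
  (PT.elim (s := fun _ _ => true) hf (PT.const false) (PT.const true)).cast fun a => by
    cases f a <;> rfl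

@[fun_prop] theorem PT.isEmpty {α β : Type} [Enc α] [Enc β] {f : α → List β} (hf : PT f) :
    PT fun a => (f a).isEmpty :=
  (PT.not (PT.any (f := fun _ _ => true) hf (PT.const true))).cast fun a => by
    cases f a <;> simp

/-! ### The algorithm -/

/-- A clause, given by the signs of the variables in it. -/
abbrev Cl := List (Option Bool)
/-- A justification `(j, k, z, a)`: the lines `j` and `k` are resolved on the variable `z`, which
has the sign `a` in the former. If `j = k`, the line is a copy of the line `j`. -/
abbrev Just := ℕ × ℕ × ℕ × Bool
/-- A line of a skeleton of a proof: unused, an axiom, or an inference. -/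
abbrev Ln := Option (Cl ⊕ Just)
/-- `(z, b, A)`: the clause `A` becomes the literal `z ^ b` under some initial trail. -/
abbrev Fact := ℕ × Bool × Cl
/-- A line of the output. -/
abbrev Raw := Cl ⊕ List (ℕ × Bool × Bool)
/-- A line of a skeleton with its clause. -/
abbrev Entry := Ln × Cl
/-- The list of the variables, and the same list sorted. -/
abbrev Ctx := List ℕ × List ℕ

/-- The sign of a variable in a clause. -/
def lit (C : Cl) (i : ℕ) : Option Bool := C.getD i none

/-- The resolvent on `z`. -/
def res (c : Ctx) (P Q : Cl) (z : ℕ) : Cl :=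
  c.1.map fun i => bif decide (i = z) then none
    else bif decide (lit P i = none) then lit Q i else lit P i

/-- All variables of the clause are in `K`. -/
def blank (c : Ctx) (K : List ℕ) (C : Cl) : Bool :=
  c.1.all fun i => decide (i ∈ K) || decide (lit C i = none)

/-- The literal `z ^ a` is in the clause and `z` is not in `K`. -/
def has (K : List ℕ) (C : Cl) (z : ℕ) (a : Bool) : Bool :=
  !decide (z ∈ K) && decide (lit C z = some a)

/-- The trail for resolving `P` with `Q` on `z`: the variables in `K` are set to zero, then `P`
becomes unit and propagates `z`, and then the remaining variables are decided such that `Q` is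
falsified. -/
def mkTrail (c : Ctx) (K : List ℕ) (P Q : Cl) (z : ℕ) : List (ℕ × Bool × Bool) :=
  K.map (fun v => (v, false, false)) ++
  ((c.2.filter fun v => !decide (v ∈ K) && (!decide (v = z) && !decide (lit P v = none))).map
    (fun v => (v, true, decide (lit P v = some false))) ++
  ((z, true, decide (lit P z = some true)) ::
  (c.2.filter fun v => !decide (v ∈ K) && decide (lit P v = none)).map
    (fun v => (v, false, decide (lit Q v = some false)))))

/-- The nonempty prefixes of a list. -/
def prefixes {α : Type} (t : List α) : List (List α) :=
  (foldEmit (fun s x => s ++ [x]) (fun s x => [s ++ [x]]) t []).2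

/-- The derivation of the resolvent of `P` and `Q` on `z`. -/
def learn (c : Ctx) (K : List ℕ) (P Q : Cl) (z : ℕ) : List Raw :=
  .inr [] :: ((prefixes (mkTrail c K P Q z)).map (fun t => .inr t) ++ [.inl (res c P Q z)])

/-- Resolve a clause with a fact, if possible. -/
def strip1 (c : Ctx) (C : Cl) (u : Fact) : Cl :=
  bif decide (lit C u.1 = some (!u.2.1)) then res c u.2.2 C u.1 else C

/-- The derivation for `strip1`. -/
def strip1E (c : Ctx) (K : List ℕ) (C : Cl) (u : Fact) : List Raw :=
  bif decide (lit C u.1 = some (!u.2.1)) then learn c K u.2.2 C u.1 else []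

/-- Resolve a clause with some facts, with the derivation. -/
def strip (c : Ctx) (K : List ℕ) (us : List Fact) (C : Cl) : Cl × List Raw :=
  foldEmit (strip1 c) (strip1E c K) us C

/-- The clause of an axiom line. -/
def axOf (l : Ln) : Option Cl := l.elim none fun s => s.elim some fun _ => none

/-- The justification of a line. -/
def justOf (l : Ln) : Option Just := l.elim none fun s => s.elim (fun _ => none) some

/-- Resolve the axioms of a skeleton with some facts. -/
def stripL (c : Ctx) (K : List ℕ) (us : List Fact) (L : List Ln) : List Ln :=
  L.map fun l => (axOf l).elim l fun C => some (.inl (strip c K us C).1)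

/-- The derivation for `stripL`. -/
def stripE (c : Ctx) (K : List ℕ) (us : List Fact) (L : List Ln) : List Raw :=
  L.flatMap fun l => (axOf l).elim [] fun C => (strip c K us C).2

/-- Drop the axioms that contain the literal `x ^ s`. -/
def dropL (x : ℕ) (s : Bool) (L : List Ln) : List Ln :=
  L.map fun l => (axOf l).elim l fun C => bif decide (lit C x = some s) then none else l

/-- The axioms that contain `x ^ s` and whose variables are in `K`. -/
def units (c : Ctx) (K : List ℕ) (x : ℕ) (s : Bool) (L : List Ln) : List Cl :=
  L.flatMap fun l => (axOf l).elim [] fun C =>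
    bif blank c K C && decide (lit C x = some s) then [C] else []

/-- The evaluation of an inference whose premises are evaluated to `P` and `Q`. -/
def evalJust (c : Ctx) (K : List ℕ) (P Q : Entry) (q : Just) : Entry :=
  bif P.1.isSome && (!blank c K P.2 && !has K P.2 q.2.2.1 q.2.2.2) then
    (some (.inr (q.1, q.1, q.2.2)), P.2)
  else bif Q.1.isSome && (!blank c K Q.2 && !has K Q.2 q.2.2.1 (!q.2.2.2)) then
    (some (.inr (q.2.1, q.2.1, q.2.2)), Q.2)
  else bif P.1.isSome && Q.1.isSome && (has K P.2 q.2.2.1 q.2.2.2 && has K Q.2 q.2.2.1 (!q.2.2.2))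
    then (some (.inr q), res c P.2 Q.2 q.2.2.1)
  else bif P.1.isSome && Q.1.isSome && (blank c K P.2 && blank c K Q.2) then
    (some (.inr (q.1, q.1, q.2.2)), P.2)
  else (none, [])

/-- The evaluation of a line. -/
def evalLn (c : Ctx) (K : List ℕ) (acc : List Entry) (l : Ln) : Entry :=
  l.elim (none, []) fun s => s.elim (fun C => (some (.inl C), C)) fun q =>
    evalJust c K (acc.getD q.1 (none, [])) (acc.getD q.2.1 (none, [])) q

/-- The evaluation of a skeleton modulo the variables in `K`. -/
def evalAll (c : Ctx) (K : List ℕ) (L : List Ln) : List Entry :=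
  L.foldl (fun acc l => acc ++ [evalLn c K acc l]) []

/-- A contradiction obtained by a resolution step. -/
def isConf (c : Ctx) (K : List ℕ) (e : Entry) : Bool :=
  (justOf e.1).elim false fun q => !decide (q.1 = q.2.1) && blank c K e.2

/-- The entries before the first contradiction. -/
def before (c : Ctx) (K : List ℕ) (E : List Entry) : List Entry :=
  E.takeWhile fun e => !isConf c K e

/-- The first contradiction. -/
def conf (c : Ctx) (K : List ℕ) (E : List Entry) : Entry :=
  E.getD (before c K E).length (none, [])

/-- The premises of a line. -/
def prems (l : Ln) : List ℕ := (justOf l).elim [] fun q => [q.1, q.2.1]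

/-- One step of `prune`. -/
def pruneStep (s : List ℕ × List Ln) (p : ℕ × Ln) : List ℕ × List Ln :=
  bif decide (p.1 ∈ s.1) then (prems p.2 ++ s.1, p.2 :: s.2) else (s.1, none :: s.2)

/-- Keep only the lines that are used in the derivation of the last line `l`. -/
def prune (T : List Ln) (l : Ln) : List Ln :=
  ((enum (T ++ [l])).reverse.foldl pruneStep ([T.length], [])).2

/-- The variable occurs in the axioms of the skeleton. -/
def occ (L : List Ln) (v : ℕ) : Bool :=
  L.any fun l => (axOf l).elim false fun C => !decide (lit C v = none)

/-- A task: under the trails that set the variables in the first component to zero, learn both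
unit clauses for all other variables in the skeleton, the first of which is the second component.
The fourth component is the clause learned for this variable, and the last one consists of the
facts that are learned when this variable is set to zero, too. -/
abbrev Frame := List ℕ × ℕ × List Ln × Option Cl × List Fact

/-- The variables up to `x`. -/
def upto (c : Ctx) (x : ℕ) : List ℕ := c.2.takeWhile (fun v => !decide (v = x)) ++ [x]

/-- A new task. -/
def mkFrame (c : Ctx) (K : List ℕ) (L : List Ln) : Frame :=
  (K, (c.2.filter fun v => !decide (v ∈ K) && occ L v).headD 0, L, none, [])

/-- The task of refuting the conflict that has been found. -/
def subFrame (c : Ctx) (K : List ℕ) (E : List Entry) : Frame :=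
  mkFrame c K (prune ((before c K E).map fun e => e.1) (conf c K E).1)

/-- The clauses of the premises of the conflict. -/
def confFacts (c : Ctx) (K : List ℕ) (E : List Entry) : List Fact :=
  (justOf (conf c K E).1).elim [] fun q =>
    [(q.2.2.1, q.2.2.2, (E.getD q.1 (none, [])).2),
      (q.2.2.1, !q.2.2.2, (E.getD q.2.1 (none, [])).2)]

/-- The derivation of all lines of an evaluated skeleton. -/
def simE (c : Ctx) (K : List ℕ) (E : List Entry) : List Raw :=
  E.flatMap fun e => (justOf e.1).elim [] fun q => bif decide (q.1 = q.2.1) then [] else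
    learn c K (E.getD q.1 (none, [])).2 (E.getD q.2.1 (none, [])).2 q.2.2.1

/-- The evaluation of the skeleton when `x = 1` is set by the clause `X`. -/
def evalOne (c : Ctx) (pre K : List ℕ) (x : ℕ) (X : Cl) (L : List Ln) : List Entry :=
  evalAll c K (stripL c pre [(x, true, X)] (dropL x true L))

/-- One round of the search for the clause with the negation of `x`. -/
def round (c : Ctx) (pre K : List ℕ) (x : ℕ) (X : Cl) (s : List Ln × Option Cl) :
    List Ln × Option Cl :=
  bif s.2.isSome then s
  else bif (units c K x false s.1).isEmpty then
    (stripL c pre (confFacts c K (evalOne c pre K x X s.1)) s.1, none)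
  else (s.1, some ((units c K x false s.1).headD []))

/-- The derivation for `round`. -/
def roundE (c : Ctx) (pre K : List ℕ) (x : ℕ) (X : Cl) (s : List Ln × Option Cl) : List Raw :=
  bif s.2.isSome then []
  else bif (units c K x false s.1).isEmpty then
    stripE c pre [(x, true, X)] (dropL x true s.1) ++ (simE c K (evalOne c pre K x X s.1) ++
      stripE c pre (confFacts c K (evalOne c pre K x X s.1)) s.1)
  else []

/-- The search for the clause with the negation of `x`. -/
def search (c : Ctx) (pre K : List ℕ) (x : ℕ) (X : Cl) (L : List Ln) :
    (List Ln × Option Cl) × List Raw :=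
  foldEmit (fun s (_ : ℕ) => round c pre K x X s) (fun s _ => roundE c pre K x X s) c.1 (L, none)

/-- The facts for the task below, when a task has been completed. -/
def newFacts (c : Ctx) (pre : List ℕ) (x : ℕ) (X Xb : Cl) (U : List Fact) : List Fact :=
  U.map (fun u => (u.1, u.2.1, (strip c pre [(x, false, Xb)] u.2.2).1)) ++
    [(x, true, X), (x, false, Xb)]

/-- The derivation for `newFacts`. -/
def newFactsE (c : Ctx) (pre : List ℕ) (x : ℕ) (Xb : Cl) (U : List Fact) : List Raw :=
  U.flatMap fun u => (strip c pre [(x, false, Xb)] u.2.2).2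

/-- The clause with the negation of `x` that is found by the search. -/
def foundCl (s : (List Ln × Option Cl) × List Raw) : Cl := s.1.2.elim [] fun C => C

/-- Add facts to the task on top of the stack. -/
def addFacts (F : List Fact) (st : List Frame) : List Frame :=
  bif st.isEmpty then [] else
    (fun f : Frame => (f.1, f.2.1, f.2.2.1, f.2.2.2.1, F ++ f.2.2.2.2))
      (st.headD ([], 0, [], none, [])) :: st.tail

/-- The clause learned for the first variable of a task. -/
def learnedCl (f : Frame) : Cl := f.2.2.2.1.elim [] fun C => C

/-- Completion of a task. -/
def pop (c : Ctx) (K : List ℕ) (f : Frame) (rest : List Frame) : List Frame :=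
  addFacts (newFacts c f.1 f.2.1 (learnedCl f)
    (foundCl (search c f.1 K f.2.1 (learnedCl f) f.2.2.1)) f.2.2.2.2) rest

/-- The derivation for `pop`. -/
def popE (c : Ctx) (K : List ℕ) (f : Frame) : List Raw :=
  (search c f.1 K f.2.1 (learnedCl f) f.2.2.1).2 ++ newFactsE c f.1 f.2.1
    (foundCl (search c f.1 K f.2.1 (learnedCl f) f.2.2.1)) f.2.2.2.2

/-- The skeleton of a task when the first variable is set to zero. -/
def prep0 (c : Ctx) (f : Frame) : List Ln :=
  f.2.2.2.1.elim (dropL f.2.1 false f.2.2.1) fun X => stripL c f.1 [(f.2.1, true, X)] f.2.2.1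

/-- The derivation for `prep0`. -/
def prep0E (c : Ctx) (f : Frame) : List Raw :=
  f.2.2.2.1.elim [] fun X => stripE c f.1 [(f.2.1, true, X)] f.2.2.1

/-- The skeleton after the use of the facts. -/
def prep (c : Ctx) (K : List ℕ) (f : Frame) : List Ln := stripL c K f.2.2.2.2 (prep0 c f)

/-- The derivation for `prep`. -/
def prepE (c : Ctx) (K : List ℕ) (f : Frame) : List Raw :=
  prep0E c f ++ stripE c K f.2.2.2.2 (prep0 c f)

/-- The first variable can be learned now. -/
def canSet (c : Ctx) (K : List ℕ) (f : Frame) : Bool :=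
  !f.2.2.2.1.isSome && !(units c K f.2.1 true (prep c K f)).isEmpty

/-- There is a conflict. -/
def hasConf (c : Ctx) (K : List ℕ) (f : Frame) : Bool :=
  isConf c K (conf c K (evalAll c K (prep c K f)))

/-- One step on the task `f`. -/
def stepFrame (c : Ctx) (K : List ℕ) (f : Frame) (rest : List Frame) : List Frame :=
  bif canSet c K f then
    (f.1, f.2.1, f.2.2.1, some ((units c K f.2.1 true (prep c K f)).headD []), f.2.2.2.2) :: rest
  else bif hasConf c K f then subFrame c K (evalAll c K (prep c K f)) :: f :: rest
  else pop c K f rest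

/-- The derivation for `stepFrame`. -/
def stepFrameE (c : Ctx) (K : List ℕ) (f : Frame) : List Raw :=
  prepE c K f ++ (bif canSet c K f || hasConf c K f then [] else popE c K f)

/-- One step of the algorithm. -/
def step (c : Ctx) (st : List Frame) : List Frame :=
  bif st.isEmpty then [] else
    stepFrame c (upto c (st.headD ([], 0, [], none, [])).2.1) (st.headD ([], 0, [], none, []))
      st.tail

/-- The derivation for `step`. -/
def stepE (c : Ctx) (st : List Frame) : List Raw :=
  bif st.isEmpty then [] else
    stepFrameE c (upto c (st.headD ([], 0, [], none, [])).2.1) (st.headD ([], 0, [], none, []))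

/-- The variables in both orders. -/
def mkCtx (pos : List ℕ) : Ctx :=
  ((enum pos).map fun p => p.1, (enum pos).map fun p =>
    (((enum pos).filter fun r => decide (r.2 = p.1)).map fun r => r.1).headD 0)

/-- The variable that is resolved on. -/
def pivot (c : Ctx) (P Q : Cl) : ℕ :=
  (c.1.filter fun i => (decide (lit P i = some true) && decide (lit Q i = some false)) ||
    (decide (lit P i = some false) && decide (lit Q i = some true))).headD 0

/-- The skeleton of the given refutation. -/
def mkLines (c : Ctx) (Pf : List (Cl × Option (ℕ × ℕ))) : List Ln :=
  Pf.map fun l => some (l.2.elim (.inl l.1) fun q => .inr (q.1, q.2,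
    pivot c (Pf.getD q.1 ([], none)).1 (Pf.getD q.2 ([], none)).1,
    decide (lit (Pf.getD q.1 ([], none)).1
      (pivot c (Pf.getD q.1 ([], none)).1 (Pf.getD q.2 ([], none)).1) = some true)))

/-- The variables of the given refutation. -/
def varList (c : Ctx) (L : List Ln) : List ℕ := c.1.filter fun v => occ L v

/-- The main loop. -/
def run (c : Ctx) (L : List Ln) : List Frame × List Raw :=
  foldEmit (fun st (_ : ℕ) => step c st) (fun st _ => stepE c st)
    (varList c L ++ (varList c L ++ varList c L)) [mkFrame c [] L]

/-- The output. -/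
def output (c : Ctx) (L : List Ln) (cls : List Cl) : List Raw :=
  bif (varList c L).isEmpty then [] else cls.map (fun C => .inl C) ++ (run c L).2

/-! ### Polynomial time of the ingredients of the algorithm. -/

section polytime
variable {α : Type} [Enc α]

theorem sz_optBool (o : Option Bool) : sz o ≤ 5 := by
  cases o with
  | none => simp
  | some b => have := sz_bool b; simp; omega

theorem sz_res (c : Ctx) (P Q : Cl) (z : ℕ) : sz (res c P Q z) ≤ 6 * sz c + 1 := by
  have h := sz_list_le (l := res c P Q z) (B := 5) fun a _ => sz_optBool a
  have h1 := length_lt_sz c.1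
  have h2 : sz c = sz c.1 + sz c.2 + 1 := rfl
  simp only [res, List.length_map] at h ⊢
  omega

@[fun_prop] theorem PT.lit {C : α → Cl} {i : α → ℕ} (hC : PT C) (hi : PT i) :
    PT fun a => lit (C a) (i a) := by unfold CDCL.lit; fun_prop

@[fun_prop] theorem PT.res {c : α → Ctx} {P Q : α → Cl} {z : α → ℕ} (hc : PT c) (hP : PT P)
    (hQ : PT Q) (hz : PT z) : PT fun a => res (c a) (P a) (Q a) (z a) := by
  unfold CDCL.res; fun_prop

@[fun_prop] theorem PT.blank {c : α → Ctx} {K : α → List ℕ} {C : α → Cl} (hc : PT c) (hK : PT K)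
    (hC : PT C) : PT fun a => blank (c a) (K a) (C a) := by unfold CDCL.blank; fun_prop

@[fun_prop] theorem PT.has {K : α → List ℕ} {C : α → Cl} {z : α → ℕ} {s : α → Bool} (hK : PT K)
    (hC : PT C) (hz : PT z) (hs : PT s) : PT fun a => has (K a) (C a) (z a) (s a) := by
  unfold CDCL.has; fun_prop

@[fun_prop] theorem PT.mkTrail {c : α → Ctx} {K : α → List ℕ} {P Q : α → Cl} {z : α → ℕ}
    (hc : PT c) (hK : PT K) (hP : PT P) (hQ : PT Q) (hz : PT z) :
    PT fun a => mkTrail (c a) (K a) (P a) (Q a) (z a) := by unfold CDCL.mkTrail; fun_prop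

theorem foldl_snoc {β : Type} (l s : List β) : l.foldl (fun s x => s ++ [x]) s = s ++ l := by
  induction l generalizing s with
  | nil => simp
  | cons x l ih => simp [ih]

@[fun_prop] theorem PT.prefixes {β : Type} [Enc β] {t : α → List β} (ht : PT t) :
    PT fun a => prefixes (t a) := by
  unfold CDCL.prefixes
  refine PT.snd (PT.foldEmit_of_prefix (h := fun _ s x => s ++ [x]) (e := fun _ s x => [s ++ [x]])
    ht (PT.const []) (by fun_prop) (by fun_prop) (fun a => sz (t a)) ht.pb fun a l l' h => ?_)
  rw [foldl_snoc, h]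
  exact sz_sublist (by simp)

@[fun_prop] theorem PT.learn {c : α → Ctx} {K : α → List ℕ} {P Q : α → Cl} {z : α → ℕ}
    (hc : PT c) (hK : PT K) (hP : PT P) (hQ : PT Q) (hz : PT z) :
    PT fun a => learn (c a) (K a) (P a) (Q a) (z a) := by unfold CDCL.learn; fun_prop

@[fun_prop] theorem PT.strip1 {c : α → Ctx} {C : α → Cl} {u : α → Fact} (hc : PT c) (hC : PT C)
    (hu : PT u) : PT fun a => strip1 (c a) (C a) (u a) := by unfold CDCL.strip1; fun_prop

@[fun_prop] theorem PT.strip1E {c : α → Ctx} {K : α → List ℕ} {C : α → Cl} {u : α → Fact}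
    (hc : PT c) (hK : PT K) (hC : PT C) (hu : PT u) :
    PT fun a => strip1E (c a) (K a) (C a) (u a) := by unfold CDCL.strip1E; fun_prop

theorem sz_strip1 (c : Ctx) (C : Cl) (u : Fact) : sz (strip1 c C u) ≤ max (sz C) (6 * sz c + 1) := by
  unfold strip1
  cases decide (lit C u.1 = some (!u.2.1))
  · exact le_max_left _ _
  · exact (sz_res _ _ _ _).trans (le_max_right _ _)

theorem strip_inv (P : Cl → Prop) (c : Ctx) (K : List ℕ) (us : List Fact)
    (hr : ∀ C, P C → ∀ u ∈ us, P (strip1 c C u)) (C : Cl) (hC : P C) : P (strip c K us C).1 := by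
  unfold strip
  rw [foldEmit_fst]
  induction us generalizing C with
  | nil => exact hC
  | cons u us ih =>
    exact ih (fun C h u hu => hr C h u (by simp [hu])) _ (hr C hC u (by simp))

theorem sz_strip (c : Ctx) (K : List ℕ) (us : List Fact) (C : Cl) :
    sz (strip c K us C).1 ≤ max (sz C) (6 * sz c + 1) :=
  strip_inv (fun D => sz D ≤ max (sz C) (6 * sz c + 1)) c K us
    (fun D hD u _ => (sz_strip1 c D u).trans (max_le hD (le_max_right _ _))) C (le_max_left _ _)

@[fun_prop] theorem PT.strip {c : α → Ctx} {K : α → List ℕ} {us : α → List Fact} {C : α → Cl}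
    (hc : PT c) (hK : PT K) (hu : PT us) (hC : PT C) :
    PT fun a => strip (c a) (K a) (us a) (C a) := by
  unfold CDCL.strip
  refine PT.foldEmit (h := fun a s x => CDCL.strip1 (c a) s x)
    (e := fun a s x => CDCL.strip1E (c a) (K a) s x) hu hC (by fun_prop) (by fun_prop)
    (fun a s => sz s ≤ sz (C a) + (6 * sz (c a) + 1)) (fun a => sz (C a) + (6 * sz (c a) + 1))
    (hC.pb.add (((PB.const 6).mul hc.pb).add (PB.const 1))) (fun a => by omega)
    (fun a s x _ h => (sz_strip1 _ _ _).trans (max_le h (by omega))) fun _ _ h => h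

@[fun_prop] theorem PT.axOf {l : α → Ln} (hl : PT l) : PT fun a => axOf (l a) := by
  unfold CDCL.axOf; fun_prop

@[fun_prop] theorem PT.justOf {l : α → Ln} (hl : PT l) : PT fun a => justOf (l a) := by
  unfold CDCL.justOf; fun_prop

@[fun_prop] theorem PT.stripL {c : α → Ctx} {K : α → List ℕ} {us : α → List Fact} {L : α → List Ln}
    (hc : PT c) (hK : PT K) (hu : PT us) (hL : PT L) :
    PT fun a => stripL (c a) (K a) (us a) (L a) := by unfold CDCL.stripL; fun_prop

@[fun_prop] theorem PT.stripE {c : α → Ctx} {K : α → List ℕ} {us : α → List Fact} {L : α → List Ln}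
    (hc : PT c) (hK : PT K) (hu : PT us) (hL : PT L) :
    PT fun a => stripE (c a) (K a) (us a) (L a) := by unfold CDCL.stripE; fun_prop

@[fun_prop] theorem PT.dropL {x : α → ℕ} {s : α → Bool} {L : α → List Ln}
    (hx : PT x) (hs : PT s) (hL : PT L) : PT fun a => dropL (x a) (s a) (L a) := by
  unfold CDCL.dropL; fun_prop

@[fun_prop] theorem PT.units {c : α → Ctx} {K : α → List ℕ} {x : α → ℕ} {s : α → Bool}
    {L : α → List Ln} (hc : PT c) (hK : PT K) (hx : PT x) (hs : PT s) (hL : PT L) :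
    PT fun a => units (c a) (K a) (x a) (s a) (L a) := by unfold CDCL.units; fun_prop

@[fun_prop] theorem PT.evalJust {c : α → Ctx} {K : α → List ℕ} {P Q : α → Entry} {q : α → Just}
    (hc : PT c) (hK : PT K) (hP : PT P) (hQ : PT Q) (hq : PT q) :
    PT fun a => evalJust (c a) (K a) (P a) (Q a) (q a) := by unfold CDCL.evalJust; fun_prop

@[fun_prop] theorem PT.evalLn {c : α → Ctx} {K : α → List ℕ} {acc : α → List Entry} {l : α → Ln}
    (hc : PT c) (hK : PT K) (ha : PT acc) (hl : PT l) :
    PT fun a => evalLn (c a) (K a) (acc a) (l a) := by unfold CDCL.evalLn; fun_prop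

theorem evalAll_append_singleton (c : Ctx) (K : List ℕ) (L : List Ln) (l : Ln) :
    evalAll c K (L ++ [l]) = evalAll c K L ++ [evalLn c K (evalAll c K L) l] := by
  simp [evalAll]

@[simp] theorem length_evalAll (c : Ctx) (K : List ℕ) (L : List Ln) :
    (evalAll c K L).length = L.length := by
  induction L using List.reverseRecOn with
  | nil => rfl
  | append_singleton L l ih => simp [evalAll_append_singleton, ih]

/-- A resulting clause is copied from an earlier entry, taken from an axiom, or a resolvent, whose
size is bounded in terms of `c` alone. So sizes do not compound along the derivation. The factor 2
is for a line that becomes a copy, where one index is written twice. -/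
theorem sz_evalLn {c : Ctx} {K : List ℕ} {acc : List Entry} {l : Ln} {B : ℕ}
    (h : ∀ e ∈ acc, sz e.2 ≤ B) (hB : 6 * sz c + 1 ≤ B) :
    sz (evalLn c K acc l).1 ≤ 2 * sz l + 10 ∧ sz (evalLn c K acc l).2 ≤ max B (sz l) := by
  have hD : ∀ j, sz (acc.getD j (none, [])).2 ≤ B := by
    intro j
    by_cases hj : j < acc.length
    · exact h _ (by rw [List.getD_eq_getElem _ _ hj]; exact List.getElem_mem hj)
    · rw [List.getD_eq_default _ _ (by omega)]
      simp only [sz_nil]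
      omega
  rcases l with _ | C | q
  · simp [evalLn]
  · simp [evalLn]; omega
  · obtain ⟨j, k, z, a⟩ := q
    have h1 := hD j
    have h2 := hD k
    have h3 := sz_res c (acc.getD j (none, [])).2 (acc.getD k (none, [])).2 z
    have hb := sz_bool a
    simp only [evalLn, Option.elim_some, Sum.elim_inr, evalJust]
    repeat' rw [Bool.cond_eq_ite]
    split_ifs <;> simp only [sz_some, sz_inr, sz_pair, sz_nat, sz_none, sz_nil] <;> omega

@[fun_prop] theorem PT.evalAll {c : α → Ctx} {K : α → List ℕ} {L : α → List Ln}
    (hc : PT c) (hK : PT K) (hL : PT L) : PT fun a => evalAll (c a) (K a) (L a) := by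
  refine PT.foldl (h := fun a acc l => acc ++ [CDCL.evalLn (c a) (K a) acc l]) hL (PT.const [])
    (by fun_prop) ⟨fun a => sz (L a) * (3 * sz (L a) + 6 * sz (c a) + 13) + 1,
      (hL.pb.mul (((((PB.const 3).mul hL.pb).add ((PB.const 6).mul hc.pb)).add
        (PB.const 13)))).add (PB.const 1), ?_⟩
  intro a l l' h
  change sz (CDCL.evalAll (c a) (K a) l) ≤ _
  have key : ∀ e ∈ CDCL.evalAll (c a) (K a) l,
      sz e.1 ≤ 2 * sz (L a) + 10 ∧ sz e.2 ≤ sz (L a) + 6 * sz (c a) + 1 := by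
    induction l using List.reverseRecOn generalizing l' with
    | nil => simp [CDCL.evalAll]
    | append_singleton l x ih =>
      have ih := ih (x :: l') (by simp [h])
      rw [evalAll_append_singleton]
      intro e he
      rcases List.mem_append.1 he with he | he
      · exact ih e he
      · rw [List.mem_singleton.1 he]
        have h1 := sz_evalLn (c := c a) (K := K a) (l := x) (fun e he => (ih e he).2) (by omega)
        have h2 := sz_mem_lt (show x ∈ L a by simp [h])
        omega
  have h1 := sz_list_le (B := 3 * sz (L a) + 6 * sz (c a) + 12) fun e he => by
    have := key e he
    rw [← Prod.mk.eta (p := e), sz_pair]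
    omega
  rw [length_evalAll] at h1
  have h2 := length_lt_sz (L a)
  have h3 : l.length ≤ (L a).length := by simp [h]
  have h4 : l.length * (3 * sz (L a) + 6 * sz (c a) + 13) ≤
    sz (L a) * (3 * sz (L a) + 6 * sz (c a) + 13) := Nat.mul_le_mul_right _ (by omega)
  rw [show 3 * sz (L a) + 6 * sz (c a) + 12 + 1 = 3 * sz (L a) + 6 * sz (c a) + 13 from rfl] at h1
  exact h1.trans (by beta_reduce; omega)

@[fun_prop] theorem PT.isConf {c : α → Ctx} {K : α → List ℕ} {e : α → Entry}
    (hc : PT c) (hK : PT K) (he : PT e) : PT fun a => isConf (c a) (K a) (e a) := by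
  unfold CDCL.isConf; fun_prop

@[fun_prop] theorem PT.before {c : α → Ctx} {K : α → List ℕ} {E : α → List Entry}
    (hc : PT c) (hK : PT K) (hE : PT E) : PT fun a => before (c a) (K a) (E a) := by
  unfold CDCL.before; fun_prop

@[fun_prop] theorem PT.conf {c : α → Ctx} {K : α → List ℕ} {E : α → List Entry}
    (hc : PT c) (hK : PT K) (hE : PT E) : PT fun a => conf (c a) (K a) (E a) := by
  unfold CDCL.conf; fun_prop

@[fun_prop] theorem PT.prems {l : α → Ln} (hl : PT l) : PT fun a => prems (l a) := by
  unfold CDCL.prems; fun_prop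

@[fun_prop] theorem PT.pruneStep {s : α → List ℕ × List Ln} {p : α → ℕ × Ln} (hs : PT s)
    (hp : PT p) : PT fun a => pruneStep (s a) (p a) := by unfold CDCL.pruneStep; fun_prop

theorem sz_prems (l : Ln) : sz (prems l) ≤ sz l + 10 := by
  rcases l with _ | C | ⟨j, k, z, a⟩ <;> simp [prems, justOf]; omega

theorem sz_pruneStep (s : List ℕ × List Ln) (p : ℕ × Ln) :
    sz (pruneStep s p) ≤ sz s + 2 * sz p + 10 := by
  obtain ⟨n, o⟩ := s
  obtain ⟨i, l⟩ := p
  have h1 := sz_prems l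
  have h2 := sz_append (prems l) n
  have h3 := sz_pos l
  simp only [pruneStep]
  cases decide (i ∈ n) <;> simp <;> omega

@[fun_prop] theorem PT.prune {T : α → List Ln} {l : α → Ln} (hT : PT T) (hl : PT l) :
    PT fun a => prune (T a) (l a) := by
  unfold CDCL.prune
  have h1 : PT fun a => (CDCL.enum (T a ++ [l a])).reverse := by fun_prop
  have h2 : PT fun a => (([(T a).length], []) : List ℕ × List Ln) := by fun_prop
  refine PT.snd (PT.foldl (h := fun _ s p => CDCL.pruneStep s p) h1 h2 (by fun_prop)
    ⟨fun a => sz (([(T a).length], []) : List ℕ × List Ln) +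
      12 * sz (CDCL.enum (T a ++ [l a])).reverse, h2.pb.add ((PB.const 12).mul h1.pb), ?_⟩)
  intro a m m' h
  have h3 : sz m ≤ sz (CDCL.enum (T a ++ [l a])).reverse := by
    rw [h]; exact sz_sublist (by simp)
  have h4 : ∀ (m : List (ℕ × Ln)) (s : List ℕ × List Ln),
      sz (m.foldl CDCL.pruneStep s) ≤ sz s + 12 * sz m := by
    intro m
    induction m with
    | nil => intro s; simp
    | cons p m ih =>
      intro s
      have h5 := ih (CDCL.pruneStep s p)
      have h6 := sz_pruneStep s p
      have := sz_pos p
      simp only [List.foldl_cons, sz_cons]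
      omega
  exact (h4 m _).trans (Nat.add_le_add_left (Nat.mul_le_mul_left _ h3) _)

@[fun_prop] theorem PT.occ {L : α → List Ln} {v : α → ℕ} (hL : PT L) (hv : PT v) :
    PT fun a => occ (L a) (v a) := by unfold CDCL.occ; fun_prop

@[fun_prop] theorem PT.upto {c : α → Ctx} {x : α → ℕ} (hc : PT c) (hx : PT x) :
    PT fun a => upto (c a) (x a) := by unfold CDCL.upto; fun_prop

@[fun_prop] theorem PT.mkFrame {c : α → Ctx} {K : α → List ℕ} {L : α → List Ln}
    (hc : PT c) (hK : PT K) (hL : PT L) : PT fun a => mkFrame (c a) (K a) (L a) := by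
  unfold CDCL.mkFrame; fun_prop

@[fun_prop] theorem PT.subFrame {c : α → Ctx} {K : α → List ℕ} {E : α → List Entry}
    (hc : PT c) (hK : PT K) (hE : PT E) : PT fun a => subFrame (c a) (K a) (E a) := by
  unfold CDCL.subFrame; fun_prop

@[fun_prop] theorem PT.confFacts {c : α → Ctx} {K : α → List ℕ} {E : α → List Entry}
    (hc : PT c) (hK : PT K) (hE : PT E) : PT fun a => confFacts (c a) (K a) (E a) := by
  unfold CDCL.confFacts; fun_prop

@[fun_prop] theorem PT.simE {c : α → Ctx} {K : α → List ℕ} {E : α → List Entry}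
    (hc : PT c) (hK : PT K) (hE : PT E) : PT fun a => simE (c a) (K a) (E a) := by
  unfold CDCL.simE; fun_prop

@[fun_prop] theorem PT.evalOne {c : α → Ctx} {pre K : α → List ℕ} {x : α → ℕ} {X : α → Cl}
    {L : α → List Ln} (hc : PT c) (hp : PT pre) (hK : PT K) (hx : PT x) (hX : PT X) (hL : PT L) :
    PT fun a => evalOne (c a) (pre a) (K a) (x a) (X a) (L a) := by
  unfold CDCL.evalOne; fun_prop

@[fun_prop] theorem PT.round {c : α → Ctx} {pre K : α → List ℕ} {x : α → ℕ} {X : α → Cl}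
    {s : α → List Ln × Option Cl} (hc : PT c) (hp : PT pre) (hK : PT K) (hx : PT x) (hX : PT X)
    (hs : PT s) : PT fun a => round (c a) (pre a) (K a) (x a) (X a) (s a) := by
  unfold CDCL.round; fun_prop

@[fun_prop] theorem PT.roundE {c : α → Ctx} {pre K : α → List ℕ} {x : α → ℕ} {X : α → Cl}
    {s : α → List Ln × Option Cl} (hc : PT c) (hp : PT pre) (hK : PT K) (hx : PT x) (hX : PT X)
    (hs : PT s) : PT fun a => roundE (c a) (pre a) (K a) (x a) (X a) (s a) := by
  unfold CDCL.roundE; fun_prop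

/-- A bound on the sizes of the lines of a skeleton. -/
def SzLe (L : List Ln) (n B : ℕ) : Prop := L.length = n ∧ ∀ l ∈ L, sz l ≤ B

theorem SzLe.stripL {L : List Ln} {n B : ℕ} (h : SzLe L n B) {c : Ctx} (hB : 6 * sz c + 5 ≤ B)
    (K : List ℕ) (us : List Fact) : SzLe (stripL c K us L) n B := by
  refine ⟨by simpa [CDCL.stripL] using h.1, fun l hl => ?_⟩
  obtain ⟨l, hl', rfl⟩ := List.mem_map.1 hl
  have h1 := h.2 l hl'
  rcases l with _ | C | q
  · exact h1
  · have := sz_strip c K us C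
    simp only [axOf, Option.elim_some, Sum.elim_inl, sz_some, sz_inl] at h1 ⊢
    omega
  · exact h1

theorem sz_units_headD {L : List Ln} {n B : ℕ} (h : SzLe L n B) (c : Ctx) (K : List ℕ) (x : ℕ)
    (s : Bool) : sz ((units c K x s L).headD []) ≤ B + 1 := by
  cases hu : units c K x s L with
  | nil => simp
  | cons C us =>
    have h1 : C ∈ units c K x s L := by simp [hu]
    obtain ⟨l, hl, h2⟩ := List.mem_flatMap.1 h1
    have h3 := h.2 l hl
    rcases l with _ | D | q
    · simp [axOf] at h2
    · simp only [axOf, Option.elim_some, Sum.elim_inl, sz_some, sz_inl] at h2 h3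
      cases hb : blank c K D && decide (lit D x = some s)
      · rw [hb] at h2; simp at h2
      · rw [hb] at h2
        simp only [cond_true, List.mem_singleton] at h2
        rw [List.headD_cons, h2]
        omega
    · simp [axOf] at h2

@[fun_prop] theorem PT.search {c : α → Ctx} {pre K : α → List ℕ} {x : α → ℕ} {X : α → Cl}
    {L : α → List Ln} (hc : PT c) (hp : PT pre) (hK : PT K) (hx : PT x) (hX : PT X) (hL : PT L) :
    PT fun a => search (c a) (pre a) (K a) (x a) (X a) (L a) := by
  unfold CDCL.search
  refine PT.foldEmit (α := α) (β := ℕ) (h := fun a s _ => CDCL.round (c a) (pre a) (K a) (x a) (X a) s)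
    (e := fun a s _ => CDCL.roundE (c a) (pre a) (K a) (x a) (X a) s) (by fun_prop) (by fun_prop)
    (by fun_prop) (by fun_prop)
    -- A round only replaces axioms by stripped ones, of size at most that of the old clause or of a
    -- resolvent. Hence one bound per line, fixed at the start, survives all rounds.
    (fun a s => SzLe s.1 (L a).length (sz (L a) + 6 * sz (c a) + 5) ∧
      ∀ C ∈ s.2, sz C ≤ sz (L a) + 6 * sz (c a) + 6)
    (fun a => sz (L a) * (sz (L a) + 6 * sz (c a) + 6) + 1 + (sz (L a) + 6 * sz (c a) + 10))
    (((hL.pb.mul ((hL.pb.add ((PB.const 6).mul hc.pb)).add (PB.const 6))).add (PB.const 1)).add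
      ((hL.pb.add ((PB.const 6).mul hc.pb)).add (PB.const 10))) ?_ ?_ ?_
  · intro a
    refine ⟨⟨rfl, fun l hl => ?_⟩, by simp⟩
    exact (sz_mem_lt hl).le.trans (show sz (L a) ≤ _ by omega)
  · rintro a ⟨L', o⟩ _ _ ⟨h1, h2⟩
    unfold CDCL.round
    cases hs : o.isSome
    · cases hu : (CDCL.units (c a) (K a) (x a) false L').isEmpty
      · refine ⟨h1, fun C hC => ?_⟩
        simp only [cond_false, Option.mem_def, Option.some.injEq] at hC
        rw [← hC]
        exact sz_units_headD h1 _ _ _ _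
      · simp only [cond_true, cond_false]
        exact ⟨h1.stripL (by omega) _ _, by simp⟩
    · exact ⟨h1, h2⟩
  · rintro a ⟨L', o⟩ ⟨⟨h1, h2⟩, h3⟩
    simp only at h1 h2
    have h4 := sz_list_le h2
    have h5 := length_lt_sz (L a)
    have h6 : L'.length * (sz (L a) + 6 * sz (c a) + 5 + 1) ≤
      sz (L a) * (sz (L a) + 6 * sz (c a) + 6) := Nat.mul_le_mul_right _ (by omega)
    simp only [sz_pair] at *
    cases o with
    | none => simp only [sz_none]; omega
    | some C => have := h3 C rfl; simp only [sz_some]; omega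

@[fun_prop] theorem PT.newFacts {c : α → Ctx} {pre : α → List ℕ} {x : α → ℕ} {X Xb : α → Cl}
    {U : α → List Fact} (hc : PT c) (hx : PT x) (hX : PT X) (hXb : PT Xb)
    (hU : PT U) : PT fun a => newFacts (c a) (pre a) (x a) (X a) (Xb a) (U a) := by
  unfold CDCL.newFacts; fun_prop

@[fun_prop] theorem PT.newFactsE {c : α → Ctx} {pre : α → List ℕ} {x : α → ℕ} {Xb : α → Cl}
    {U : α → List Fact} (hc : PT c) (hp : PT pre) (hx : PT x) (hXb : PT Xb)
    (hU : PT U) : PT fun a => newFactsE (c a) (pre a) (x a) (Xb a) (U a) := by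
  unfold CDCL.newFactsE; fun_prop

@[fun_prop] theorem PT.foundCl {s : α → (List Ln × Option Cl) × List Raw} (hs : PT s) :
    PT fun a => foundCl (s a) := by unfold CDCL.foundCl; fun_prop

@[fun_prop] theorem PT.addFacts {F : α → List Fact} {st : α → List Frame} (hF : PT F) (hs : PT st) :
    PT fun a => addFacts (F a) (st a) := by unfold CDCL.addFacts; fun_prop

@[fun_prop] theorem PT.learnedCl {f : α → Frame} (hf : PT f) : PT fun a => learnedCl (f a) := by
  unfold CDCL.learnedCl; fun_prop

@[fun_prop] theorem PT.pop {c : α → Ctx} {K : α → List ℕ} {f : α → Frame} {r : α → List Frame}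
    (hc : PT c) (hK : PT K) (hf : PT f) (hr : PT r) : PT fun a => pop (c a) (K a) (f a) (r a) := by
  unfold CDCL.pop; fun_prop

@[fun_prop] theorem PT.popE {c : α → Ctx} {K : α → List ℕ} {f : α → Frame}
    (hc : PT c) (hK : PT K) (hf : PT f) : PT fun a => popE (c a) (K a) (f a) := by
  unfold CDCL.popE; fun_prop

@[fun_prop] theorem PT.prep0 {c : α → Ctx} {f : α → Frame}
    (hc : PT c) (hf : PT f) : PT fun a => prep0 (c a) (f a) := by
  unfold CDCL.prep0; fun_prop

@[fun_prop] theorem PT.prep0E {c : α → Ctx} {f : α → Frame}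
    (hc : PT c) (hf : PT f) : PT fun a => prep0E (c a) (f a) := by
  unfold CDCL.prep0E; fun_prop

@[fun_prop] theorem PT.prep {c : α → Ctx} {K : α → List ℕ} {f : α → Frame}
    (hc : PT c) (hK : PT K) (hf : PT f) : PT fun a => prep (c a) (K a) (f a) := by
  unfold CDCL.prep; fun_prop

@[fun_prop] theorem PT.prepE {c : α → Ctx} {K : α → List ℕ} {f : α → Frame}
    (hc : PT c) (hK : PT K) (hf : PT f) : PT fun a => prepE (c a) (K a) (f a) := by
  unfold CDCL.prepE; fun_prop

@[fun_prop] theorem PT.canSet {c : α → Ctx} {K : α → List ℕ} {f : α → Frame}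
    (hc : PT c) (hK : PT K) (hf : PT f) : PT fun a => canSet (c a) (K a) (f a) := by
  unfold CDCL.canSet; fun_prop

@[fun_prop] theorem PT.hasConf {c : α → Ctx} {K : α → List ℕ} {f : α → Frame}
    (hc : PT c) (hK : PT K) (hf : PT f) : PT fun a => hasConf (c a) (K a) (f a) := by
  unfold CDCL.hasConf; fun_prop

@[fun_prop] theorem PT.stepFrame {c : α → Ctx} {K : α → List ℕ} {f : α → Frame}
    {r : α → List Frame} (hc : PT c) (hK : PT K) (hf : PT f) (hr : PT r) :
    PT fun a => stepFrame (c a) (K a) (f a) (r a) := by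
  unfold CDCL.stepFrame; fun_prop

@[fun_prop] theorem PT.stepFrameE {c : α → Ctx} {K : α → List ℕ} {f : α → Frame}
    (hc : PT c) (hK : PT K) (hf : PT f) : PT fun a => stepFrameE (c a) (K a) (f a) := by
  unfold CDCL.stepFrameE; fun_prop

@[fun_prop] theorem PT.step {c : α → Ctx} {st : α → List Frame} (hc : PT c) (hs : PT st) :
    PT fun a => step (c a) (st a) := by unfold CDCL.step; fun_prop

@[fun_prop] theorem PT.stepE {c : α → Ctx} {st : α → List Frame} (hc : PT c) (hs : PT st) :
    PT fun a => stepE (c a) (st a) := by unfold CDCL.stepE; fun_prop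

@[fun_prop] theorem PT.mkCtx {pos : α → List ℕ} (h : PT pos) : PT fun a => mkCtx (pos a) := by
  unfold CDCL.mkCtx; fun_prop

@[fun_prop] theorem PT.pivot {c : α → Ctx} {P Q : α → Cl} (hc : PT c) (hP : PT P) (hQ : PT Q) :
    PT fun a => pivot (c a) (P a) (Q a) := by unfold CDCL.pivot; fun_prop

@[fun_prop] theorem PT.mkLines {c : α → Ctx} {Pf : α → List (Cl × Option (ℕ × ℕ))} (hc : PT c)
    (hPf : PT Pf) : PT fun a => mkLines (c a) (Pf a) := by unfold CDCL.mkLines; fun_prop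

@[fun_prop] theorem PT.varList {c : α → Ctx} {L : α → List Ln} (hc : PT c)
    (hL : PT L) : PT fun a => varList (c a) (L a) := by unfold CDCL.varList; fun_prop

end polytime

/-! ### Correctness of single derivations -/

section semantics
variable {n : ℕ}

/-- The position of a variable in the order. -/
def pos (π : Equiv.Perm (Fin n)) (v : ℕ) : ℕ := if h : v < n then (π ⟨v, h⟩ : ℕ) else n

/-- The lists of the variables are as they should be. -/
structure CtxOK (π : Equiv.Perm (Fin n)) (c : Ctx) : Prop where
  vs : c.1 = List.range n
  mem : ∀ v, v ∈ c.2 ↔ v < n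
  sorted : c.2.Pairwise fun a b => pos π a < pos π b

theorem CtxOK.nodup {π : Equiv.Perm (Fin n)} {c : Ctx} (h : CtxOK π c) : c.2.Nodup :=
  h.sorted.imp fun h e => by subst e; exact lt_irrefl _ h

/-- The clause given by a list of signs. -/
def toClause (n : ℕ) (C : Cl) : Clause n :=
  ⟨Finset.univ.filter fun l : Lit n => lit C l.1 = some l.2, by
    intro i h
    simp only [Finset.mem_filter, Finset.mem_univ, true_and] at h
    rw [h.1] at h
    simp at h⟩

@[simp] theorem mem_toClause {C : Cl} {i : Fin n} {a : Bool} :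
    (i, a) ∈ (toClause n C).1 ↔ lit C i = some a := by simp [toClause]

/-- The trail given by a list. -/
def toTrail (n : ℕ) (t : List (ℕ × Bool × Bool)) : Trail n :=
  t.filterMap fun s => if h : s.1 < n then some ⟨⟨s.1, h⟩, if s.2.1 then .u else .d, s.2.2⟩
    else none

/-- A line of the output as a line of a proof. -/
def toLine (n : ℕ) : Raw → P0Line n
  | .inl C => .clause (toClause n C)
  | .inr t => .trail (toTrail n t)

theorem lit_eq_none {C : Cl} (hC : C.length = n) {v : ℕ} (hv : n ≤ v) : lit C v = none := by
  simp [lit, hC, hv]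

theorem lt_of_lit {C : Cl} (hC : C.length = n) {v : ℕ} (hv : lit C v ≠ none) : v < n := by
  by_contra h
  exact hv (lit_eq_none hC (by omega))

theorem mem_vars_toTrail {t : List (ℕ × Bool × Bool)} {i : Fin n} :
    i ∈ Trail.vars (toTrail n t) ↔ (i : ℕ) ∈ t.map Prod.fst := by
  simp only [Trail.vars, toTrail, List.mem_map, List.mem_filterMap]
  constructor
  · rintro ⟨_, ⟨s, hs, h⟩, rfl⟩
    by_cases hn : s.1 < n
    on_goal 2 => rw [dif_neg hn] at h; simp at h
    rw [dif_pos hn] at h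
    exact ⟨s, hs, by rw [← Option.some.inj h]⟩
  · rintro ⟨s, hs, h⟩
    exact ⟨_, ⟨s, hs, by rw [dif_pos (by rw [h]; exact i.2)]⟩, by ext; exact h⟩

theorem sets_toTrail {t : List (ℕ × Bool × Bool)} {f : ℕ → Bool} (hf : ∀ s ∈ t, s.2.2 = f s.1)
    {i : Fin n} {a : Bool} :
    Trail.Sets (toTrail n t) i a ↔ (i : ℕ) ∈ t.map Prod.fst ∧ a = f i := by
  simp only [Trail.Sets, toTrail, List.mem_map, List.mem_filterMap]
  constructor
  · rintro ⟨_, ⟨s, hs, h⟩, rfl, rfl⟩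
    by_cases hn : s.1 < n
    on_goal 2 => rw [dif_neg hn] at h; simp at h
    rw [dif_pos hn] at h
    rw [← Option.some.inj h]
    exact ⟨⟨s, hs, rfl⟩, hf s hs⟩
  · rintro ⟨⟨s, hs, h⟩, rfl⟩
    refine ⟨_, ⟨s, hs, by rw [dif_pos (by rw [h]; exact i.2)]⟩, by ext; exact h, ?_⟩
    change s.2.2 = f i
    rw [hf s hs, h]

/-- All values in the trail come from one function `f`, so a literal that is not satisfied is
falsified exactly when its variable appears in the trail. This reduces restrictions to membership,
for the unit case and the zero case below. -/
theorem restrict_toTrail {t : List (ℕ × Bool × Bool)} {f : ℕ → Bool}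
    (hf : ∀ s ∈ t, s.2.2 = f s.1) {C : Cl}
    (h : ∀ v ∈ t.map Prod.fst, lit C v ≠ some (f v)) :
    Clause.restrict (toClause n C) (toTrail n t) =
      some ((toClause n C).1.filter fun l => (l.1 : ℕ) ∉ t.map Prod.fst) := by
  classical
  rw [Clause.restrict, if_neg]
  · congr 1
    refine Finset.filter_congr fun l hl => ?_
    obtain ⟨i, a⟩ := l
    rw [mem_toClause] at hl
    rw [sets_toTrail hf, not_iff_not]
    refine ⟨fun h => h.1, fun h' => ⟨h', ?_⟩⟩
    have := h i h'
    rw [hl] at this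
    simp only [ne_eq, Option.some.injEq] at this
    simp only
    revert this
    cases a <;> cases f i <;> simp
  · rintro ⟨⟨i, a⟩, h1, h2⟩
    rw [mem_toClause] at h1
    rw [sets_toTrail hf] at h2
    exact h i h2.1 (by rw [h1]; exact congrArg some h2.2)

theorem restrict_unit {t : List (ℕ × Bool × Bool)} {f : ℕ → Bool}
    (hf : ∀ s ∈ t, s.2.2 = f s.1) {C : Cl}
    (h : ∀ v ∈ t.map Prod.fst, lit C v ≠ some (f v)) {z : Fin n} {a : Bool}
    (hz : lit C z = some a) (hzt : (z : ℕ) ∉ t.map Prod.fst)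
    (ho : ∀ v : ℕ, v ≠ z → lit C v ≠ none → v ∈ t.map Prod.fst) :
    Clause.restrict (toClause n C) (toTrail n t) = some {(z, a)} := by
  rw [restrict_toTrail hf h]
  congr 1
  ext ⟨i, b⟩
  rw [Finset.mem_filter, Finset.mem_singleton, mem_toClause]
  constructor
  · rintro ⟨h1, h2⟩
    have h3 : i = z := by
      by_contra h4
      exact h2 (ho i (fun h => h4 (Fin.ext h)) (by simp [h1]))
    subst h3
    rw [hz] at h1
    rw [Option.some.inj h1]
  · rintro h1
    obtain ⟨rfl, rfl⟩ := Prod.mk.inj h1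
    exact ⟨hz, hzt⟩

theorem restrict_zero {t : List (ℕ × Bool × Bool)} {f : ℕ → Bool}
    (hf : ∀ s ∈ t, s.2.2 = f s.1) {C : Cl}
    (h : ∀ v ∈ t.map Prod.fst, lit C v ≠ some (f v))
    (ho : ∀ v, lit C v ≠ none → v ∈ t.map Prod.fst) :
    Clause.restrict (toClause n C) (toTrail n t) = some ∅ := by
  rw [restrict_toTrail hf h]
  congr 1
  ext ⟨i, b⟩
  rw [Finset.mem_filter, mem_toClause]
  constructor
  · rintro ⟨h1, h2⟩
    exact absurd (ho i (by simp [h1])) h2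
  · simp

variable (π : Equiv.Perm (Fin n)) (τ : CNF n)

/-- A line that encodes a clause or a trail. -/
def IsLine (n : ℕ) : Raw → Prop
  | .inl C => C.length = n
  | .inr t => ∀ s ∈ t, s.1 < n

/-- The output so far is a proof. -/
structure Good (G : List Raw) : Prop where
  isProof : IsP0Proof π τ (G.map (toLine n))
  isLine : ∀ r ∈ G, IsLine n r

variable {π τ}

theorem Good.snoc {G : List Raw} (hG : Good π τ G) {r : Raw}
    (hr : P0Step π τ (G.map (toLine n)) (toLine n r)) (hl : IsLine n r) : Good π τ (G ++ [r]) := by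
  refine ⟨?_, fun s hs => ?_⟩
  on_goal 2 =>
    rcases List.mem_append.1 hs with h | h
    · exact hG.isLine s h
    · exact List.mem_singleton.1 h ▸ hl
  intro v L hL
  rw [List.map_append] at hL ⊢
  rcases lt_or_ge v G.length with h | h
  · rw [List.getElem?_append_left (by simpa using h)] at hL
    rw [List.take_append_of_le_length (by simp; omega)]
    exact hG.isProof v L hL
  · rw [List.getElem?_append_right (by simpa using h)] at hL
    have h1 : v = G.length := by
      have := (List.getElem?_eq_some_iff.1 hL).1
      simp at this
      omega
    subst h1
    simp at hL
    subst hL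
    simpa using hr

/-- Trails that can be derived from given clauses. -/
inductive Chain (π : Equiv.Perm (Fin n)) (A : Set (Clause n)) : List (ℕ × Bool × Bool) → Prop
  | nil : Chain π A []
  | dec (t : List (ℕ × Bool × Bool)) (v : ℕ) (b : Bool) (ht : Chain π A t) (hv : v < n)
      (h : v ∉ t.map Prod.fst) (hm : ∀ j < n, j ∉ t.map Prod.fst → pos π v ≤ pos π j) :
      Chain π A (t ++ [(v, false, b)])
  | prop (t : List (ℕ × Bool × Bool)) (v : Fin n) (b : Bool) (C : Clause n) (ht : Chain π A t)
      (hC : C ∈ A) (h : Clause.restrict C (toTrail n t) = some {(v, b)}) :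
      Chain π A (t ++ [((v : ℕ), true, b)])

theorem prefixes_append_singleton {α : Type} (t : List α) (x : α) :
    prefixes (t ++ [x]) = prefixes t ++ [t ++ [x]] := by
  have : (foldEmit (fun s x => s ++ [x]) (fun s (x : α) => [s ++ [x]]) t []).1 = t := by
    rw [foldEmit_fst, foldl_snoc]; simp
  rw [prefixes, foldEmit_append_singleton, this]
  rfl

/-- Each prefix of the trail follows from the one before it, so the trail is derived by listing its
prefixes after the empty trail. -/
theorem Good.chain {G : List Raw} (hG : Good π τ G) (h0 : (.inr [] : Raw) ∈ G)
    {t : List (ℕ × Bool × Bool)}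
    (ht : Chain π {C | .clause C ∈ G.map (toLine n)} t) :
    Good π τ (G ++ (prefixes t).map fun t => .inr t) ∧
      (.inr t : Raw) ∈ G ++ (prefixes t).map fun t => .inr t := by
  induction ht with
  | nil => simpa [prefixes] using ⟨hG, h0⟩
  | dec t v b ht hv h hm ih =>
    rw [prefixes_append_singleton, List.map_append, ← List.append_assoc]
    refine ⟨ih.1.snoc ?_ ?_, by simp⟩
    on_goal 2 =>
      intro s hs
      rcases List.mem_append.1 hs with h | h
      · exact ih.1.isLine _ ih.2 s h
      · rw [List.mem_singleton.1 h]
        exact hv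
    have := P0Step.decision (π := π) (τ := τ) (toTrail n t) ⟨v, hv⟩ b
      (List.mem_map_of_mem (f := toLine n) ih.2) (by rwa [mem_vars_toTrail]) (fun j hj => by
        rw [mem_vars_toTrail] at hj
        have := hm j j.2 hj
        simpa [pos, hv] using this)
    have e : toLine n (.inr (t ++ [(v, false, b)])) =
        .trail (toTrail n t ++ [⟨⟨v, hv⟩, .d, b⟩]) := by simp [toLine, toTrail, hv]
    exact e ▸ this
  | prop t v b C ht hC h ih =>
    rw [prefixes_append_singleton, List.map_append, ← List.append_assoc]
    refine ⟨ih.1.snoc ?_ ?_, by simp⟩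
    on_goal 2 =>
      intro s hs
      rcases List.mem_append.1 hs with h | h
      · exact ih.1.isLine _ ih.2 s h
      · rw [List.mem_singleton.1 h]
        exact v.2
    have := P0Step.unitProp (π := π) (τ := τ) (toTrail n t) C v b
      (List.mem_map_of_mem (f := toLine n) ih.2)
      (List.map_subset _ (List.subset_append_left _ _) hC) h
    have e : toLine n (.inr (t ++ [((v : ℕ), true, b)])) =
        .trail (toTrail n t ++ [⟨v, .u, b⟩]) := by simp [toLine, toTrail]
    exact e ▸ this

theorem lit_res {c : Ctx} (hc : CtxOK π c) {P Q : Cl} (hP : P.length = n) (hQ : Q.length = n)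
    (z v : ℕ) : lit (res c P Q z) v =
      if v = z then none else if lit P v = none then lit Q v else lit P v := by
  rw [lit, res, hc.vs]
  rcases lt_or_ge v n with h | h
  · rw [List.getD_eq_getElem _ _ (by simpa using h)]
    simp [Bool.cond_eq_ite]
  · rw [List.getD_eq_default _ _ (by simpa using h), lit_eq_none hP h, lit_eq_none hQ h]
    simp

theorem length_res {c : Ctx} (hc : CtxOK π c) (P Q : Cl) (z : ℕ) : (res c P Q z).length = n := by
  simp [res, hc.vs]

/-- As `K` is an initial segment of the sorted list of variables, the next variable is always the
smallest one not yet assigned, so each of these decisions is legal. -/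
theorem chain_prefix {c : Ctx} (hc : CtxOK π c) (A : Set (Clause n)) {K : List ℕ}
    (hK : K <+: c.2) : Chain π A (K.map fun v => (v, false, false)) := by
  induction K using List.reverseRecOn with
  | nil => exact .nil
  | append_singleton K v ih =>
    rw [List.map_append, List.map_singleton]
    obtain ⟨r, hr⟩ := hK
    have hs := hc.sorted
    have hm : v < n := (hc.mem v).1 (by simp [← hr])
    rw [← hr] at hs
    simp only [List.append_assoc, List.singleton_append] at hs
    rw [List.pairwise_append] at hs
    refine .dec _ _ _ (ih ⟨v :: r, by simp [← hr]⟩) hm ?_ ?_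
    · simp only [List.map_map, List.mem_map, Function.comp, exists_eq_right]
      exact fun h => lt_irrefl _ (hs.2.2 v h v (by simp))
    · intro j hj hjK
      simp only [List.map_map, List.mem_map, Function.comp, exists_eq_right] at hjK
      have : j ∈ c.2 := (hc.mem j).2 hj
      rw [← hr] at this
      simp only [List.append_assoc, List.singleton_append, List.mem_append, List.mem_cons,
        hjK, false_or] at this
      rcases this with rfl | h
      · exact le_rfl
      · exact ((List.pairwise_cons.1 hs.2.1).1 j h).le

/-- The values assigned by `mkTrail`. -/
def trailVal (K : List ℕ) (P Q : Cl) (z v : ℕ) : Bool :=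
  if v ∈ K then false else if v = z then decide (lit P z = some true)
  else if lit P v = none then decide (lit Q v = some false) else decide (lit P v = some false)

/-- `A` becomes the literal `w ^ b` when the variables in `K` are set to zero. -/
structure IsFact (n : ℕ) (G : List Raw) (K : List ℕ) (w : ℕ) (b : Bool) (A : Cl) : Prop where
  mem : (.inl A : Raw) ∈ G
  len : A.length = n
  lit_eq : lit A w = some b
  other : ∀ v, v ≠ w → lit A v ≠ none → v ∈ K ∧ lit A v = some true

/-- The conditions for the derivation of a resolvent. -/
structure LearnOK (n : ℕ) (G : List Raw) (K : List ℕ) (P Q : Cl) (z : ℕ) (a : Bool) : Prop where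
  memP : (.inl P : Raw) ∈ G
  memQ : (.inl Q : Raw) ∈ G
  lenP : P.length = n
  lenQ : Q.length = n
  litP : lit P z = some a
  litQ : lit Q z = some (!a)
  notMem : z ∉ K
  compat : ∀ v, v ≠ z → ∀ b b', lit P v = some b → lit Q v = some b' → b = b'
  posP : ∀ v ∈ K, lit P v ≠ some false
  posQ : ∀ v ∈ K, lit Q v ≠ some false
  facts : ∀ w, w ∉ K → w ≠ z → ∀ b, lit P w = some b → ∃ A, IsFact n G K w (!b) A

theorem trailVal_spec {c : Ctx} {K : List ℕ} {P Q : Cl} {z : ℕ} (hz : z ∉ K)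
    (hPz : lit P z ≠ none) : ∀ s ∈ mkTrail c K P Q z, s.2.2 = trailVal K P Q z s.1 := by
  intro s hs
  simp only [mkTrail, List.mem_append, List.mem_map, List.mem_cons, List.mem_filter] at hs
  rcases hs with ⟨v, hv, rfl⟩ | ⟨v, hv, rfl⟩ | rfl | ⟨v, hv, rfl⟩
  · simp [trailVal, hv]
  · simp at hv
    simp [trailVal, hv]
  · simp [trailVal, hz]
  · simp at hv
    simp only [trailVal, hv]
    by_cases h : v = z
    · subst h; simp_all
    · simp [h]

/-- On `K` the value is zero and neither clause has a negative literal there. Elsewhere the value is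
chosen against `P`, or against `Q` where `P` is silent; where both clauses have a literal, the signs
agree. -/
theorem LearnOK.resolvent_ne {G : List Raw} {K : List ℕ} {P Q : Cl} {z : ℕ} {a : Bool}
    (h : LearnOK n G K P Q z a) {v : ℕ} (hv : v ≠ z) :
    lit P v ≠ some (trailVal K P Q z v) ∧ lit Q v ≠ some (trailVal K P Q z v) := by
  by_cases hK : v ∈ K
  · simp [trailVal, hK, h.posP v hK, h.posQ v hK]
  · simp only [trailVal, hK, hv, if_false]
    cases hP : lit P v with
    | none => cases hQ : lit Q v with
      | none => simp
      | some b => cases b <;> simp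
    | some b => cases hQ : lit Q v with
      | none => cases b <;> simp
      | some b' => rw [h.compat v hv b b' hP hQ]; cases b' <;> simp

-- The central derivation. The trail has four segments: decisions on `K`, propagations by facts that
-- falsify the rest of `P`, the propagation of `z` by `P`, and decisions against `Q`. The order
-- matters only for the decisions: the first segment is initial, and when the last one starts, every
-- variable still missing is decided in increasing order.
set_option maxHeartbeats 1000000 in
theorem Good.learn {c : Ctx} (hc : CtxOK π c) {K : List ℕ} (hK : K <+: c.2) {G : List Raw}
    (hG : Good π τ G) {P Q : Cl} {z : ℕ} {a : Bool} (h : LearnOK n G K P Q z a) :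
    Good π τ (G ++ learn c K P Q z) ∧ (.inl (res c P Q z) : Raw) ∈ G ++ learn c K P Q z := by
  set G₁ : List Raw := G ++ [.inr []] with hG₁
  have hG₁' : Good π τ G₁ := hG.snoc .emptyTrail (by simp [IsLine])
  set A : Set (Clause n) := {C | .clause C ∈ G₁.map (toLine n)} with hA
  have memA : ∀ C, (.inl C : Raw) ∈ G → toClause n C ∈ A := fun C hC =>
    List.mem_map.2 ⟨.inl C, by simp [hG₁, hC], rfl⟩
  have hzn : z < n := lt_of_lit h.lenP (by simp [h.litP])
  have hKn : ∀ v ∈ K, v < n := fun v hv => (hc.mem v).1 (hK.subset hv)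
  set f := trailVal K P Q z with hf
  have hfK : ∀ v ∈ K, f v = false := fun v hv => by simp [hf, trailVal, hv]
  set t₀ : List (ℕ × Bool × Bool) := K.map fun v => (v, false, false) with ht₀
  set F₁ := c.2.filter fun v => !decide (v ∈ K) && (!decide (v = z) && !decide (lit P v = none))
    with hF₁
  set F₂ := c.2.filter fun v => !decide (v ∈ K) && decide (lit P v = none) with hF₂
  set e₁ : ℕ → ℕ × Bool × Bool := fun v => (v, true, decide (lit P v = some false)) with he₁
  set e₂ : ℕ → ℕ × Bool × Bool := fun v => (v, false, decide (lit Q v = some false)) with he₂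
  have htr : mkTrail c K P Q z =
      (t₀ ++ F₁.map e₁) ++ (z, true, decide (lit P z = some true)) :: F₂.map e₂ := by
    simp [mkTrail, ht₀, hF₁, hF₂, he₁, he₂]
  have hval : ∀ s ∈ mkTrail c K P Q z, s.2.2 = f s.1 := trailVal_spec h.notMem (by simp [h.litP])
  have hfst₀ : ∀ v, v ∈ t₀.map Prod.fst ↔ v ∈ K := fun v => by simp [ht₀]
  have hfst₁ : ∀ (l : List ℕ) v, v ∈ (l.map e₁).map Prod.fst ↔ v ∈ l := fun l v => by simp [he₁]
  have hfst₂ : ∀ (l : List ℕ) v, v ∈ (l.map e₂).map Prod.fst ↔ v ∈ l := fun l v => by simp [he₂]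
  have hmem₁ : ∀ v, v ∈ F₁ ↔ v < n ∧ v ∉ K ∧ v ≠ z ∧ lit P v ≠ none := fun v => by
    simp [hF₁, hc.mem]
  have hmem₂ : ∀ v, v ∈ F₂ ↔ v < n ∧ v ∉ K ∧ lit P v = none := fun v => by
    simp [hF₂, hc.mem]
  -- A fact depends only on variables in `K`, which are already zero. So the propagations are
  -- independent of each other and may come in any sequence.
  have c₁ : ∀ l, l <+: F₁ → Chain π A (t₀ ++ l.map e₁) := by
    intro l
    induction l using List.reverseRecOn with
    | nil => intro _; simpa using chain_prefix hc A hK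
    | append_singleton l w ih =>
      intro hl
      have hl' : l <+: F₁ := (List.prefix_append l [w]).trans hl
      have hw := (hmem₁ w).1 (hl.subset (by simp))
      obtain ⟨b, hb⟩ := Option.ne_none_iff_exists'.1 hw.2.2.2
      obtain ⟨B, hB⟩ := h.facts w hw.2.1 hw.2.2.1 b hb
      have hnd : (l ++ [w]).Nodup := (hc.nodup.filter _).sublist hl.sublist
      have hwl : w ∉ l := fun h' => (List.nodup_append.1 hnd).2.2 w h' w (by simp) rfl
      rw [List.map_append, ← List.append_assoc, List.map_singleton]
      have e : e₁ w = (((⟨w, hw.1⟩ : Fin n) : ℕ), true, !b) := by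
        simp only [he₁, hb]; cases b <;> simp
      rw [e]
      refine .prop _ _ _ _ (ih hl') (memA B hB.mem) (restrict_unit (f := f) ?_ ?_ hB.lit_eq ?_ ?_)
      · intro s hs
        refine hval s ?_
        rw [htr]
        have : s ∈ t₀ ++ F₁.map e₁ := by
          rcases List.mem_append.1 hs with hs | hs
          · exact List.mem_append_left _ hs
          · exact List.mem_append_right _ (List.map_subset _ hl'.subset hs)
        exact List.mem_append_left _ this
      · intro v hv
        rw [List.map_append, List.mem_append, hfst₀, hfst₁] at hv
        by_cases hvw : v = w
        · subst hvw
          exact absurd hv (by simp [hw.2.1, hwl])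
        · by_cases hn : lit B v = none
          · simp [hn]
          · obtain ⟨h1, h2⟩ := hB.other v hvw hn
            rw [h2, hfK v h1]
            simp
      · rw [List.map_append, List.mem_append, hfst₀, hfst₁]
        simp [hw.2.1, hwl]
      · intro v hv hn
        rw [List.map_append, List.mem_append, hfst₀]
        exact Or.inl (hB.other v hv hn).1
  have hsub₁ : ∀ s ∈ t₀ ++ F₁.map e₁, s.2.2 = f s.1 := fun s hs =>
    hval s (by rw [htr]; exact List.mem_append_left _ hs)
  have hz₁ : z ∉ (t₀ ++ F₁.map e₁).map Prod.fst := by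
    rw [List.map_append, List.mem_append, hfst₀, hfst₁, hmem₁]
    simp [h.notMem]
  -- Every literal of `P` except the pivot is now falsified, so `P` itself is unit.
  have c₂ : Chain π A (t₀ ++ F₁.map e₁ ++ [(z, true, decide (lit P z = some true))]) := by
    have e : decide (lit P z = some true) = a := by rw [h.litP]; cases a <;> simp
    rw [e]
    refine .prop _ ⟨z, hzn⟩ _ _ (c₁ F₁ List.prefix_rfl) (memA P h.memP)
      (restrict_unit hsub₁ ?_ h.litP hz₁ ?_)
    · intro v hv
      have : v ≠ z := fun e => hz₁ (e ▸ hv)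
      exact (h.resolvent_ne this).1
    · intro v hv hn
      rw [List.map_append, List.mem_append, hfst₀, hfst₁, hmem₁]
      by_cases hvK : v ∈ K
      · exact Or.inl hvK
      · exact Or.inr ⟨lt_of_lit h.lenP hn, hvK, hv, hn⟩
  -- The variables not yet assigned are exactly those of `F₂`, taken in increasing order; so each is
  -- the smallest one missing when its turn comes.
  have c₃ : ∀ l, l <+: F₂ →
      Chain π A (t₀ ++ F₁.map e₁ ++ [(z, true, decide (lit P z = some true))] ++ l.map e₂) := by
    intro l
    induction l using List.reverseRecOn with
    | nil => intro _; simpa using c₂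
    | append_singleton l w ih =>
      intro hl
      have hl' : l <+: F₂ := (List.prefix_append l [w]).trans hl
      have hw := (hmem₂ w).1 (hl.subset (by simp))
      rw [List.map_append, ← List.append_assoc, List.map_singleton]
      have hfst : ∀ v, v ∈ (t₀ ++ F₁.map e₁ ++ [(z, true, decide (lit P z = some true))] ++
          l.map e₂).map Prod.fst ↔ ((v ∈ K ∨ v ∈ F₁) ∨ v = z) ∨ v ∈ l := by
        intro v
        rw [List.map_append, List.mem_append, List.map_append, List.mem_append, List.map_append,
          List.mem_append, hfst₀, hfst₁, hfst₂]
        simp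
      obtain ⟨r, hr⟩ := hl
      have hs : F₂.Pairwise fun a b => pos π a < pos π b := hc.sorted.filter _
      rw [← hr] at hs
      simp only [List.append_assoc, List.singleton_append] at hs
      rw [List.pairwise_append] at hs
      refine .dec _ _ _ (ih hl') hw.1 ?_ ?_
      · rw [hfst, hmem₁]
        have h1 : w ≠ z := by rintro rfl; rw [h.litP] at hw; simp at hw
        have h2 : w ∉ l := fun h' => lt_irrefl _ (hs.2.2 w h' w (by simp))
        simp [hw, h1, h2]
      · intro j hj hjt
        rw [hfst] at hjt
        push Not at hjt
        have h1 : j ∈ F₂ := by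
          rw [hmem₂]
          refine ⟨hj, hjt.1.1.1, ?_⟩
          by_contra h2
          exact hjt.1.1.2 ((hmem₁ j).2 ⟨hj, hjt.1.1.1, hjt.1.2, h2⟩)
        rw [← hr] at h1
        simp only [List.append_assoc, List.singleton_append, List.mem_append, List.mem_cons,
          hjt.2, false_or] at h1
        rcases h1 with rfl | h1
        · exact le_rfl
        · exact ((List.pairwise_cons.1 hs.2.1).1 j h1).le
  have c₄ := c₃ F₂ List.prefix_rfl
  rw [List.append_assoc, List.singleton_append, ← htr] at c₄
  obtain ⟨g₁, g₂⟩ := hG₁'.chain (by simp [hG₁]) c₄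
  have hl : G ++ CDCL.learn c K P Q z =
      (G₁ ++ (prefixes (mkTrail c K P Q z)).map fun t => .inr t) ++ [.inl (res c P Q z)] := by
    simp [CDCL.learn, hG₁]
  rw [hl]
  refine ⟨g₁.snoc ?_ (length_res hc P Q z), by simp⟩
  -- The trail is total, so the resolvent, none of whose literals is satisfied, restricts to the
  -- empty clause.
  have hall : ∀ v < n, v ∈ (mkTrail c K P Q z).map Prod.fst := by
    intro v hv
    rw [htr, List.map_append, List.mem_append, List.map_append, List.mem_append, hfst₀, hfst₁,
      List.map_cons, List.mem_cons, hfst₂, hmem₁, hmem₂]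
    by_cases h1 : v ∈ K
    · exact Or.inl (Or.inl h1)
    · by_cases h2 : v = z
      · exact Or.inr (Or.inl h2)
      · by_cases h3 : lit P v = none
        · exact Or.inr (Or.inr ⟨hv, h1, h3⟩)
        · exact Or.inl (Or.inr ⟨hv, h1, h2, h3⟩)
  have e : toTrail n (mkTrail c K P Q z) = toTrail n (t₀ ++ F₁.map e₁) ++
      (⟨⟨z, hzn⟩, .u, a⟩ :: toTrail n (F₂.map e₂)) := by
    have e : decide (lit P z = some true) = a := by rw [h.litP]; cases a <;> simp
    rw [htr, e, toTrail, List.filterMap_append, List.filterMap_cons]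
    simp [hzn, toTrail]
  refine P0Step.learning (toClause n P) (toClause n Q) (toClause n (res c P Q z)) ⟨z, hzn⟩ a .u
    (toTrail n (t₀ ++ F₁.map e₁)) (toTrail n (F₂.map e₂)) ?_ ?_ ?_ ?_ ?_ ?_
  · exact List.mem_map.2 ⟨.inl P, by simp [hG₁, h.memP], rfl⟩
  · exact List.mem_map.2 ⟨.inl Q, by simp [hG₁, h.memQ], rfl⟩
  · exact List.mem_map.2 ⟨_, g₂, by rw [toLine, e]⟩
  · refine ⟨mem_toClause.2 h.litP, mem_toClause.2 h.litQ, ?_⟩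
    ext ⟨i, b⟩
    rw [mem_toClause, lit_res hc h.lenP h.lenQ, Finset.mem_union, Finset.mem_erase,
      Finset.mem_erase, mem_toClause, mem_toClause]
    by_cases hi : (i : ℕ) = z
    · have hi' : i = ⟨z, hzn⟩ := Fin.ext hi
      subst hi'
      simp only [if_true, h.litP, h.litQ]
      cases a <;> cases b <;> simp
    · have hi' : i ≠ ⟨z, hzn⟩ := fun e => hi (congrArg Fin.val e)
      simp only [hi, if_false, ne_eq, Prod.mk.injEq, hi', false_and, not_false_eq_true, true_and]
      cases hP : lit P i with
      | none => simp
      | some b' =>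
        simp only [reduceCtorEq, if_false]
        constructor
        · exact Or.inl
        · rintro (h1 | h1)
          · exact h1
          · rw [h.compat i hi b' b hP h1]
  · rw [← e]
    refine restrict_zero hval ?_ ?_
    · intro v _
      rw [lit_res hc h.lenP h.lenQ]
      by_cases hv : v = z
      · simp [hv]
      · rw [if_neg hv]
        split_ifs
        · exact (h.resolvent_ne hv).2
        · exact (h.resolvent_ne hv).1
    · intro v hv
      exact hall v (lt_of_lit (length_res hc P Q z) hv)
  · intro j hj hne
    rw [mem_vars_toTrail, List.map_append, List.mem_append, hfst₀, hfst₁, hmem₁]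
    obtain ⟨⟨i, b⟩, h1, rfl⟩ := Finset.mem_image.1 hj
    rw [mem_toClause] at h1
    by_cases h2 : (i : ℕ) ∈ K
    · exact Or.inl h2
    · exact Or.inr ⟨i.2, h2, fun h => hne (Fin.ext h), by simp [h1]⟩

end semantics

/-! ### Shortening clauses by resolution with facts. -/

section strip
variable {n : ℕ} {π : Equiv.Perm (Fin n)} {τ : CNF n} {c : Ctx} {G : List Raw} {O : ℕ → Prop}
  {K : List ℕ}

/-- The clause `C` is derived, has only variables in `O`, and does not contain the negation of a
variable in `K`. -/
structure Der (n : ℕ) (G : List Raw) (O : ℕ → Prop) (K : List ℕ) (C : Cl) : Prop where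
  mem : (.inl C : Raw) ∈ G
  len : C.length = n
  sup : ∀ v, lit C v ≠ none → O v
  nn : ∀ v ∈ K, lit C v ≠ some false

/-- `A` is a derived clause with variables in `O` that becomes the literal `z ^ b` when the variables
in `K` are set to zero, and `z` is not in `K`. -/
structure FactOK (n : ℕ) (G : List Raw) (O : ℕ → Prop) (K : List ℕ) (u : Fact) : Prop
    extends IsFact n G K u.1 u.2.1 u.2.2 where
  notMem : u.1 ∉ K
  sup : ∀ v, lit u.2.2 v ≠ none → O v

theorem Der.mono {C : Cl} (h : Der n G O K C) {G' : List Raw} {O' : ℕ → Prop} (hG : G ⊆ G')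
    (hO : ∀ v, O v → O' v) : Der n G' O' K C :=
  ⟨hG h.mem, h.len, fun v hv => hO v (h.sup v hv), h.nn⟩

theorem IsFact.mono {z : ℕ} {b : Bool} {A : Cl} (h : IsFact n G K z b A) {G' : List Raw}
    (hG : G ⊆ G') : IsFact n G' K z b A := ⟨hG h.mem, h.len, h.lit_eq, h.other⟩

theorem FactOK.mono {u : Fact} (h : FactOK n G O K u) {G' : List Raw} {O' : ℕ → Prop}
    (hG : G ⊆ G') (hO : ∀ v, O v → O' v) : FactOK n G' O' K u :=
  { h.toIsFact.mono hG with notMem := h.notMem, sup := fun v hv => hO v (h.sup v hv) }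

theorem FactOK.nn {u : Fact} (h : FactOK n G O K u) : ∀ v ∈ K, lit u.2.2 v ≠ some false := by
  intro v hv h'
  have h1 : v ≠ u.1 := fun e => h.notMem (e ▸ hv)
  have := (h.other v h1 (by simp [h'])).2
  simp [h'] at this

/-- The fact takes the role of `P` in the learning step, where it needs no further facts. The
resolvent may acquire positive literals on `K` from the fact; therefore its literals are described
exactly only outside `K`, while on `K` it is only recorded that no literal is lost. -/
theorem strip1_spec (hc : CtxOK π c) (hK : K <+: c.2) (hG : Good π τ G) {u : Fact}
    (hu : FactOK n G O K u) {C : Cl} (hC : Der n G O K C) :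
    Good π τ (G ++ strip1E c K C u) ∧ Der n (G ++ strip1E c K C u) O K (strip1 c C u) ∧
      (∀ v ∉ K, lit (strip1 c C u) v =
        if v = u.1 ∧ lit C v = some (!u.2.1) then none else lit C v) ∧
      ∀ v ∈ K, lit C v ≠ none → lit (strip1 c C u) v ≠ none := by
  by_cases h : lit C u.1 = some (!u.2.1)
  · have e₁ : strip1E c K C u = learn c K u.2.2 C u.1 := by simp [strip1E, h]
    have e₂ : strip1 c C u = res c u.2.2 C u.1 := by simp [strip1, h]
    have hl : LearnOK n G K u.2.2 C u.1 u.2.1 :=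
      { memP := hu.mem, memQ := hC.mem, lenP := hu.len, lenQ := hC.len, litP := hu.lit_eq
        litQ := h, notMem := hu.notMem, posP := hu.nn, posQ := hC.nn
        -- The other literals of the fact are positive and lie on `K`, where `C` has no negative
        -- literals; so there is no clash.
        compat := by
          intro v hv b b' h1 h2
          obtain ⟨h3, h4⟩ := hu.other v hv (by simp [h1])
          rw [h4] at h1
          have := hC.nn v h3
          rw [h2] at this
          cases b' <;> simp_all
        -- Vacuous: outside `K`, the fact has no variable except the pivot.
        facts := fun w hw hwz b hb => absurd (hu.other w hwz (by simp [hb])).1 hw }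
    obtain ⟨g₁, g₂⟩ := hG.learn hc hK hl
    rw [e₁, e₂]
    refine ⟨g₁, ⟨g₂, length_res hc _ _ _, ?_, ?_⟩, ?_, ?_⟩
    · intro v hv
      rw [lit_res hc hu.len hC.len] at hv
      split_ifs at hv with h1 h2
      · simp at hv
      · exact hC.sup v hv
      · exact hu.sup v hv
    · intro v hv
      rw [lit_res hc hu.len hC.len]
      split_ifs
      · simp
      · exact hC.nn v hv
      · exact hu.nn v hv
    · intro v hv
      rw [lit_res hc hu.len hC.len]
      by_cases h1 : v = u.1
      · simp [h1, h]
      · have : lit u.2.2 v = none := by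
          by_contra h2
          exact hv (hu.other v h1 h2).1
        simp [h1, this]
    · intro v hv hn
      rw [lit_res hc hu.len hC.len, if_neg (show v ≠ u.1 from fun e => hu.notMem (e ▸ hv))]
      split_ifs with h1
      · exact hn
      · exact h1
  · have e₁ : strip1E c K C u = [] := by simp [strip1E, h]
    have e₂ : strip1 c C u = C := by simp [strip1, h]
    rw [e₁, e₂, List.append_nil]
    refine ⟨hG, hC, fun v _ => ?_, fun _ _ h => h⟩
    rw [if_neg]
    rintro ⟨rfl, h'⟩
    exact h h'

-- The facts may be used one after another because resolving with one of them neither adds nor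
-- changes literals outside `K`; so whether another fact applies is still decided by the original
-- clause.
open Classical in
theorem strip_spec (hc : CtxOK π c) (hK : K <+: c.2) {us : List Fact} (hG : Good π τ G)
    (hu : ∀ u ∈ us, FactOK n G O K u) {C : Cl} (hC : Der n G O K C) :
    Good π τ (G ++ (strip c K us C).2) ∧ Der n (G ++ (strip c K us C).2) O K (strip c K us C).1 ∧
      (∀ v ∉ K, lit (strip c K us C).1 v =
        if ∃ u ∈ us, v = u.1 ∧ lit C v = some (!u.2.1) then none else lit C v) ∧
      ∀ v ∈ K, lit C v ≠ none → lit (strip c K us C).1 v ≠ none := by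
  induction us generalizing G C with
  | nil => simpa [strip] using ⟨hG, hC⟩
  | cons u us ih =>
    obtain ⟨g₁, g₂, g₃, g₄⟩ := strip1_spec hc hK hG (hu u (by simp)) hC
    obtain ⟨k₁, k₂, k₃, k₄⟩ := ih g₁
      (fun w hw => (hu w (by simp [hw])).mono (List.subset_append_left _ _) fun _ h => h) g₂
    have e : strip c K (u :: us) C = ((strip c K us (strip1 c C u)).1,
      strip1E c K C u ++ (strip c K us (strip1 c C u)).2) := foldEmit_cons _ _ _ _ _
    rw [e]
    simp only [← List.append_assoc]
    refine ⟨k₁, k₂, fun v hv => ?_, fun v hv hn => k₄ v hv (g₄ v hv hn)⟩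
    rw [k₃ v hv, g₃ v hv]
    by_cases h : v = u.1 ∧ lit C v = some (!u.2.1)
    · have h' : ∃ w ∈ u :: us, v = w.1 ∧ lit C v = some (!w.2.1) := ⟨u, by simp, h⟩
      rw [if_pos h, if_pos h']
      simp
    · rw [if_neg h]
      simp [h]

theorem justOf_eq {l : Ln} {q : Just} : justOf l = some q ↔ l = some (.inr q) := by
  rcases l with _ | C' | q <;> simp [justOf]

theorem stripE_spec (hc : CtxOK π c) (hK : K <+: c.2) {us : List Fact} (hG : Good π τ G)
    (hu : ∀ u ∈ us, FactOK n G O K u) {L : List Ln}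
    (hL : ∀ C, (some (.inl C) : Ln) ∈ L → Der n G O K C) :
    Good π τ (G ++ stripE c K us L) ∧ ∀ C, (some (.inl C) : Ln) ∈ L →
      Der n (G ++ stripE c K us L) O K (strip c K us C).1 := by
  induction L using List.reverseRecOn with
  | nil => simpa [stripE] using hG
  | append_singleton L l ih =>
    obtain ⟨g₁, g₂⟩ := ih fun C hC => hL C (by simp [hC])
    have e : stripE c K us (L ++ [l]) = stripE c K us L ++ stripE c K us [l] := by
      simp [stripE]
    rw [e, ← List.append_assoc]
    rcases l with _ | C | q
    · have : stripE c K us [none] = [] := rfl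
      rw [this, List.append_nil]
      exact ⟨g₁, fun C hC => g₂ C (by simpa using hC)⟩
    · have : stripE c K us [some (.inl C)] = (strip c K us C).2 := by simp [stripE, axOf]
      rw [this]
      obtain ⟨k₁, k₂, -⟩ := strip_spec hc hK g₁
        (fun u h => (hu u h).mono (List.subset_append_left _ _) fun _ h => h)
        ((hL C (by simp)).mono (List.subset_append_left _ _) fun _ h => h)
      refine ⟨k₁, fun C' hC' => ?_⟩
      rw [List.mem_append] at hC'
      rcases hC' with h | h
      · exact (g₂ C' h).mono (List.subset_append_left _ _) fun _ h => h
      · simp at h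
        subst h
        exact k₂
    · have : stripE c K us [some (.inr q)] = [] := rfl
      rw [this, List.append_nil]
      exact ⟨g₁, fun C hC => g₂ C (by simpa using hC)⟩

theorem stripL_getElem? (us : List Fact) (L : List Ln) (v : ℕ) : (stripL c K us L)[v]? =
    L[v]?.map fun l => (axOf l).elim l fun C => some (.inl (strip c K us C).1) := by
  simp [stripL]

theorem mem_stripL {us : List Fact} {L : List Ln} {C : Cl} :
    (some (.inl C) : Ln) ∈ stripL c K us L ↔
      ∃ C', (some (.inl C') : Ln) ∈ L ∧ (strip c K us C').1 = C := by
  simp only [stripL, List.mem_map]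
  constructor
  · rintro ⟨l, hl, h⟩
    rcases l with _ | C' | q
    · simp [axOf] at h
    · exact ⟨C', hl, by simpa [axOf] using h⟩
    · simp [axOf] at h
  · rintro ⟨C', h, rfl⟩
    exact ⟨_, h, by simp [axOf]⟩

theorem dropL_getElem? (x : ℕ) (s : Bool) (L : List Ln) (v : ℕ) : (dropL x s L)[v]? =
    L[v]?.map fun l => (axOf l).elim l fun C => bif decide (lit C x = some s) then none else l := by
  simp [dropL]

theorem mem_dropL {x : ℕ} {s : Bool} {L : List Ln} {C : Cl} :
    (some (.inl C) : Ln) ∈ dropL x s L ↔ (some (.inl C) : Ln) ∈ L ∧ lit C x ≠ some s := by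
  simp only [dropL, List.mem_map]
  constructor
  · rintro ⟨l, hl, h⟩
    rcases l with _ | C' | q
    · simp [axOf] at h
    · by_cases h' : lit C' x = some s
      · simp [axOf, h'] at h
      · simp only [axOf, Option.elim_some, Sum.elim_inl, h', decide_false, cond_false,
          Option.some.injEq, Sum.inl.injEq] at h
        exact h ▸ ⟨hl, h'⟩
    · simp [axOf] at h
  · rintro ⟨h, h'⟩
    exact ⟨_, h, by simp [axOf, h']⟩

theorem blank_iff (hc : CtxOK π c) {C : Cl} (hC : C.length = n) :
    blank c K C = true ↔ ∀ i ∉ K, lit C i = none := by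
  simp only [blank, hc.vs, List.all_eq_true, List.mem_range, Bool.or_eq_true, decide_eq_true_eq]
  refine ⟨fun h i hi => ?_, fun h i _ => or_iff_not_imp_left.2 (h i)⟩
  rcases lt_or_ge i n with h' | h'
  · exact (h i h').resolve_left hi
  · exact lit_eq_none hC h'

theorem mem_units {x : ℕ} {s : Bool} {L : List Ln} {C : Cl} : C ∈ units c K x s L ↔
    (some (.inl C) : Ln) ∈ L ∧ blank c K C = true ∧ lit C x = some s := by
  simp only [units, List.mem_flatMap]
  constructor
  · rintro ⟨l, hl, h⟩
    rcases l with _ | C' | q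
    · simp [axOf] at h
    · by_cases h' : blank c K C' = true ∧ lit C' x = some s
      · simp [axOf, h'] at h
        exact h ▸ ⟨hl, h'⟩
      · have : (blank c K C' && decide (lit C' x = some s)) = false := by simpa using h'
        simp [axOf, this] at h
    · simp [axOf] at h
  · rintro ⟨h, h1, h2⟩
    exact ⟨_, h, by simp [axOf, h1, h2]⟩

theorem has_iff {C : Cl} {z : ℕ} {a : Bool} :
    has K C z a = true ↔ z ∉ K ∧ lit C z = some a := by simp [has]

end strip

/-! ### Evaluation of a derivation on shortened axioms. -/

section eval
variable {n : ℕ} {π : Equiv.Perm (Fin n)} {c : Ctx} {K : List ℕ}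

/-- The evaluation of the line number `v`. -/
def ent (c : Ctx) (K : List ℕ) (L : List Ln) (v : ℕ) : Entry := (evalAll c K L).getD v (none, [])

theorem evalAll_take (L : List Ln) (v : ℕ) : evalAll c K (L.take v) = (evalAll c K L).take v := by
  induction L using List.reverseRecOn with
  | nil => simp [evalAll]
  | append_singleton L l ih =>
    rw [evalAll_append_singleton]
    rcases lt_or_ge L.length v with h | h
    · rw [List.take_of_length_le (by simp; omega), evalAll_append_singleton,
        List.take_of_length_le (by simp [length_evalAll]; omega)]
    · rw [List.take_append_of_le_length h, List.take_append_of_le_length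
        (by simpa [length_evalAll] using h), ih]

theorem ent_eq {L : List Ln} {v : ℕ} {l : Ln} (hl : L[v]? = some l) :
    ent c K L v = evalLn c K ((evalAll c K L).take v) l := by
  obtain ⟨hv, rfl⟩ := List.getElem?_eq_some_iff.1 hl
  have h1 : L.take (v + 1) = L.take v ++ [L[v]] := List.take_succ_eq_append_getElem hv
  have h2 : (evalAll c K L).take (v + 1) = (evalAll c K L).take v ++
      [evalLn c K ((evalAll c K L).take v) L[v]] := by
    rw [← evalAll_take, h1, evalAll_append_singleton, evalAll_take]
  have h3 : ((evalAll c K L).take (v + 1))[v]? = (evalAll c K L)[v]? :=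
    List.getElem?_take_of_lt (by omega)
  rw [h2, List.getElem?_append_right (by simp [length_evalAll])] at h3
  simp only [List.length_take, length_evalAll, min_eq_left hv.le, Nat.sub_self] at h3
  rw [ent, List.getD, ← h3]
  rfl

theorem ent_none {L : List Ln} {v : ℕ} (hl : L[v]? = some none) : ent c K L v = (none, []) := by
  rw [ent_eq hl]; rfl

theorem ent_inl {L : List Ln} {v : ℕ} {C : Cl} (hl : L[v]? = some (some (.inl C))) :
    ent c K L v = (some (.inl C), C) := by rw [ent_eq hl]; rfl

theorem ent_inr {L : List Ln} {v : ℕ} {q : Just} (hl : L[v]? = some (some (.inr q)))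
    (h1 : q.1 < v) (h2 : q.2.1 < v) :
    ent c K L v = evalJust c K (ent c K L q.1) (ent c K L q.2.1) q := by
  have key : ∀ j < v, ((evalAll c K L).take v).getD j (none, []) = ent c K L j := fun j hj => by
    rw [ent, List.getD, List.getElem?_take_of_lt hj]
    rfl
  rw [ent_eq hl, ← key _ h1, ← key _ h2]
  rfl

theorem ent_of_le {L : List Ln} {v : ℕ} (h : L.length ≤ v) : ent c K L v = (none, []) := by
  rw [ent, List.getD_eq_default _ _ (by simpa [length_evalAll] using h)]

/-- The clause `R` is the resolvent of `P` and `Q` on `z`. -/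
structure Resolves (K : List ℕ) (P Q : Cl) (z : ℕ) (a : Bool) (R : Cl) : Prop where
  litP : lit P z = some a
  litQ : lit Q z = some (!a)
  notMem : z ∉ K
  compat : ∀ v ∉ K, v ≠ z → ∀ b b', lit P v = some b → lit Q v = some b' → b = b'
  lit_eq : ∀ v, lit R v = if v = z then none else if lit P v = none then lit Q v else lit P v

/-- The line number `v` is used. -/
def Used (L : List Ln) (v : ℕ) : Prop := ∃ s, L[v]? = some (some s)

/-- `L` is the skeleton of a connected derivation with the clauses `val` of a contradiction modulo the
variables in `K`. -/
structure Skel (K : List ℕ) (L : List Ln) (val : ℕ → Cl) : Prop where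
  ax : ∀ (v : ℕ) (C : Cl), L[v]? = some (some (.inl C)) → val v = C
  lt : ∀ (v : ℕ) (q : Just), L[v]? = some (some (.inr q)) → q.1 < v ∧ q.2.1 < v
  used : ∀ (v : ℕ) (q : Just), L[v]? = some (some (.inr q)) → Used L q.1 ∧ Used L q.2.1
  inf : ∀ (v : ℕ) (q : Just), L[v]? = some (some (.inr q)) → (q.1 = q.2.1 ∧ val v = val q.1) ∨
    Resolves K (val q.1) (val q.2.1) q.2.2.1 q.2.2.2 (val v)
  last : Used L (L.length - 1)
  blank : ∀ i ∉ K, lit (val (L.length - 1)) i = none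
  conn : ∀ S : ℕ → Prop, S (L.length - 1) →
    (∀ (v : ℕ) (q : Just), S v → L[v]? = some (some (.inr q)) → S q.1 ∧ S q.2.1) → ∀ v : ℕ, Used L v → S v

theorem Used.lt {L : List Ln} {v : ℕ} (h : Used L v) : v < L.length := by
  obtain ⟨s, h⟩ := h
  exact (List.getElem?_eq_some_iff.1 h).1

/-- `L'` is obtained from `L` by removing the variables in `W` from the axioms and, if `N`
holds, dropping the axioms that contain `x ^ s`; no other axiom with `x` is contradictory. -/
structure Reduct (n : ℕ) (K : List ℕ) (x : ℕ) (N : Prop) (s : Bool) (W : ℕ → Prop)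
    (L L' : List Ln) : Prop where
  length : L'.length = L.length
  unused : ∀ v : ℕ, L[v]? = some none → L'[v]? = some none
  inf : ∀ (v : ℕ) (q : Just), L[v]? = some (some (.inr q)) → L'[v]? = some (some (.inr q))
  ax : ∀ (v : ℕ) (C : Cl), L[v]? = some (some (.inl C)) → (L'[v]? = some none ∧ N ∧ lit C x = some s) ∨
    ∃ C' : Cl, L'[v]? = some (some (.inl C')) ∧ (N → lit C x ≠ some s) ∧
      (N → (∀ i ∉ K, lit C' i = none) → lit C x ≠ some (!s)) ∧ C'.length = n ∧
      ∀ i ∉ K, (W i → lit C' i = none) ∧ (¬ W i → lit C' i = lit C i)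

variable {pre : List ℕ} {x : ℕ} {N : Prop} {s : Bool} {W : ℕ → Prop} {L L' : List Ln}
  {val : ℕ → Cl}

/-- The rules of evaluation, with all side conditions explicit: copy a nonblank premise that has
lost its pivot literal; resolve if both premises still have it; copy if both premises are blank;
otherwise give no clause. The last case includes a blank premise next to one with its pivot literal.
The proof is a truth table over the six tests. -/
theorem evalJust_cases (P Q : Entry) (q : Just) :
    (P.1.isSome = true ∧ blank c K P.2 = false ∧ has K P.2 q.2.2.1 q.2.2.2 = false ∧
      evalJust c K P Q q = (some (.inr (q.1, q.1, q.2.2)), P.2)) ∨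
    (Q.1.isSome = true ∧ blank c K Q.2 = false ∧ has K Q.2 q.2.2.1 (!q.2.2.2) = false ∧
      evalJust c K P Q q = (some (.inr (q.2.1, q.2.1, q.2.2)), Q.2)) ∨
    (P.1.isSome = true ∧ Q.1.isSome = true ∧ has K P.2 q.2.2.1 q.2.2.2 = true ∧
      has K Q.2 q.2.2.1 (!q.2.2.2) = true ∧
      evalJust c K P Q q = (some (.inr q), res c P.2 Q.2 q.2.2.1)) ∨
    (P.1.isSome = true ∧ Q.1.isSome = true ∧ blank c K P.2 = true ∧ blank c K Q.2 = true ∧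
      evalJust c K P Q q = (some (.inr (q.1, q.1, q.2.2)), P.2)) ∨
    ((P.1.isSome = true → blank c K P.2 = true ∨ has K P.2 q.2.2.1 q.2.2.2 = true) ∧
      (Q.1.isSome = true → blank c K Q.2 = true ∨ has K Q.2 q.2.2.1 (!q.2.2.2) = true) ∧
      ¬ (P.1.isSome = true ∧ Q.1.isSome = true ∧ has K P.2 q.2.2.1 q.2.2.2 = true ∧
        has K Q.2 q.2.2.1 (!q.2.2.2) = true) ∧
      ¬ (P.1.isSome = true ∧ Q.1.isSome = true ∧ blank c K P.2 = true ∧ blank c K Q.2 = true) ∧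
      evalJust c K P Q q = (.none, [])) := by
  unfold evalJust
  generalize P.1.isSome = p₁
  generalize Q.1.isSome = q₁
  generalize blank c K P.2 = p₂
  generalize blank c K Q.2 = q₂
  generalize has K P.2 q.2.2.1 q.2.2.2 = p₃
  generalize has K Q.2 q.2.2.1 (!q.2.2.2) = q₃
  cases p₁ <;> cases q₁ <;> cases p₂ <;> cases q₂ <;> cases p₃ <;> cases q₃ <;> simp

/-- The evaluated clauses have no literals but those of the clauses of the skeleton. -/
theorem ent_spec (hc : CtxOK π c) (hpre : pre ⊆ K) (hS : Skel pre L val)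
    (hR : Reduct n K x N s W L L') (v : ℕ) :
    ((ent c K L' v).1 ≠ Option.none → (ent c K L' v).2.length = n) ∧
    ∀ i ∉ K, lit (ent c K L' v).2 i ≠ Option.none →
      lit (ent c K L' v).2 i = lit (val v) i ∧ ¬ W i := by
  induction v using Nat.strong_induction_on with
  | _ v ih =>
  have hdef : ((.none, []) : Entry).2 = [] := rfl
  have hnil : ∀ i, lit [] i = Option.none := fun i => by simp [lit]
  rcases lt_or_ge v L.length with hv | hv
  · have hl : L[v]? = some L[v] := List.getElem?_eq_getElem hv
    rcases hlv : L[v] with _ | C | q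
    · rw [hlv] at hl
      rw [ent_none (hR.unused v hl)]
      simp [hnil]
    · rw [hlv] at hl
      rcases hR.ax v C hl with ⟨h, -, -⟩ | ⟨C', h, -, -, hlen, h'⟩
      · rw [ent_none h]
        simp [hnil]
      · rw [ent_inl h, hS.ax v C hl]
        refine ⟨fun _ => hlen, fun i hi hn => ?_⟩
        by_cases hW : W i
        · exact absurd ((h' i hi).1 hW) hn
        · exact ⟨(h' i hi).2 hW, hW⟩
    · rw [hlv] at hl
      obtain ⟨h1, h2⟩ := hS.lt v q hl
      have hP := ih q.1 h1
      have hQ := ih q.2.1 h2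
      rw [ent_inr (hR.inf v q hl) h1 h2]
      set P := ent c K L' q.1
      set Q := ent c K L' q.2.1
      rcases evalJust_cases (c := c) (K := K) P Q q with ⟨g1, g2, g3, e⟩ | ⟨g1, g2, g3, e⟩ |
        ⟨g1, g2, g3, g4, e⟩ | ⟨g1, g2, g3, g4, e⟩ | ⟨-, -, -, -, e⟩
      · rw [e]
        refine ⟨fun _ => hP.1 (by simpa [Option.isSome_iff_ne_none] using g1), fun i hi hn => ?_⟩
        obtain ⟨k1, k2⟩ := hP.2 i hi hn
        refine ⟨k1.trans ?_, k2⟩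
        rcases hS.inf v q hl with ⟨-, h⟩ | h
        · rw [h]
        · have hn' : lit (val q.1) i ≠ Option.none := k1 ▸ hn
          rw [h.lit_eq, if_neg, if_neg hn']
          rintro rfl
          rw [← Bool.not_eq_true, has_iff] at g3
          exact g3 ⟨hi, k1.trans h.litP⟩
      · rw [e]
        refine ⟨fun _ => hQ.1 (by simpa [Option.isSome_iff_ne_none] using g1), fun i hi hn => ?_⟩
        obtain ⟨k1, k2⟩ := hQ.2 i hi hn
        refine ⟨k1.trans ?_, k2⟩
        rcases hS.inf v q hl with ⟨h', h⟩ | h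
        · rw [h, h']
        · have hn' : lit (val q.2.1) i ≠ Option.none := k1 ▸ hn
          have hz : i ≠ q.2.2.1 := by
            rintro rfl
            rw [← Bool.not_eq_true, has_iff] at g3
            exact g3 ⟨hi, k1.trans h.litQ⟩
          rw [h.lit_eq, if_neg hz]
          split_ifs with h3
          · rfl
          -- The literal also occurs in the other premise of the original inference, whose sign
          -- takes precedence in the resolvent; as the signs agree, nothing changes.
          · obtain ⟨b, hb⟩ := Option.ne_none_iff_exists'.1 h3
            obtain ⟨b', hb'⟩ := Option.ne_none_iff_exists'.1 hn'
            rw [hb, hb', h.compat i (fun h => hi (hpre h)) hz b b' hb hb']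
      · rw [e]
        refine ⟨fun _ => length_res hc _ _ _, fun i hi hn => ?_⟩
        have lP := hP.1 (by simpa [Option.isSome_iff_ne_none] using g1)
        have lQ := hQ.1 (by simpa [Option.isSome_iff_ne_none] using g2)
        rw [has_iff] at g3 g4
        rw [lit_res hc lP lQ] at hn ⊢
        rcases hS.inf v q hl with ⟨h', h⟩ | h
        -- A copy line has the same entry as both premises, which cannot contain the pivot with both
        -- signs.
        · exfalso
          have e1 := g3.2
          have e2 := g4.2
          have : P = Q := by simp only [P, Q, h']
          rw [this, e2] at e1
          simp at e1
        · by_cases hz : i = q.2.2.1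
          · simp [hz] at hn
          · rw [if_neg hz] at hn ⊢
            rw [h.lit_eq, if_neg hz]
            by_cases h3 : lit P.2 i = Option.none
            · rw [if_pos h3] at hn ⊢
              obtain ⟨k1, k2⟩ := hQ.2 i hi hn
              refine ⟨?_, k2⟩
              split_ifs with h4
              · exact k1
              · obtain ⟨b, hb⟩ := Option.ne_none_iff_exists'.1 h4
                obtain ⟨b', hb'⟩ := Option.ne_none_iff_exists'.1 (k1 ▸ hn)
                rw [k1, hb, hb', h.compat i (fun h => hi (hpre h)) hz b b' hb hb']
            · rw [if_neg h3]
              obtain ⟨k1, k2⟩ := hP.2 i hi h3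
              refine ⟨?_, k2⟩
              rw [if_neg (k1 ▸ h3), k1]
      · rw [e]
        refine ⟨fun _ => hP.1 (by simpa [Option.isSome_iff_ne_none] using g1), fun i hi hn => ?_⟩
        have lP := hP.1 (by simpa [Option.isSome_iff_ne_none] using g1)
        exact absurd ((blank_iff hc lP).1 g3 i hi) hn
      · rw [e]
        simp [hnil]
  · rw [ent_of_le (by rw [hR.length]; exact hv)]
    simp [hnil]

/-- If there is no contradiction up to `v`, then a line is not evaluated only if it depends on a
dropped axiom, and it is evaluated to a contradiction only if all its variables are removed. -/
theorem ent_noconf (hc : CtxOK π c) (hpre : pre ⊆ K) (hx : x ∈ K) (hxp : x ∉ pre)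
    (hS : Skel pre L val) (hR : Reduct n K x N s W L L')
    (hno : ∀ v, isConf c K (ent c K L' v) = false) (v : ℕ) (hv : Used L v) :
    ((ent c K L' v).1 = Option.none → N ∧ lit (val v) x = some s) ∧
    ((ent c K L' v).1 ≠ Option.none → blank c K (ent c K L' v).2 = true →
      (∀ i ∉ K, lit (val v) i ≠ Option.none → W i) ∧ (N → lit (val v) x ≠ some (!s))) := by
  induction v using Nat.strong_induction_on with
  | _ v ih =>
  obtain ⟨l, hl⟩ := hv
  rcases l with C | q
  · rw [hS.ax v C hl]
    rcases hR.ax v C hl with ⟨h, hN, hs⟩ | ⟨C', h, -, hg, hlen, h'⟩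
    · rw [ent_none h]
      exact ⟨fun _ => ⟨hN, hs⟩, fun h => absurd rfl h⟩
    · rw [ent_inl h]
      refine ⟨fun h => by simp at h, fun _ hb => ?_⟩
      rw [blank_iff hc hlen] at hb
      refine ⟨fun i hi hn => ?_, fun hN => hg hN hb⟩
      by_contra hW
      exact hn (((h' i hi).2 hW).symm.trans (hb i hi))
  · obtain ⟨h1, h2⟩ := hS.lt v q hl
    obtain ⟨u1, u2⟩ := hS.used v q hl
    obtain ⟨pP, pP'⟩ := ih q.1 h1 u1
    obtain ⟨pQ, pQ'⟩ := ih q.2.1 h2 u2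
    obtain ⟨lP, sP⟩ := ent_spec hc hpre hS hR q.1
    obtain ⟨lQ, sQ⟩ := ent_spec hc hpre hS hR q.2.1
    have hnv := hno v
    rw [ent_inr (hR.inf v q hl) h1 h2] at hnv ⊢
    have hPQ : q.1 = q.2.1 → ent c K L' q.1 = ent c K L' q.2.1 := fun h => by rw [h]
    set P := ent c K L' q.1
    set Q := ent c K L' q.2.1
    simp only [Option.isSome_iff_ne_none.symm] at *
    rcases evalJust_cases (c := c) (K := K) P Q q with ⟨g1, g2, g3, e⟩ | ⟨g1, g2, g3, e⟩ |
      ⟨g1, g2, g3, g4, e⟩ | ⟨g1, g2, g3, g4, e⟩ | ⟨k1, k2, k3, k4, e⟩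
    · rw [e]
      simp [g2]
    · rw [e]
      simp [g2]
    · rw [e]
      refine ⟨fun h => by simp at h, fun _ hb => ?_⟩
      -- A blank resolvent of two different lines would count as a conflict, which is excluded. So
      -- blank lines only arise from blank axioms by copying.
      have hne : q.1 ≠ q.2.1 := by
        intro h
        rw [has_iff] at g3 g4
        have e1 := g3.2
        rw [hPQ h, g4.2] at e1
        simp at e1
      rw [e] at hnv
      simp [isConf, justOf, hne, hb] at hnv
    · rw [e]
      refine ⟨fun h => by simp at h, fun _ _ => ?_⟩
      obtain ⟨a1, a2⟩ := pP' g1 g3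
      obtain ⟨b1, b2⟩ := pQ' g2 g4
      rcases hS.inf v q hl with ⟨-, h⟩ | h
      · rw [h]
        exact ⟨a1, a2⟩
      · refine ⟨fun i hi hn => ?_, fun hN => ?_⟩
        · rw [h.lit_eq] at hn
          split_ifs at hn with h3 h4
          · simp at hn
          · exact b1 i hi hn
          · exact a1 i hi hn
        · rw [h.lit_eq]
          split_ifs
          · simp
          · exact b2 hN
          · exact a2 hN
    · rw [e]
      refine ⟨fun _ => ?_, fun h => by simp at h⟩
      have pP₁ : P.1.isSome = false → N ∧ lit (val q.1) x = some s := fun h => pP (by simpa using h)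
      have pQ₁ : Q.1.isSome = false → N ∧ lit (val q.2.1) x = some s :=
        fun h => pQ (by simpa using h)
      rcases hS.inf v q hl with ⟨h', h⟩ | h
      · rw [h]
        cases hP1 : P.1.isSome
        · exact pP₁ hP1
        · exfalso
          have hQ1 : Q.1.isSome = true := by rw [← hPQ h']; exact hP1
          have e1 := k1 hP1
          have e2 := k2 hQ1
          rw [← hPQ h'] at e2 k4
          rcases e1 with e1 | e1
          · exact k4 ⟨hP1, hP1, e1, e1⟩
          · rcases e2 with e2 | e2
            · exact k4 ⟨hP1, hP1, e2, e2⟩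
            · rw [has_iff] at e1 e2
              rw [e1.2] at e2
              simp at e2
      -- If the pivot is `x`, neither premise can show it, as `x` lies in `K`. One premise has `x ^
      -- s` and the other one `x ^ (!s)`. A missing premise must be the one with `x ^ s`; the other
      -- one then exists and is blank, which the induction hypothesis forbids for a clause with `x ^
      -- (!s)`. Two blank premises would have been copied.
      · by_cases hz : q.2.2.1 = x
        · have hhas : ∀ C a, has K C q.2.2.1 a = false := fun C a => by simp [has, hz, hx]
          rw [hhas] at k1 k2 k3
          have litP := h.litP
          have litQ := h.litQ
          rw [hz] at litP litQ
          cases hP1 : P.1.isSome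
          · obtain ⟨hN, hs⟩ := pP₁ hP1
            exfalso
            rw [litP] at hs
            cases hQ1 : Q.1.isSome
            · have := (pQ₁ hQ1).2
              rw [litQ, ← hs] at this
              simp at this
            · refine (pQ' hQ1 ?_).2 hN ?_
              · simpa using k2 hQ1
              · rw [litQ, Option.some.inj hs]
          · have hbP : blank c K P.2 = true := by simpa using k1 hP1
            cases hQ1 : Q.1.isSome
            · obtain ⟨hN, hs⟩ := pQ₁ hQ1
              exfalso
              rw [litQ] at hs
              refine (pP' hP1 hbP).2 hN ?_
              rw [litP, ← Option.some.inj hs]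
              simp
            · exact absurd ⟨hP1, hQ1, hbP, by simpa using k2 hQ1⟩ k4
        · have hz' : x ≠ q.2.2.1 := fun h => hz h.symm
          cases hP1 : P.1.isSome
          · obtain ⟨hN, hs⟩ := pP₁ hP1
            refine ⟨hN, ?_⟩
            rw [h.lit_eq, if_neg hz', if_neg (by simp [hs]), hs]
          · cases hQ1 : Q.1.isSome
            · obtain ⟨hN, hs⟩ := pQ₁ hQ1
              refine ⟨hN, ?_⟩
              rw [h.lit_eq, if_neg hz']
              split_ifs with h3
              · exact hs
              · obtain ⟨b, hb⟩ := Option.ne_none_iff_exists'.1 h3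
                rw [hb, h.compat x hxp hz' b s hb hs]
            · exfalso
              rcases k1 hP1 with e1 | e1
              · rcases k2 hQ1 with e2 | e2
                · exact k4 ⟨hP1, hQ1, e1, e2⟩
                -- The pivot is still present in `Q`, so it is not in `W`. But `P` is blank, so all
                -- variables of the original premise outside `K`, the pivot among them, are in `W`.
                · rw [has_iff] at e2
                  have := sQ q.2.2.1 e2.1 (by rw [e2.2]; rfl)
                  refine this.2 ((pP' hP1 e1).1 _ e2.1 ?_)
                  rw [h.litP]; rfl
              · rcases k2 hQ1 with e2 | e2
                · rw [has_iff] at e1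
                  have := sP q.2.2.1 e1.1 (by rw [e1.2]; rfl)
                  refine this.2 ((pQ' hQ1 e2).1 _ e1.1 ?_)
                  rw [h.litQ]; rfl
                · exact k3 ⟨hP1, hQ1, e1, e2⟩

/-- If there is no contradiction, then all variables in the skeleton are removed. -/
theorem Skel.of_noconf (hc : CtxOK π c) (hpre : pre ⊆ K) (hx : x ∈ K) (hxp : x ∉ pre)
    (hS : Skel pre L val) (hR : Reduct n K x N s W L L')
    (hno : ∀ v, isConf c K (ent c K L' v) = false) (v : ℕ) (C : Cl)
    (hv : L[v]? = some (some (.inl C))) :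
    (∀ i ∉ K, lit C i ≠ Option.none → W i) ∧ (N → lit C x = Option.none) := by
  have key := ent_noconf hc hpre hx hxp hS hR hno
  -- A line without a value contains `x ^ s`. The last clause has no variable outside `pre`, so it
  -- does have a value, and by the previous result on literals this value is blank.
  have hlast : (ent c K L' (L.length - 1)).1 ≠ Option.none := by
    intro h
    have := ((key _ hS.last).1 h).2
    rw [hS.blank x hxp] at this
    simp at this
  obtain ⟨l1, l2⟩ := ent_spec hc hpre hS hR (L.length - 1)
  have hbl : CDCL.blank c K (ent c K L' (L.length - 1)).2 = true := by
    rw [blank_iff hc (l1 hlast)]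
    intro i hi
    by_contra hn
    rw [(l2 i hi hn).1, hS.blank i fun h => hi (hpre h)] at hn
    exact hn rfl
  -- Being blank spreads backwards: without conflicts a blank inferred line has two blank premises.
  -- By connectedness all used lines are blank, in particular all axioms.
  have hall := hS.conn
    (fun v => (ent c K L' v).1 ≠ Option.none ∧ CDCL.blank c K (ent c K L' v).2 = true) ⟨hlast, hbl⟩ (by
      rintro v q ⟨h1, h2⟩ hl
      obtain ⟨j1, j2⟩ := hS.lt v q hl
      have hnv := hno v
      rw [ent_inr (hR.inf v q hl) j1 j2] at h1 h2 hnv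
      simp only [← Option.isSome_iff_ne_none] at *
      have hPQ : q.1 = q.2.1 → ent c K L' q.1 = ent c K L' q.2.1 := fun h => by rw [h]
      rcases evalJust_cases (c := c) (K := K) (ent c K L' q.1) (ent c K L' q.2.1) q with
        ⟨g1, g2, g3, e⟩ | ⟨g1, g2, g3, e⟩ |
        ⟨g1, g2, g3, g4, e⟩ | ⟨g1, g2, g3, g4, e⟩ | ⟨k1, k2, k3, k4, e⟩
      · rw [e] at h2
        simp [g2] at h2
      · rw [e] at h2
        simp [g2] at h2
      · have hne : q.1 ≠ q.2.1 := by
          intro h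
          rw [has_iff] at g3 g4
          have e1 := g3.2
          rw [hPQ h, g4.2] at e1
          simp at e1
        rw [e] at hnv h2
        simp [isConf, justOf, hne, h2] at hnv
      · exact ⟨⟨g1, g3⟩, ⟨g2, g4⟩⟩
      · rw [e] at h1
        simp at h1) v ⟨_, hv⟩
  have k := (key v ⟨_, hv⟩).2 hall.1 hall.2
  rw [hS.ax v C hv] at k
  refine ⟨k.1, fun hN => ?_⟩
  have hns : lit C x ≠ some s := by
    rcases hR.ax v C hv with ⟨h, -, -⟩ | ⟨C', h, h', -⟩
    · rw [ent_none h] at hall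
      exact absurd rfl hall.1
    · exact h' hN
  cases h : lit C x with
  | none => rfl
  | some b =>
    have h1 := k.2 hN
    rw [h] at hns h1
    cases b <;> cases s <;> simp_all

end eval

/-! ### The first contradiction, its pruned derivation, and replaying a derivation. -/

section conflict
variable {n : ℕ} {π : Equiv.Perm (Fin n)} {τ : CNF n} {c : Ctx} {K pre : List ℕ} {x : ℕ} {N : Prop}
  {s : Bool} {W : ℕ → Prop} {L L' : List Ln} {val : ℕ → Cl} {G : List Raw} {O : ℕ → Prop}

theorem ent_lt {v : ℕ} (h : (ent c K L v).1 ≠ none) : v < L.length := by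
  by_contra h'
  rw [ent_of_le (by omega)] at h
  exact h rfl

/-- The justifications of the evaluated lines. -/
theorem ent_just (hc : CtxOK π c) (hpre : pre ⊆ K) (hS : Skel pre L val)
    (hR : Reduct n K x N s W L L') {v : ℕ} {q : Just} (h : (ent c K L' v).1 = some (.inr q)) :
    q.1 < v ∧ q.2.1 < v ∧ (ent c K L' q.1).1 ≠ none ∧ (ent c K L' q.2.1).1 ≠ none ∧
      ((q.1 = q.2.1 ∧ (ent c K L' v).2 = (ent c K L' q.1).2) ∨
        (q.1 ≠ q.2.1 ∧ (ent c K L' v).2 = res c (ent c K L' q.1).2 (ent c K L' q.2.1).2 q.2.2.1 ∧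
        Resolves K (ent c K L' q.1).2 (ent c K L' q.2.1).2 q.2.2.1 q.2.2.2 (ent c K L' v).2)) := by
  have hv : v < L.length := hR.length ▸ ent_lt (c := c) (K := K) (by rw [h]; simp)
  have hl : L[v]? = some L[v] := List.getElem?_eq_getElem hv
  rcases hlv : L[v] with _ | C | r
  · rw [hlv] at hl
    rw [ent_none (hR.unused v hl)] at h
    simp at h
  · rw [hlv] at hl
    rcases hR.ax v C hl with ⟨h', -⟩ | ⟨C', h', -⟩
    · rw [ent_none h'] at h
      simp at h
    · rw [ent_inl h'] at h
      simp at h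
  · rw [hlv] at hl
    obtain ⟨h1, h2⟩ := hS.lt v r hl
    obtain ⟨lP, sP⟩ := ent_spec hc hpre hS hR r.1
    obtain ⟨lQ, sQ⟩ := ent_spec hc hpre hS hR r.2.1
    have he := ent_inr (c := c) (K := K) (hR.inf v r hl) h1 h2
    have hPQ : r.1 = r.2.1 → ent c K L' r.1 = ent c K L' r.2.1 := fun h => by rw [h]
    rcases evalJust_cases (c := c) (K := K) (ent c K L' r.1) (ent c K L' r.2.1) r with
      ⟨g1, g2, g3, e⟩ | ⟨g1, g2, g3, e⟩ | ⟨g1, g2, g3, g4, e⟩ | ⟨g1, g2, g3, g4, e⟩ |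
      ⟨k1, k2, k3, k4, e⟩
    · rw [he, e] at h ⊢
      obtain rfl := Sum.inr.inj (Option.some.inj h)
      rw [Option.isSome_iff_ne_none] at g1
      exact ⟨h1, h1, g1, g1, Or.inl ⟨rfl, rfl⟩⟩
    · rw [he, e] at h ⊢
      obtain rfl := Sum.inr.inj (Option.some.inj h)
      rw [Option.isSome_iff_ne_none] at g1
      exact ⟨h2, h2, g1, g1, Or.inl ⟨rfl, rfl⟩⟩
    · rw [he, e] at h ⊢
      obtain rfl := Sum.inr.inj (Option.some.inj h)
      rw [Option.isSome_iff_ne_none] at g1 g2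
      rw [has_iff] at g3 g4
      have hne : r.1 ≠ r.2.1 := by
        intro h
        have e1 := g3.2
        rw [hPQ h, g4.2] at e1
        simp at e1
      refine ⟨h1, h2, g1, g2, Or.inr ⟨hne, rfl, g3.2, g4.2, g3.1, ?_, ?_⟩⟩
      · intro i hi hz b b' hb hb'
        rcases hS.inf v r hl with ⟨h', -⟩ | h'
        · exact absurd h' hne
        · have e1 := (sP i hi (by simp [hb])).1
          have e2 := (sQ i hi (by simp [hb'])).1
          exact h'.compat i (fun h => hi (hpre h)) hz b b' (e1 ▸ hb) (e2 ▸ hb')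
      · intro i
        exact lit_res hc (lP g1) (lQ g2) _ _
    · rw [he, e] at h ⊢
      obtain rfl := Sum.inr.inj (Option.some.inj h)
      rw [Option.isSome_iff_ne_none] at g1
      exact ⟨h1, h1, g1, g1, Or.inl ⟨rfl, rfl⟩⟩
    · rw [he, e] at h
      simp at h

theorem ent_ax {v : ℕ} {C : Cl} (hlt : ∀ (v : ℕ) (q : Just), L[v]? = some (some (.inr q)) →
    q.1 < v ∧ q.2.1 < v) (h : (ent c K L v).1 = some (.inl C)) :
    L[v]? = some (some (.inl C)) ∧ (ent c K L v).2 = C := by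
  have hv : v < L.length := ent_lt (c := c) (K := K) (by rw [h]; simp)
  have hl : L[v]? = some L[v] := List.getElem?_eq_getElem hv
  rcases hlv : L[v] with _ | C' | r
  · rw [hlv] at hl
    rw [ent_none hl] at h
    simp at h
  · rw [hlv] at hl
    rw [ent_inl hl] at h ⊢
    obtain rfl := Sum.inl.inj (Option.some.inj h)
    exact ⟨hl, rfl⟩
  · rw [hlv] at hl
    obtain ⟨h1, h2⟩ := hlt v r hl
    rw [ent_inr hl h1 h2] at h
    rcases evalJust_cases (c := c) (K := K) (ent c K L r.1) (ent c K L r.2.1) r with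
      ⟨g1, g2, g3, e⟩ | ⟨g1, g2, g3, e⟩ | ⟨g1, g2, g3, g4, e⟩ | ⟨g1, g2, g3, g4, e⟩ |
      ⟨k1, k2, k3, k4, e⟩ <;>
    · rw [e] at h
      simp at h

theorem Reduct.lt (hS : Skel pre L val) (hR : Reduct n K x N s W L L') (v : ℕ) (q : Just)
    (h : L'[v]? = some (some (.inr q))) : q.1 < v ∧ q.2.1 < v := by
  have hv : v < L.length := hR.length ▸ (List.getElem?_eq_some_iff.1 h).1
  have hl : L[v]? = some L[v] := List.getElem?_eq_getElem hv
  rcases hlv : L[v] with _ | C' | r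
  · rw [hlv] at hl
    rw [hR.unused v hl] at h
    simp at h
  · rw [hlv] at hl
    rcases hR.ax v C' hl with ⟨h', -⟩ | ⟨C', h', -⟩ <;>
    · rw [h'] at h
      simp at h
  · rw [hlv] at hl
    rw [hR.inf v r hl] at h
    obtain rfl := Sum.inr.inj (Option.some.inj (Option.some.inj h))
    exact hS.lt v _ hl

theorem before_eq_take (E : List Entry) : before c K E = E.take (before c K E).length :=
  List.prefix_iff_eq_take.1 (List.takeWhile_prefix _)

theorem isConf_of_hasConf {E : List Entry} {e : Entry} (he : e ∈ E) (h : isConf c K e = true) :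
    isConf c K (conf c K E) = true := by
  have h1 : before c K E ++ E.dropWhile (fun e => !isConf c K e) = E :=
    List.takeWhile_append_dropWhile
  cases hd : E.dropWhile (fun e => !isConf c K e) with
  | nil =>
    rw [hd, List.append_nil] at h1
    rw [← h1] at he
    have := List.mem_takeWhile_imp he
    simp [h] at this
  | cons a l =>
    have h0 : (before c K E ++ a :: l)[(before c K E).length]? = some a := by simp
    have h1' := h1
    rw [hd] at h1'
    rw [h1'] at h0
    have h2 : conf c K E = a := by
      rw [conf, List.getD_eq_getElem?_getD, h0]
      rfl
    have h3 := List.head_dropWhile_not (fun e => !isConf c K e) (l := E) (by rw [hd]; simp)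
    simp only [hd, List.head_cons] at h3
    rw [h2]
    simpa using h3

theorem no_conf {L : List Ln} (h : isConf c K (conf c K (evalAll c K L)) ≠ true) (v : ℕ) :
    isConf c K (ent c K L v) = false := by
  by_contra hv
  rw [Bool.not_eq_false] at hv
  rcases lt_or_ge v L.length with h' | h'
  · refine h (isConf_of_hasConf (e := ent c K L v) ?_ hv)
    have : v < (evalAll c K L).length := by rwa [length_evalAll]
    rw [ent, List.getD_eq_getElem _ _ this]
    exact List.getElem_mem _
  · rw [ent_of_le h'] at hv
    simp [isConf, justOf] at hv

/-- The two clauses that are resolved to a contradiction. -/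
theorem conf_spec (hc : CtxOK π c) (hpre : pre ⊆ K) (hS : Skel pre L val)
    (hR : Reduct n K x N s W L L') (h : isConf c K (conf c K (evalAll c K L')) = true) :
    ∃ q : Just, (conf c K (evalAll c K L')).1 = some (.inr q) ∧ q.1 ≠ q.2.1 ∧
      (∀ i ∉ K, lit (conf c K (evalAll c K L')).2 i = none) := by
  have he : conf c K (evalAll c K L') = ent c K L' (before c K (evalAll c K L')).length := rfl
  have h' := h
  rw [isConf] at h
  cases hq : justOf (conf c K (evalAll c K L')).1 with
  | none => simp [hq] at h
  | some q =>
    rw [justOf_eq] at hq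
    have h1 := h
    simp [hq, justOf] at h
    refine ⟨q, hq, h.1, ?_⟩
    rw [← blank_iff hc]
    · exact h.2
    · rw [he]
      refine (ent_spec hc hpre hS hR _).1 ?_
      rw [← he, hq]
      simp

theorem pruneStep_pos {N : List ℕ} {R : List Ln} {p : ℕ × Ln} (h : p.1 ∈ N) :
    pruneStep (N, R) p = (prems p.2 ++ N, p.2 :: R) := by simp [pruneStep, h]

theorem pruneStep_neg {N : List ℕ} {R : List Ln} {p : ℕ × Ln} (h : p.1 ∉ N) :
    pruneStep (N, R) p = (N, none :: R) := by simp [pruneStep, h]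

/-- The scan goes from the last line to the first. Premises precede conclusions, so when a line is
reached it has already been decided whether it is needed. The final clause says that the set of
needed lines is the least one that contains `N` and the premises of kept lines; it becomes the
connectedness of the pruned skeleton. -/
theorem foldl_pruneStep (L : List Ln)
    (hL : ∀ (v : ℕ) (l : Ln), L[v]? = some l → ∀ j ∈ prems l, j < v) (N : List ℕ) (R : List Ln) :
    ∃ (N' : List ℕ) (L' : List Ln), (enum L).reverse.foldl pruneStep (N, R) = (N', L' ++ R) ∧
      L'.length = L.length ∧ N ⊆ N' ∧ (∀ u ∈ N', u ∈ N ∨ u < L.length) ∧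
      (∀ v < L.length, v ∈ N' → L'[v]? = L[v]?) ∧
      (∀ (v : ℕ) (s : Cl ⊕ Just), L'[v]? = some (some s) →
        L[v]? = some (some s) ∧ v ∈ N' ∧ ∀ j ∈ prems (some s), j ∈ N') ∧
      (∀ S : ℕ → Prop, (∀ u ∈ N, S u) → (∀ (v : ℕ) (s : Cl ⊕ Just), S v →
        L'[v]? = some (some s) → ∀ j ∈ prems (some s), S j) → ∀ u ∈ N', S u) := by
  induction L using List.reverseRecOn generalizing N R with
  | nil => exact ⟨N, [], rfl, rfl, fun _ h => h, fun u h => Or.inl h, by simp, by simp,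
      fun S h _ => h⟩
  | append_singleton L l ih =>
    have hL1 : ∀ (v : ℕ) (l : Ln), L[v]? = some l → ∀ j ∈ prems l, j < v := fun v l' h => by
      refine hL v l' ?_
      rw [List.getElem?_append_left (List.getElem?_eq_some_iff.1 h).1, h]
    have hl := hL L.length l (by simp)
    rw [enum_append_singleton, List.reverse_append]
    simp only [List.reverse_singleton, List.singleton_append, List.foldl_cons]
    have app : ∀ (L' : List Ln) (r : Ln) (v : ℕ), L'.length = L.length → v < L.length →
        (L' ++ [r])[v]? = L'[v]? := fun L' r v h hv => List.getElem?_append_left (by omega)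
    have app' : ∀ (L' : List Ln) (r : Ln), L'.length = L.length →
        (L' ++ [r])[L.length]? = some r := fun L' r h => by
      rw [List.getElem?_append_right (by omega)]; simp [h]
    have bnd : ∀ (L' : List Ln) (r : Ln) (v : ℕ) (s), L'.length = L.length →
        (L' ++ [r])[v]? = some s → v < L.length ∨ v = L.length := fun L' r v s h hs => by
      have := (List.getElem?_eq_some_iff.1 hs).1
      simp only [List.length_append, List.length_singleton] at this
      omega
    by_cases hN : L.length ∈ N
    · rw [pruneStep_pos hN]
      obtain ⟨N', L', e, h1, h2, h3, h4, h5, h6⟩ := ih hL1 (prems l ++ N) (l :: R)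
      refine ⟨N', L' ++ [l], by simpa using e, by simp [h1],
        fun u hu => h2 (List.mem_append_right _ hu), ?_, ?_, ?_, ?_⟩
      · intro u hu
        simp only [List.length_append, List.length_singleton]
        rcases h3 u hu with h | h
        · rcases List.mem_append.1 h with h | h
          · have := hl u h
            exact Or.inr (by omega)
          · exact Or.inl h
        · exact Or.inr (by omega)
      · intro v hv hv'
        simp only [List.length_append, List.length_singleton] at hv
        rcases (by omega : v < L.length ∨ v = L.length) with h | rfl
        · rw [app _ _ _ h1 h, app _ _ _ rfl h, h4 v h hv']
        · rw [app' _ _ h1, app' _ _ rfl]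
      · intro v s hs
        rcases bnd _ _ _ _ h1 hs with h | rfl
        · rw [app _ _ _ h1 h] at hs
          rw [app _ _ _ rfl h]
          exact h5 v s hs
        · rw [app' _ _ h1] at hs
          obtain rfl := Option.some.inj hs
          exact ⟨app' _ _ rfl, h2 (by simp [hN]), fun j hj => h2 (by simp [hj])⟩
      · intro S hS hS'
        refine h6 S (fun u hu => ?_) fun v s hv hs => hS' v s hv ?_
        · rcases List.mem_append.1 hu with h | h
          · rcases l with _ | t
            · simp [prems, justOf] at h
            · exact hS' L.length t (hS _ hN) (app' _ _ h1) u h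
          · exact hS u h
        · rw [app _ _ _ h1 (h1 ▸ (List.getElem?_eq_some_iff.1 hs).1), hs]
    · rw [pruneStep_neg hN]
      obtain ⟨N', L', e, h1, h2, h3, h4, h5, h6⟩ := ih hL1 N (none :: R)
      have hN' : L.length ∉ N' := fun h => (h3 _ h).elim hN (lt_irrefl _)
      refine ⟨N', L' ++ [none], by simpa using e, by simp [h1], h2, ?_, ?_, ?_, ?_⟩
      · intro u hu
        simp only [List.length_append, List.length_singleton]
        exact (h3 u hu).imp_right fun h => by omega
      · intro v hv hv'
        simp only [List.length_append, List.length_singleton] at hv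
        rcases (by omega : v < L.length ∨ v = L.length) with h | rfl
        · rw [app _ _ _ h1 h, app _ _ _ rfl h, h4 v h hv']
        · exact absurd hv' hN'
      · intro v s hs
        rcases bnd _ _ _ _ h1 hs with h | rfl
        · rw [app _ _ _ h1 h] at hs
          rw [app _ _ _ rfl h]
          exact h5 v s hs
        · rw [app' _ _ h1] at hs
          simp at hs
      · intro S hS hS'
        refine h6 S hS fun v s hv hs => hS' v s hv ?_
        rw [app _ _ _ h1 (h1 ▸ (List.getElem?_eq_some_iff.1 hs).1), hs]

theorem prune_spec (T : List Ln) (l : Ln)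
    (hL : ∀ (v : ℕ) (r : Ln), (T ++ [l])[v]? = some r → ∀ j ∈ prems r, j < v) :
    (prune T l).length = T.length + 1 ∧ (prune T l)[T.length]? = some l ∧
      (∀ (v : ℕ) (s : Cl ⊕ Just), (prune T l)[v]? = some (some s) →
        (T ++ [l])[v]? = some (some s) ∧
          ∀ j ∈ prems (some s), (prune T l)[j]? = (T ++ [l])[j]?) ∧
      (∀ S : ℕ → Prop, S T.length → (∀ (v : ℕ) (s : Cl ⊕ Just), S v →
        (prune T l)[v]? = some (some s) → ∀ j ∈ prems (some s), S j) →
          ∀ v, Used (prune T l) v → S v) := by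
  obtain ⟨N', L', e, h1, h2, h3, h4, h5, h6⟩ := foldl_pruneStep (T ++ [l]) hL [T.length] []
  have hp : prune T l = L' := by rw [prune, e]; simp
  simp only [List.length_append, List.length_singleton] at h1 h3 h4
  have hlt : ∀ u ∈ N', u < T.length + 1 := fun u hu => by
    rcases h3 u hu with h | h
    · simp at h; omega
    · exact h
  rw [hp]
  refine ⟨h1, ?_, ?_, ?_⟩
  · rw [h4 T.length (by omega) (h2 (by simp))]
    simp
  · intro v s hs
    obtain ⟨k1, k2, k3⟩ := h5 v s hs
    exact ⟨k1, fun j hj => h4 j (hlt j (k3 j hj)) (k3 j hj)⟩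
  · rintro S hS hS' v ⟨s, hs⟩
    exact h6 S (by simpa using hS) hS' v (h5 v s hs).2.1

theorem getElem?_conf_list (L : List Ln)
    (h : (before c K (evalAll c K L)).length < (evalAll c K L).length) (v : ℕ) :
    ((before c K (evalAll c K L)).map (fun e => e.1) ++ [(conf c K (evalAll c K L)).1])[v]? =
      if v ≤ (before c K (evalAll c K L)).length then some (ent c K L v).1 else none := by
  set E := evalAll c K L
  set m := (before c K E).length with hm
  have hent : ∀ u < E.length, E[u]? = some (ent c K L u) := fun u hu => by
    rw [ent, List.getD_eq_getElem _ _ hu, List.getElem?_eq_getElem hu]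
  rcases lt_trichotomy v m with h1 | h1 | h1
  · rw [List.getElem?_append_left (by simpa using h1), if_pos h1.le, List.getElem?_map,
      before_eq_take, List.getElem?_take_of_lt (by simpa using h1), hent v (by omega)]
    rfl
  · subst h1
    rw [List.getElem?_append_right (by simp [← hm]), if_pos le_rfl]
    simp only [List.length_map, ← hm, Nat.sub_self]
    rfl
  · rw [if_neg (by omega), List.getElem?_eq_none]
    simp only [List.length_append, List.length_map, List.length_singleton]
    omega

/-- The skeleton of the refutation of the conflict. -/
theorem Skel.sub (hc : CtxOK π c) (hpre : pre ⊆ K) (hS : Skel pre L val)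
    (hR : Reduct n K x N s W L L') (h : isConf c K (conf c K (evalAll c K L')) = true) :
    Skel K (prune ((before c K (evalAll c K L')).map fun e => e.1) (conf c K (evalAll c K L')).1)
      (fun v => (ent c K L' v).2) ∧
    (∀ C, (some (.inl C) : Ln) ∈ prune ((before c K (evalAll c K L')).map fun e => e.1)
      (conf c K (evalAll c K L')).1 → (some (.inl C) : Ln) ∈ L') ∧
    (prune ((before c K (evalAll c K L')).map fun e => e.1)
      (conf c K (evalAll c K L')).1).length ≤ L.length ∧
    ∃ q : Just, (prune ((before c K (evalAll c K L')).map fun e => e.1)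
      (conf c K (evalAll c K L')).1)[(before c K (evalAll c K L')).length]? =
        some (some (.inr q)) ∧ q.1 ≠ q.2.1 := by
  obtain ⟨q₀, hq₀, hne, hbl⟩ := conf_spec hc hpre hS hR h
  set E := evalAll c K L' with hE
  set m := (before c K E).length with hm
  have hcm : conf c K E = ent c K L' m := rfl
  have hmE : m < E.length := by
    rw [hE, length_evalAll]
    exact ent_lt (c := c) (K := K) (by rw [← hcm, hq₀]; simp)
  have hget := getElem?_conf_list (c := c) (K := K) L' hmE
  set T := (before c K E).map (fun e => e.1) with hT
  have hTm : T.length = m := by simp [hT, hm]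
  have hjust : ∀ (v : ℕ) (q : Just), (T ++ [(conf c K E).1])[v]? = some (some (.inr q)) →
      (ent c K L' v).1 = some (.inr q) := by
    intro v q hv
    rw [hget v] at hv
    split_ifs at hv
    exact Option.some.inj hv
  obtain ⟨p1, p2, p3, p4⟩ := prune_spec T (conf c K E).1 (by
    intro v r hv j hj
    rcases r with _ | C | q
    · simp [prems, justOf] at hj
    · simp [prems, justOf] at hj
    · obtain ⟨h1, h2, -⟩ := ent_just hc hpre hS hR (hjust v q hv)
      simp only [prems, justOf, Option.elim_some, Sum.elim_inr, List.mem_cons,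
        List.not_mem_nil, or_false] at hj
      rcases hj with rfl | rfl
      · exact h1
      · exact h2)
  have hax : ∀ (v : ℕ) (C : Cl), (prune T (conf c K E).1)[v]? = some (some (.inl C)) →
      L'[v]? = some (some (.inl C)) ∧ (ent c K L' v).2 = C := by
    intro v C hv
    have := (p3 v _ hv).1
    rw [hget v] at this
    split_ifs at this
    exact ent_ax (hR.lt hS) (Option.some.inj this)
  have hlen : (prune T (conf c K E).1).length - 1 = m := by rw [p1, hTm]; rfl
  refine ⟨⟨fun v C hv => (hax v C hv).2, ?_, ?_, ?_, ?_, ?_, ?_⟩, ?_, ?_, q₀, ?_, hne⟩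
  · intro v q hv
    obtain ⟨h1, h2, -⟩ := ent_just hc hpre hS hR (hjust v q (p3 v _ hv).1)
    exact ⟨h1, h2⟩
  · intro v q hv
    have hv' := (p3 v _ hv).1
    obtain ⟨h1, h2, h3, h4, -⟩ := ent_just hc hpre hS hR (hjust v q hv')
    have hvm : v ≤ m := by
      have := (List.getElem?_eq_some_iff.1 hv).1
      omega
    have hu : ∀ j, j ∈ prems (some (.inr q)) → j < v → (ent c K L' j).1 ≠ none →
        Used (prune T (conf c K E).1) j := by
      intro j hj hjv hn
      obtain ⟨t, ht⟩ := Option.ne_none_iff_exists'.1 hn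
      refine ⟨t, ?_⟩
      rw [(p3 v _ hv).2 j hj, hget j, if_pos (show j ≤ m by omega), ht]
    exact ⟨hu _ (by simp [prems, justOf]) h1 h3, hu _ (by simp [prems, justOf]) h2 h4⟩
  · intro v q hv
    obtain ⟨-, -, -, -, h5⟩ := ent_just hc hpre hS hR (hjust v q (p3 v _ hv).1)
    exact h5.imp_right fun h => h.2.2
  · rw [hlen, ← hTm]
    exact ⟨.inr q₀, by rw [p2, hq₀]⟩
  · rw [hlen]
    exact hbl
  · intro S hS1 hS2
    rw [hlen] at hS1
    refine p4 S (hTm ▸ hS1) fun v t hv ht j hj => ?_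
    rcases t with C | q
    · simp [prems, justOf] at hj
    · obtain ⟨h1, h2⟩ := hS2 v q hv ht
      simp only [prems, justOf, Option.elim_some, Sum.elim_inr, List.mem_cons,
        List.not_mem_nil, or_false] at hj
      rcases hj with rfl | rfl
      · exact h1
      · exact h2
  · intro C hC
    obtain ⟨v, hv⟩ := List.mem_iff_getElem?.1 hC
    exact List.mem_of_getElem? (hax v C hv).1
  · rw [p1, hTm, ← hR.length, ← length_evalAll c K L']
    exact hmE
  · rw [← hTm, p2, hq₀]

theorem Reduct.lit_eq_none (hR : Reduct n K x N s W L L') {C : Cl}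
    (hC : (some (.inl C) : Ln) ∈ L') {i : ℕ} (hi : i ∉ K) (hW : W i) : lit C i = none := by
  obtain ⟨v, hv⟩ := List.mem_iff_getElem?.1 hC
  have hvL : v < L.length := hR.length ▸ (List.getElem?_eq_some_iff.1 hv).1
  have hl : L[v]? = some L[v] := List.getElem?_eq_getElem hvL
  rcases hlv : L[v] with _ | C' | r
  · rw [hlv] at hl
    rw [hR.unused v hl] at hv
    simp at hv
  · rw [hlv] at hl
    rcases hR.ax v C' hl with ⟨h', -⟩ | ⟨C'', h', -, -, -, h''⟩
    · rw [h'] at hv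
      simp at hv
    · rw [h'] at hv
      obtain rfl := Sum.inl.inj (Option.some.inj (Option.some.inj hv))
      exact (h'' i hi).1 hW
  · rw [hlv] at hl
    rw [hR.inf v r hl] at hv
    simp at hv

/-- The variables of the clauses of a skeleton occur in the axioms. -/
theorem Skel.occ (hS : Skel pre L val) (v : ℕ) (hv : Used L v) (i : ℕ)
    (hi : lit (val v) i ≠ none) : CDCL.occ L i = true := by
  induction v using Nat.strong_induction_on with
  | _ v ih =>
  obtain ⟨t, ht⟩ := hv
  rcases t with C | q
  · rw [hS.ax v C ht] at hi
    simp only [CDCL.occ, List.any_eq_true]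
    exact ⟨_, List.mem_of_getElem? ht, by simp [axOf, hi]⟩
  · obtain ⟨h1, h2⟩ := hS.lt v q ht
    obtain ⟨u1, u2⟩ := hS.used v q ht
    rcases hS.inf v q ht with ⟨-, h⟩ | h
    · exact ih _ h1 u1 (h ▸ hi)
    · rw [h.lit_eq] at hi
      split_ifs at hi with h3 h4
      · simp at hi
      · exact ih _ h2 u2 hi
      · exact ih _ h1 u1 hi

/-- All lines of an evaluated skeleton can be derived if all facts are available. -/
theorem simE_spec (hc : CtxOK π c) (hK : K <+: c.2) (hpre : pre ⊆ K) (hS : Skel pre L val)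
    (hR : Reduct n K x N s W L L') (hG : Good π τ G)
    (hax : ∀ C, (some (.inl C) : Ln) ∈ L' → Der n G O K C)
    (hf : ∀ w, O w → w ∉ K → ∀ b, ∃ A, FactOK n G O K (w, b, A)) :
    Good π τ (G ++ simE c K (evalAll c K L')) ∧ ∀ v, (ent c K L' v).1 ≠ none →
      Der n (G ++ simE c K (evalAll c K L')) O K (ent c K L' v).2 := by
  set g : Entry → List Raw := fun e => (justOf e.1).elim [] fun q =>
    bif decide (q.1 = q.2.1) then [] else learn c K (ent c K L' q.1).2 (ent c K L' q.2.1).2 q.2.2.1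
    with hg
  have hsim : simE c K (evalAll c K L') = (evalAll c K L').flatMap g := rfl
  have hlenE : (evalAll c K L').length = L'.length := length_evalAll _ _ _
  have key : ∀ m ≤ L'.length, Good π τ (G ++ ((evalAll c K L').take m).flatMap g) ∧
      ∀ v < m, (ent c K L' v).1 ≠ none →
        Der n (G ++ ((evalAll c K L').take m).flatMap g) O K (ent c K L' v).2 := by
    intro m
    induction m with
    | zero => simpa using hG
    | succ m ih =>
      intro hm
      obtain ⟨g1, g2⟩ := ih (by omega)
      have hmE : m < (evalAll c K L').length := by omega
      have e : (evalAll c K L').take (m + 1) = (evalAll c K L').take m ++ [ent c K L' m] := by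
        rw [List.take_succ_eq_append_getElem hmE, ent, List.getD_eq_getElem _ _ hmE]
      rw [e, List.flatMap_append, ← List.append_assoc]
      simp only [List.flatMap_singleton]
      have hold : ∀ v < m, (ent c K L' v).1 ≠ none → ∀ G',
          Der n (G ++ ((evalAll c K L').take m).flatMap g ++ G') O K (ent c K L' v).2 :=
        fun v hv hn G' => (g2 v hv hn).mono (List.subset_append_left _ _) fun _ h => h
      rcases hm1 : (ent c K L' m).1 with _ | C | q
      · have : g (ent c K L' m) = [] := by simp [hg, hm1, justOf]
        rw [this, List.append_nil]
        refine ⟨g1, fun v hv hn => ?_⟩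
        rcases (by omega : v < m ∨ v = m) with h | rfl
        · exact g2 v h hn
        · exact absurd hm1 hn
      · have : g (ent c K L' m) = [] := by simp [hg, hm1, justOf]
        rw [this, List.append_nil]
        refine ⟨g1, fun v hv hn => ?_⟩
        rcases (by omega : v < m ∨ v = m) with h | rfl
        · exact g2 v h hn
        · obtain ⟨k1, k2⟩ := ent_ax (hR.lt hS) hm1
          rw [k2]
          exact (hax C (List.mem_of_getElem? k1)).mono (List.subset_append_left _ _) fun _ h => h
      · obtain ⟨h1, h2, h3, h4, h5⟩ := ent_just hc hpre hS hR hm1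
        rcases h5 with ⟨h5, h6⟩ | ⟨h5, h6, h7⟩
        · have : g (ent c K L' m) = [] := by simp [hg, hm1, justOf, h5]
          rw [this, List.append_nil]
          refine ⟨g1, fun v hv hn => ?_⟩
          rcases (by omega : v < m ∨ v = m) with h | rfl
          · exact g2 v h hn
          · rw [h6]
            exact g2 _ h1 h3
        · have hP := g2 _ h1 h3
          have hQ := g2 _ h2 h4
          have : g (ent c K L' m) = learn c K (ent c K L' q.1).2 (ent c K L' q.2.1).2 q.2.2.1 := by
            simp [hg, hm1, justOf, h5]
          rw [this]
          have hl : LearnOK n (G ++ ((evalAll c K L').take m).flatMap g) K (ent c K L' q.1).2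
              (ent c K L' q.2.1).2 q.2.2.1 q.2.2.2 :=
            { memP := hP.mem, memQ := hQ.mem, lenP := hP.len, lenQ := hQ.len, litP := h7.litP
              litQ := h7.litQ, notMem := h7.notMem, posP := hP.nn, posQ := hQ.nn
              -- On `K` neither clause has a negative literal, so the signs agree there. Outside `K`
              -- the agreement comes from the original inference.
              compat := by
                intro v hv b b' hb hb'
                by_cases hvK : v ∈ K
                · have e1 := hP.nn v hvK
                  have e2 := hQ.nn v hvK
                  rw [hb] at e1
                  rw [hb'] at e2
                  cases b <;> cases b' <;> simp_all
                · exact h7.compat v hvK hv b b' hb hb'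
              -- Variables in `O` outside `K` have facts of both signs, so any literal of the first
              -- premise can be falsified by propagation.
              facts := by
                intro w hw _ b hb
                obtain ⟨A, hA⟩ := hf w (hP.sup w (by simp [hb])) hw (!b)
                exact ⟨A, hA.toIsFact.mono (List.subset_append_left _ _)⟩ }
          obtain ⟨k1, k2⟩ := g1.learn hc hK hl
          refine ⟨k1, fun v hv hn => ?_⟩
          rcases (by omega : v < m ∨ v = m) with h | rfl
          · exact hold v h hn _
          · rw [h6]
            refine ⟨k2, length_res hc _ _ _, fun i hi => ?_, fun i hi => ?_⟩
            · rw [lit_res hc hP.len hQ.len] at hi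
              split_ifs at hi
              · simp at hi
              · exact hQ.sup i hi
              · exact hP.sup i hi
            · rw [lit_res hc hP.len hQ.len]
              split_ifs
              · simp
              · exact hQ.nn i hi
              · exact hP.nn i hi
  obtain ⟨g1, g2⟩ := key L'.length le_rfl
  rw [← hlenE, List.take_length, ← hsim] at g1 g2
  exact ⟨g1, fun v hn => g2 v (hlenE ▸ ent_lt hn) hn⟩

theorem lit_res_none {P Q : Cl} {z i : ℕ} (hP : lit P i = none) (hQ : lit Q i = none)
    (hc : CtxOK π c) : lit (res c P Q z) i = none := by
  rw [lit, res, hc.vs]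
  rcases lt_or_ge i n with h | h
  · rw [List.getD_eq_getElem _ _ (by simpa using h)]
    simp [hP, hQ]
  · rw [List.getD_eq_default _ _ (by simpa using h)]

/-- Variables that do not occur in the axioms do not occur in the evaluated lines. -/
theorem lit_ent_none (hc : CtxOK π c) (hpre : pre ⊆ K) (hS : Skel pre L val)
    (hR : Reduct n K x N s W L L') {i : ℕ}
    (hax : ∀ C, (some (.inl C) : Ln) ∈ L' → lit C i = none) (v : ℕ)
    (hv : (ent c K L' v).1 ≠ none) : lit (ent c K L' v).2 i = none := by
  induction v using Nat.strong_induction_on with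
  | _ v ih =>
  rcases hm1 : (ent c K L' v).1 with _ | C | q
  · exact absurd hm1 hv
  · obtain ⟨k1, k2⟩ := ent_ax (hR.lt hS) hm1
    rw [k2]
    exact hax C (List.mem_of_getElem? k1)
  · obtain ⟨h1, h2, h3, h4, h5⟩ := ent_just hc hpre hS hR hm1
    rcases h5 with ⟨h5, h6⟩ | ⟨h5, h6, h7⟩
    · rw [h6]
      exact ih _ h1 h3
    · rw [h6]
      exact lit_res_none (ih _ h1 h3) (ih _ h2 h4) hc

end conflict

/-! ### The search for the second fact on the first variable of a task. -/

section search
variable {n : ℕ} {π : Equiv.Perm (Fin n)} {τ : CNF n} {c : Ctx} {K pre : List ℕ} {x : ℕ}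
  {L : List Ln} {val : ℕ → Cl} {G : List Raw} {O : ℕ → Prop}

/-- No variable in `O` lies between `pre` and `x`, so enlarging the segment from `pre` to `K` puts
only `x` at risk. -/
theorem Der.raise {C : Cl} (h : Der n G O pre C) (hgap : ∀ i ∈ K, O i → i ∈ pre ∨ i = x)
    (hx : lit C x ≠ some false) : Der n G O K C :=
  ⟨h.mem, h.len, h.sup, fun v hv hn => by
    rcases hgap v hv (h.sup v (by simp [hn])) with h' | rfl
    · exact h.nn v h' hn
    · exact hx hn⟩

/-- The converse passage, from `K` down to `pre`. If outside `K` only `z` is left and `x` does not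
occur apart from `z`, then the remaining literals lie in `pre`, as no variable in `O` lies in
between. The case `z = x` is allowed and yields facts on `x` itself. -/
theorem factOK_of_der {C : Cl} (h : Der n G O K C)
    (hgap : ∀ i ∈ K, O i → i ∈ pre ∨ i = x) {z : ℕ} {b : Bool} (hz : z ∉ pre)
    (hb : lit C z = some b) (ho : ∀ v, v ≠ z → lit C v ≠ none → v ∈ K ∧ v ≠ x)  :
    FactOK n G O pre (z, b, C) :=
  { mem := h.mem, len := h.len, lit_eq := hb, sup := h.sup, notMem := hz
    other := fun v hv hn => by
      obtain ⟨h1, h2⟩ := ho v hv hn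
      have h3 := (hgap v h1 (h.sup v hn)).resolve_right h2
      refine ⟨h3, ?_⟩
      have h4 := h.nn v h1
      obtain ⟨b', hb'⟩ := Option.ne_none_iff_exists'.1 hn
      change lit C v = _
      rw [hb'] at h4 ⊢
      cases b'
      · exact absurd rfl h4
      · rfl }

/-- `L'` is obtained from `L` by removing the variables in `W` from the axioms. -/
structure Stripped (pre : List ℕ) (W : ℕ → Prop) (L L' : List Ln) : Prop where
  length : L'.length = L.length
  unused : ∀ v : ℕ, L[v]? = some none → L'[v]? = some none
  inf : ∀ (v : ℕ) (q : Just), L[v]? = some (some (.inr q)) → L'[v]? = some (some (.inr q))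
  ax : ∀ (v : ℕ) (C : Cl), L[v]? = some (some (.inl C)) → ∃ C' : Cl,
    L'[v]? = some (some (.inl C')) ∧
      ∀ i ∉ pre, (W i → lit C' i = none) ∧ (¬ W i → lit C' i = lit C i)

theorem Stripped.refl : Stripped pre (fun _ => False) L L :=
  ⟨rfl, fun _ h => h, fun _ _ h => h, fun _ C h => ⟨C, h, fun _ _ => ⟨False.elim, fun _ => rfl⟩⟩⟩

theorem getElem?_stripL_ax {us : List Fact} {v : ℕ} {C : Cl}
    (h : L[v]? = some (some (.inl C))) :
    (stripL c K us L)[v]? = some (some (.inl (strip c K us C).1)) := by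
  rw [stripL_getElem?, h]; rfl

theorem getElem?_stripL_inr {us : List Fact} {v : ℕ} {q : Just}
    (h : L[v]? = some (some (.inr q))) : (stripL c K us L)[v]? = some (some (.inr q)) := by
  rw [stripL_getElem?, h]; rfl

theorem getElem?_stripL_none {us : List Fact} {v : ℕ} (h : L[v]? = some none) :
    (stripL c K us L)[v]? = some none := by
  rw [stripL_getElem?, h]; rfl

theorem getElem?_dropL_inr {s : Bool} {v : ℕ} {q : Just}
    (h : L[v]? = some (some (.inr q))) : (dropL x s L)[v]? = some (some (.inr q)) := by
  rw [dropL_getElem?, h]; rfl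

theorem getElem?_dropL_none {s : Bool} {v : ℕ} (h : L[v]? = some none) :
    (dropL x s L)[v]? = some none := by
  rw [dropL_getElem?, h]; rfl

theorem getElem?_dropL_pos {s : Bool} {v : ℕ} {C : Cl} (h : L[v]? = some (some (.inl C)))
    (hC : lit C x = some s) : (dropL x s L)[v]? = some none := by
  rw [dropL_getElem?, h]; simp [axOf, hC]

theorem getElem?_dropL_neg {s : Bool} {v : ℕ} {C : Cl} (h : L[v]? = some (some (.inl C)))
    (hC : lit C x ≠ some s) : (dropL x s L)[v]? = some (some (.inl C)) := by
  rw [dropL_getElem?, h]; simp [axOf, hC]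

theorem length_stripL (us : List Fact) : (stripL c K us L).length = L.length := by simp [stripL]

theorem length_dropL (s : Bool) : (dropL x s L).length = L.length := by simp [dropL]

theorem occ_iff {i : ℕ} : occ L i = true ↔ ∃ C, (some (.inl C) : Ln) ∈ L ∧ lit C i ≠ none := by
  simp only [occ, List.any_eq_true]
  constructor
  · rintro ⟨l, hl, h⟩
    rcases l with _ | C | q
    · simp [axOf] at h
    · exact ⟨C, hl, by simpa [axOf] using h⟩
    · simp [axOf] at h
  · rintro ⟨C, h1, h2⟩
    exact ⟨_, h1, by simp [axOf, h2]⟩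

theorem singleton_fact {u : Fact} (h : FactOK n G O K u) : ∀ w ∈ [u], FactOK n G O K w := by
  simpa using h

/-- One round of the search. -/
theorem round_spec (hc : CtxOK π c) (hpre' : pre <+: c.2) (hK : K <+: c.2) (hpre : pre ⊆ K)
    (hxK : x ∈ K) (hxp : x ∉ pre) (hS : Skel pre L val)
    (hgap : ∀ i ∈ K, O i → i ∈ pre ∨ i = x) (hocc : occ L x = true) {X : Cl}
    (hX : FactOK n G O pre (x, true, X))
    (hf : ∀ w, O w → w ∉ K → ∀ b, ∃ A, FactOK n G O K (w, b, A)) (hG : Good π τ G)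
    {Lr : List Ln} {W : Finset ℕ} (hW : W ⊆ Finset.range n) (hxW : x ∉ W)
    (hLr : Stripped pre (fun i => i ∈ W) L Lr)
    (hder : ∀ C, (some (.inl C) : Ln) ∈ Lr → Der n G O pre C) :
    Good π τ (G ++ roundE c pre K x X (Lr, none)) ∧
    ((∃ Xb L', round c pre K x X (Lr, none) = (L', some Xb) ∧ FactOK n G O pre (x, false, Xb)) ∨
      ∃ (W' : Finset ℕ) (L' : List Ln), round c pre K x X (Lr, none) = (L', none) ∧
        W' ⊆ Finset.range n ∧ x ∉ W' ∧ W'.card = W.card + 1 ∧ Stripped pre (fun i => i ∈ W') L L' ∧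
        ∀ C, (some (.inl C) : Ln) ∈ L' →
          Der n (G ++ roundE c pre K x X (Lr, none)) O pre C) := by
  -- If no axiom has shrunk to `x ^ 0`, the derivation is evaluated with `x = 1`. Its first
  -- contradiction supplies two facts over `pre` for a variable not yet in `W`.
  by_cases hu : (units c K x false Lr).isEmpty = true
  · have e1 : round c pre K x X (Lr, none) =
        (stripL c pre (confFacts c K (evalOne c pre K x X Lr)) Lr, none) := by simp [round, hu]
    have e2 : roundE c pre K x X (Lr, none) = stripE c pre [(x, true, X)] (dropL x true Lr) ++
        (simE c K (evalOne c pre K x X Lr) ++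
          stripE c pre (confFacts c K (evalOne c pre K x X Lr)) Lr) := by simp [roundE, hu]
    rw [e1, e2]
    set D := dropL x true Lr with hD
    set L' := stripL c pre [(x, true, X)] D with hL'
    have hev : evalOne c pre K x X Lr = evalAll c K L' := rfl
    have hderD : ∀ C, (some (.inl C) : Ln) ∈ D → Der n G O pre C :=
      fun C hC => hder C (mem_dropL.1 hC).1
    obtain ⟨g1, d1⟩ := stripE_spec hc hpre' hG (singleton_fact hX) hderD
    set G1 := G ++ stripE c pre [(x, true, X)] D with hG1
    have hs1 : G ⊆ G1 := List.subset_append_left _ _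
    -- Axioms with the positive literal are dropped, and the negative literal is resolved away with
    -- `X`. So `x` disappears, and setting `x` to zero in the trails below is harmless although the
    -- axioms were chosen for `x = 1`.
    have hlitx : ∀ C, (some (.inl C) : Ln) ∈ D →
        lit (strip c pre [(x, true, X)] C).1 x = none := by
      intro C hC
      rw [(strip_spec hc hpre' hG (singleton_fact hX) (hderD C hC)).2.2.1 x hxp]
      split_ifs with h
      · rfl
      · cases hl : lit C x with
        | none => rfl
        | some b =>
          have := (mem_dropL.1 hC).2
          rw [hl] at this h
          cases b <;> simp_all
    have hlitx' : ∀ C, (some (.inl C) : Ln) ∈ L' → lit C x = none := by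
      intro C hC
      obtain ⟨C', h1, rfl⟩ := mem_stripL.1 hC
      exact hlitx C' h1
    -- A blank axiom with a negative literal on `x` would be among the `units`, which are empty in
    -- this case. This is the condition on retained axioms.
    have hR : Reduct n K x True true (fun i => i ∈ W) L L' := by
      refine ⟨?_, ?_, ?_, ?_⟩
      · rw [hL', length_stripL, hD, length_dropL, hLr.length]
      · exact fun v h => getElem?_stripL_none (getElem?_dropL_none (hLr.unused v h))
      · exact fun v q h => getElem?_stripL_inr (getElem?_dropL_inr (hLr.inf v q h))
      · intro v C h
        obtain ⟨C₁, h1, h2⟩ := hLr.ax v C h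
        have hxx := (h2 x hxp).2 hxW
        by_cases hx1 : lit C₁ x = some true
        · exact Or.inl ⟨getElem?_stripL_none (getElem?_dropL_pos h1 hx1), trivial, hxx ▸ hx1⟩
        · have h3 := getElem?_dropL_neg h1 hx1
          have hm : (some (.inl C₁) : Ln) ∈ D := List.mem_of_getElem? h3
          obtain ⟨-, s2, s3, -⟩ := strip_spec hc hpre' hG (singleton_fact hX) (hderD C₁ hm)
          refine Or.inr ⟨_, getElem?_stripL_ax h3, fun _ => hxx ▸ hx1, fun _ hb hl => ?_, s2.len,
            fun i hi => ?_⟩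
          · have : C₁ ∈ units c K x false Lr := by
              rw [mem_units, blank_iff hc (hderD C₁ hm).len]
              refine ⟨(mem_dropL.1 hm).1, fun i hi => ?_, hxx.trans hl⟩
              rw [← hb i hi, s3 i fun h => hi (hpre h), if_neg]
              rintro ⟨u, hu, rfl, -⟩
              simp only [List.mem_singleton] at hu
              subst hu
              exact hi hxK
            rw [List.isEmpty_iff] at hu
            simp [hu] at this
          · have hip : i ∉ pre := fun h => hi (hpre h)
            have : lit (strip c pre [(x, true, X)] C₁).1 i = lit C₁ i := by
              rw [s3 i hip, if_neg]
              rintro ⟨u, hu, rfl, -⟩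
              simp only [List.mem_singleton] at hu
              subst hu
              exact hi hxK
            rw [this]
            exact h2 i hip
    -- Without a conflict, `x` would not occur in any axiom of `L`.
    have hcf : isConf c K (conf c K (evalAll c K L')) = true := by
      by_contra hno
      obtain ⟨C, hC, hn⟩ := occ_iff.1 hocc
      obtain ⟨v, hv⟩ := List.mem_iff_getElem?.1 hC
      exact hn ((hS.of_noconf hc hpre hxK hxp hR (no_conf hno) v C hv).2 trivial)
    obtain ⟨g2, d2⟩ := simE_spec hc hK hpre hS hR g1 (fun C hC => by
        obtain ⟨C', h1, rfl⟩ := mem_stripL.1 hC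
        exact (d1 C' h1).raise hgap (by rw [hlitx C' h1]; simp))
      fun w hw hwK b => by
        obtain ⟨A, hA⟩ := hf w hw hwK b
        exact ⟨A, hA.mono hs1 fun _ h => h⟩
    set G2 := G1 ++ simE c K (evalAll c K L') with hG2
    have hs2 : G ⊆ G2 := fun _ h => List.subset_append_left _ _ (hs1 h)
    obtain ⟨q, hq, hne, hbl⟩ := conf_spec hc hpre hS hR hcf
    have hce : conf c K (evalAll c K L') =
      ent c K L' (before c K (evalAll c K L')).length := rfl
    rw [hce] at hq hbl
    obtain ⟨j1, j2, j3, j4, j5⟩ := ent_just hc hpre hS hR hq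
    obtain ⟨-, -, hr⟩ := j5.resolve_left fun h => hne h.1
    have hzK := hr.notMem
    have hcfs : confFacts c K (evalAll c K L') = [(q.2.2.1, q.2.2.2, (ent c K L' q.1).2),
        (q.2.2.1, !q.2.2.2, (ent c K L' q.2.1).2)] := by
      rw [confFacts, hce, justOf_eq.2 hq]
      rfl
    set z := q.2.2.1 with hz
    have hzx : z ≠ x := fun h => hzK (h ▸ hxK)
    have hP := d2 _ j3
    have hQ := d2 _ j4
    -- The resolvent is blank, so outside `K` each premise contains only the pivot. As neither
    -- contains `x`, both are facts over `pre`, not just over `K`.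
    have ho : ∀ v, v ≠ z → (lit (ent c K L' q.1).2 v ≠ none ∨
        lit (ent c K L' q.2.1).2 v ≠ none) → v ∈ K := by
      intro v hv hn
      by_contra hvK
      have := hbl v hvK
      rw [hr.lit_eq, if_neg hv] at this
      split_ifs at this with h
      · exact hn.elim (fun h' => h' h) fun h' => h' this
      · exact h this
    have hzp : z ∉ pre := fun h => hzK (hpre h)
    have hfacts : ∀ u ∈ confFacts c K (evalAll c K L'), FactOK n G2 O pre u := by
      intro u hu
      rw [hcfs] at hu
      simp only [List.mem_cons, List.not_mem_nil, or_false] at hu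
      rcases hu with rfl | rfl
      · refine factOK_of_der hP hgap hzp hr.litP fun v hv hn => ⟨ho v hv (Or.inl hn), ?_⟩
        rintro rfl
        exact hn (lit_ent_none hc hpre hS hR hlitx' _ j3)
      · refine factOK_of_der hQ hgap hzp hr.litQ fun v hv hn => ⟨ho v hv (Or.inr hn), ?_⟩
        rintro rfl
        exact hn (lit_ent_none hc hpre hS hR hlitx' _ j4)
    have hder2 : ∀ C, (some (.inl C) : Ln) ∈ Lr → Der n G2 O pre C :=
      fun C hC => (hder C hC).mono hs2 fun _ h => h
    obtain ⟨g3, d3⟩ := stripE_spec hc hpre' g2 hfacts hder2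
    rw [hev]
    have hGe : G ++ (stripE c pre [(x, true, X)] D ++ (simE c K (evalAll c K L') ++
        stripE c pre (confFacts c K (evalAll c K L')) Lr)) =
        G2 ++ stripE c pre (confFacts c K (evalAll c K L')) Lr := by simp [hG2, hG1]
    rw [hGe]
    -- Variables in `W` have been removed from the axioms and do not come back in evaluated clauses,
    -- so the pivot is new.
    have hzW : z ∉ W := by
      have := (ent_spec hc hpre hS hR q.1).2 z hzK (by rw [hr.litP]; simp)
      exact this.2
    refine ⟨g3, Or.inr ⟨insert z W, _, rfl, ?_, ?_, ?_, ?_, ?_⟩⟩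
    · intro i hi
      rcases Finset.mem_insert.1 hi with rfl | hi
      · exact Finset.mem_range.2 (lt_of_lit hP.len (by rw [hr.litP]; simp))
      · exact hW hi
    · simp [hxW, hzx.symm]
    · exact Finset.card_insert_of_notMem hzW
    · refine ⟨?_, ?_, ?_, ?_⟩
      · rw [length_stripL, hLr.length]
      · exact fun v h => getElem?_stripL_none (hLr.unused v h)
      · exact fun v q h => getElem?_stripL_inr (hLr.inf v q h)
      · intro v C h
        obtain ⟨C₁, h1, h2⟩ := hLr.ax v C h
        obtain ⟨-, -, s3, -⟩ := strip_spec hc hpre' g2 hfacts (hder2 C₁ (List.mem_of_getElem? h1))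
        refine ⟨_, getElem?_stripL_ax h1, fun i hi => ?_⟩
        rw [s3 i hi]
        obtain ⟨k1, k2⟩ := h2 i hi
        constructor
        · intro hiW
          split_ifs with h'
          · rfl
          · rcases Finset.mem_insert.1 hiW with rfl | hiW
            · cases hl : lit C₁ z with
              | none => rfl
              | some b =>
                exfalso
                apply h'
                rw [hcfs]
                by_cases hb : b = !q.2.2.2
                · exact ⟨_, List.mem_cons_self .., rfl, by rw [hl, hb]⟩
                · exact ⟨_, List.mem_cons_of_mem _ (List.mem_cons_self ..), rfl, by
                    rw [hl]; revert hb; cases b <;> cases q.2.2.2 <;> simp⟩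
            · exact k1 hiW
        · intro hiW
          rw [Finset.mem_insert, not_or] at hiW
          rw [if_neg]
          · exact k2 hiW.2
          · rw [hcfs]
            rintro ⟨u, hu, rfl, -⟩
            simp only [List.mem_cons, List.not_mem_nil, or_false] at hu
            rcases hu with rfl | rfl
            · exact hiW.1 rfl
            · exact hiW.1 rfl
    · intro C hC
      obtain ⟨C', h1, rfl⟩ := mem_stripL.1 hC
      exact d3 C' h1
  · have e1 : round c pre K x X (Lr, none) = (Lr, some ((units c K x false Lr).headD [])) := by
      simp [round, hu]
    have e2 : roundE c pre K x X (Lr, none) = [] := by simp [roundE, hu]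
    rw [e1, e2, List.append_nil]
    refine ⟨hG, Or.inl ⟨_, _, rfl, ?_⟩⟩
    have hmem : (units c K x false Lr).headD [] ∈ units c K x false Lr := by
      cases h : units c K x false Lr with
      | nil => simp [h] at hu
      | cons a l => simp
    obtain ⟨h1, h2, h3⟩ := mem_units.1 hmem
    have hd := hder _ h1
    rw [blank_iff hc hd.len] at h2
    refine factOK_of_der (K := pre) (x := x) hd (fun i h _ => Or.inl h) hxp h3
      fun v hv hn => ⟨?_, hv⟩
    have hvK : v ∈ K := by
      by_contra h
      exact hn (h2 v h)
    exact (hgap v hvK (hd.sup v hn)).resolve_right hv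

/-- Every unsuccessful round adds one variable to `W`, which never contains `x`. So `n` rounds
cannot all fail, as they would put all variables into `W`. -/
theorem search_spec (hc : CtxOK π c) (hpre' : pre <+: c.2) (hK : K <+: c.2) (hpre : pre ⊆ K)
    (hxK : x ∈ K) (hxp : x ∉ pre) (hS : Skel pre L val)
    (hgap : ∀ i ∈ K, O i → i ∈ pre ∨ i = x) (hocc : occ L x = true) {X : Cl}
    (hX : FactOK n G O pre (x, true, X))
    (hf : ∀ w, O w → w ∉ K → ∀ b, ∃ A, FactOK n G O K (w, b, A)) (hG : Good π τ G)
    (hder : ∀ C, (some (.inl C) : Ln) ∈ L → Der n G O pre C) :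
    Good π τ (G ++ (search c pre K x X L).2) ∧
      FactOK n (G ++ (search c pre K x X L).2) O pre
        (x, false, foundCl (search c pre K x X L)) := by
  have key : ∀ l : List ℕ, ∃ s E, foldEmit (fun s (_ : ℕ) => round c pre K x X s)
      (fun s _ => roundE c pre K x X s) l (L, none) = (s, E) ∧ Good π τ (G ++ E) ∧
      ((∃ L' Xb, s = (L', some Xb) ∧ FactOK n (G ++ E) O pre (x, false, Xb)) ∨
      ∃ (W : Finset ℕ) (L' : List Ln), s = (L', none) ∧ W ⊆ Finset.range n ∧ x ∉ W ∧
        W.card = l.length ∧ Stripped pre (fun i => i ∈ W) L L' ∧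
        ∀ C, (some (.inl C) : Ln) ∈ L' → Der n (G ++ E) O pre C) := by
    intro l
    induction l using List.reverseRecOn with
    | nil =>
      refine ⟨_, _, rfl, by simpa using hG, Or.inr ⟨∅, L, rfl, by simp, by simp, rfl, ?_, ?_⟩⟩
      · simpa using Stripped.refl
      · simpa using hder
    | append_singleton l y ih =>
      obtain ⟨s, E, e, g, h⟩ := ih
      rw [foldEmit_append_singleton, e]
      rcases h with ⟨L', Xb, rfl, h⟩ | ⟨W, L', rfl, hW, hxW, hcard, hst, hd⟩
      · refine ⟨_, _, rfl, ?_⟩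
        have e1 : round c pre K x X (L', some Xb) = (L', some Xb) := by simp [round]
        have e2 : roundE c pre K x X (L', some Xb) = [] := by simp [roundE]
        simp only [e1, e2, List.append_nil]
        exact ⟨g, Or.inl ⟨L', Xb, rfl, h⟩⟩
      · have hs : G ⊆ G ++ E := List.subset_append_left _ _
        obtain ⟨g', h'⟩ := round_spec hc hpre' hK hpre hxK hxp hS hgap hocc
          (hX.mono hs fun _ h => h) (fun w hw hwK b => by
            obtain ⟨A, hA⟩ := hf w hw hwK b
            exact ⟨A, hA.mono hs fun _ h => h⟩) g hW hxW hst hd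
        refine ⟨_, _, rfl, ?_⟩
        simp only [← List.append_assoc]
        refine ⟨g', ?_⟩
        rcases h' with ⟨Xb, L'', h1, h2⟩ | ⟨W', L'', h1, h2, h3, h4, h5, h6⟩
        · exact Or.inl ⟨L'', Xb, h1, h2.mono (List.subset_append_left _ _) fun _ h => h⟩
        · exact Or.inr ⟨W', L'', h1, h2, h3, by simp [h4, hcard], h5, h6⟩
  obtain ⟨s, E, e, g, h⟩ := key c.1
  rw [search, e]
  refine ⟨g, ?_⟩
  rcases h with ⟨L', Xb, rfl, h⟩ | ⟨W, L', -, hW, hxW, hcard, -⟩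
  · exact h
  · exfalso
    have h1 : W = Finset.range n :=
      Finset.eq_of_subset_of_card_le hW (by simp [hcard, hc.vs])
    rw [h1] at hxW
    obtain ⟨C, hC, hn⟩ := occ_iff.1 hocc
    exact hxW (Finset.mem_range.2 (lt_of_lit (hder C hC).len hn))

/-- The facts for the task below. -/
theorem newFacts_spec (hc : CtxOK π c) (hpre' : pre <+: c.2) (hpre : pre ⊆ K) (hxK : x ∈ K)
    (hxp : x ∉ pre) (hgap : ∀ i ∈ K, O i → i ∈ pre ∨ i = x) {X Xb : Cl}
    (hX : FactOK n G O pre (x, true, X)) (hXb : FactOK n G O pre (x, false, Xb))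
    {U : List Fact} (hU : ∀ u ∈ U, FactOK n G O K u) (hG : Good π τ G) :
    Good π τ (G ++ newFactsE c pre x Xb U) ∧ ∀ u ∈ newFacts c pre x X Xb U,
      FactOK n (G ++ newFactsE c pre x Xb U) O pre u := by
  have hder : ∀ u ∈ U, Der n G O pre u.2.2 := fun u hu =>
    ⟨(hU u hu).mem, (hU u hu).len, (hU u hu).sup, fun v hv => (hU u hu).nn v (hpre hv)⟩
  obtain ⟨g, d⟩ := stripE_spec (L := U.map fun u => some (.inl u.2.2)) hc hpre' hG
    -- The clauses of the facts are treated as the axioms of an auxiliary skeleton, so that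
    -- `stripE_spec` applies.
    (singleton_fact hXb) (by
      intro C hC
      obtain ⟨u, hu, h⟩ := List.mem_map.1 hC
      obtain rfl := Sum.inl.inj (Option.some.inj h)
      exact hder u hu)
  have e : stripE c pre [(x, false, Xb)] (U.map fun u => some (.inl u.2.2)) =
      newFactsE c pre x Xb U := by
    simp [stripE, newFactsE, List.flatMap_map, axOf]
  rw [e] at g d
  refine ⟨g, fun u hu => ?_⟩
  simp only [newFacts, List.mem_append, List.mem_map, List.mem_cons, List.not_mem_nil,
    or_false] at hu
  rcases hu with ⟨u, hu, rfl⟩ | rfl | rfl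
  · have hd := d u.2.2 (List.mem_map_of_mem (f := fun u : Fact => (some (.inl u.2.2) : Ln)) hu)
    obtain ⟨-, -, s3, -⟩ := strip_spec hc hpre' hG (singleton_fact hXb) (hder u hu)
    have hz : u.1 ≠ x := fun h => (hU u hu).notMem (h ▸ hxK)
    have hzp : u.1 ∉ pre := fun h => (hU u hu).notMem (hpre h)
    -- In a fact over `K` the variable `x` can only occur positively, so resolving with the fact for
    -- `x ^ 0` removes it. What remains is a fact over `pre`.
    have hlx : lit (strip c pre [(x, false, Xb)] u.2.2).1 x = none := by
      rw [s3 x hxp]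
      split_ifs with h
      · rfl
      · by_contra hn
        refine h ⟨_, List.mem_singleton_self _, rfl, ?_⟩
        exact ((hU u hu).other x hz.symm hn).2
    have hnx : ∀ v, v ∉ pre → v ≠ x →
        lit (strip c pre [(x, false, Xb)] u.2.2).1 v = lit u.2.2 v := by
      intro v hv hvx
      rw [s3 v hv, if_neg]
      rintro ⟨w, hw, rfl, -⟩
      rw [List.mem_singleton] at hw
      subst hw
      exact hvx rfl
    refine factOK_of_der hd (x := x) (fun i h _ => Or.inl h) hzp ?_ ?_
    · rw [hnx _ hzp hz]
      exact (hU u hu).lit_eq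
    · intro v hv hn
      have hvx : v ≠ x := by
        rintro rfl
        exact hn hlx
      refine ⟨?_, hvx⟩
      by_contra hvp
      rw [hnx v hvp hvx] at hn
      exact hvp ((hgap v ((hU u hu).other v hv hn).1 ((hU u hu).sup v hn)).resolve_right hvx)
  · exact hX.mono (List.subset_append_left _ _) fun _ h => h
  · exact hXb.mono (List.subset_append_left _ _) fun _ h => h

end search

/-! ### Lengths of the derivations -/

section length
variable {n : ℕ} {π : Equiv.Perm (Fin n)} {c : Ctx} {K pre : List ℕ}

theorem CtxOK.length (hc : CtxOK π c) : c.2.length = n := by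
  have : c.2.Perm (List.range n) :=
    (List.perm_ext_iff_of_nodup hc.nodup List.nodup_range).2 fun v => by
      rw [hc.mem, List.mem_range]
  simpa using this.length_eq

theorem length_prefixes {α : Type} (t : List α) : (prefixes t).length = t.length := by
  induction t using List.reverseRecOn with
  | nil => rfl
  | append_singleton t x ih => rw [prefixes_append_singleton]; simp [ih]

/-- The trail has at most `n` entries for `K`, at most `n` for each of the two filtered lists, and
one for `z`. The empty trail and the learned clause account for the other two lines. -/
theorem length_learn (hc : CtxOK π c) (hK : K <+: c.2) (P Q : Cl) (z : ℕ) :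
    (learn c K P Q z).length ≤ 3 * n + 3 := by
  have h1 := hc.length
  have h2 := hK.length_le
  have h3 := List.length_filter_le
    (fun v => !decide (v ∈ K) && (!decide (v = z) && !decide (lit P v = none))) c.2
  have h4 := List.length_filter_le (fun v => !decide (v ∈ K) && decide (lit P v = none)) c.2
  simp only [learn, List.length_cons, List.length_append, List.length_map, length_prefixes,
    mkTrail, List.length_nil]
  omega

theorem length_foldEmit {α β γ : Type} {h : α → β → α} {e : α → β → List γ} {B : ℕ}
    (I : α → Prop) (hI : ∀ s x, I s → I (h s x)) (hB : ∀ s x, I s → (e s x).length ≤ B)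
    (l : List β) (i : α) (hi : I i) : (foldEmit h e l i).2.length ≤ l.length * B := by
  induction l generalizing i with
  | nil => simp
  | cons x l ih =>
    rw [foldEmit_cons, List.length_append, List.length_cons, add_mul]
    have := ih (h i x) (hI i x hi)
    have := hB i x hi
    omega

theorem length_flatMap_le {α β : Type} {f : α → List β} {B : ℕ} {l : List α}
    (h : ∀ x ∈ l, (f x).length ≤ B) : (l.flatMap f).length ≤ l.length * B := by
  induction l with
  | nil => simp
  | cons x l ih =>
    rw [List.flatMap_cons, List.length_append, List.length_cons, add_mul]
    have := h x (by simp)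
    have := ih fun y hy => h y (by simp [hy])
    omega

theorem length_strip (hc : CtxOK π c) (hK : K <+: c.2) (us : List Fact) (C : Cl) :
    (strip c K us C).2.length ≤ us.length * (3 * n + 3) :=
  length_foldEmit (fun _ => True) (fun _ _ _ => trivial) (fun C u _ => by
    rw [strip1E]
    cases decide (lit C u.1 = some (!u.2.1))
    · simp
    · exact length_learn hc hK _ _ _) us C trivial

theorem length_stripE (hc : CtxOK π c) (hK : K <+: c.2) (us : List Fact) (L : List Ln) :
    (stripE c K us L).length ≤ L.length * (us.length * (3 * n + 3)) :=
  length_flatMap_le fun l _ => by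
    rcases axOf l with _ | C
    · simp
    · exact length_strip hc hK us C

theorem length_simE (hc : CtxOK π c) (hK : K <+: c.2) (E : List Entry) :
    (simE c K E).length ≤ E.length * (3 * n + 3) :=
  length_flatMap_le fun e _ => by
    rcases justOf e.1 with _ | q
    · simp
    · simp only [Option.elim_some]
      cases decide (q.1 = q.2.1)
      · exact length_learn hc hK _ _ _
      · simp

/-- For each line of the skeleton there are at most four learning steps: one to resolve with `X`,
one to replay the line, and two to resolve with the facts from the conflict. -/
theorem length_roundE (hc : CtxOK π c) (hK : K <+: c.2) (hpre : pre <+: c.2) (x : ℕ) (X : Cl)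
    (s : List Ln × Option Cl) :
    (roundE c pre K x X s).length ≤ 4 * s.1.length * (3 * n + 3) := by
  rw [roundE]
  cases s.2.isSome
  · cases (units c K x false s.1).isEmpty
    · simp
    · simp only [cond_true, cond_false, List.length_append]
      have h1 := length_stripE hc hpre [(x, true, X)] (dropL x true s.1)
      have h2 := length_simE hc hK (evalOne c pre K x X s.1)
      have h3 := length_stripE hc hpre (confFacts c K (evalOne c pre K x X s.1)) s.1
      have h4 : (evalOne c pre K x X s.1).length = s.1.length := by
        rw [evalOne, length_evalAll, length_stripL, length_dropL]
      have h5 : (confFacts c K (evalOne c pre K x X s.1)).length ≤ 2 := by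
        rw [confFacts]
        rcases justOf (conf c K (evalOne c pre K x X s.1)).1 with _ | q <;> simp
      rw [length_dropL] at h1
      rw [h4] at h2
      have h6 : s.1.length * ((confFacts c K (evalOne c pre K x X s.1)).length * (3 * n + 3)) ≤
          s.1.length * (2 * (3 * n + 3)) :=
        Nat.mul_le_mul_left _ (Nat.mul_le_mul_right _ h5)
      simp only [List.length_singleton] at h1
      nlinarith
  · simp

theorem length_round (x : ℕ) (X : Cl) (s : List Ln × Option Cl) :
    (round c pre K x X s).1.length = s.1.length := by
  rw [round]
  cases s.2.isSome
  · cases (units c K x false s.1).isEmpty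
    · simp
    · simp [length_stripL]
  · simp

theorem length_search (hc : CtxOK π c) (hK : K <+: c.2) (hpre : pre <+: c.2) (x : ℕ) (X : Cl)
    (L : List Ln) : (search c pre K x X L).2.length ≤ n * (4 * L.length * (3 * n + 3)) := by
  have h1 : c.1.length = n := by simp [hc.vs]
  rw [← h1]
  refine length_foldEmit (fun s => s.1.length = L.length)
    (fun s _ hs => by rw [length_round, hs]) (fun s _ hs => ?_) c.1 (L, none) rfl
  rw [← hs, h1]
  exact length_roundE hc hK hpre x X s

/-- A bound on the length of the derivation of one step. -/
def stepBound (n R : ℕ) : ℕ := (R + R * (2 * n) + n * (4 * R) + 2 * n) * (3 * n + 3)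

/-- The summands of `stepBound` are the learning steps for stripping with the fact on `x`, for
stripping with at most `2 * n` facts, for at most `n` rounds of the search, and for handing down the
facts. -/
theorem length_stepFrameE (hc : CtxOK π c) (hK : K <+: c.2) (hpre : pre <+: c.2) {R : ℕ}
    (x : ℕ) (L : List Ln) (lx : Option Cl) (U : List Fact) (hL : L.length ≤ R)
    (hU : U.length ≤ 2 * n) :
    (stepFrameE c K (pre, x, L, lx, U)).length ≤ stepBound n R := by
  set T := 3 * n + 3 with hT
  have h0 : (prep0E c (pre, x, L, lx, U)).length ≤ R * T := by
    rcases lx with _ | X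
    · simp [prep0E]
    · refine (length_stripE hc hpre [(x, true, X)] L).trans ?_
      rw [List.length_singleton, one_mul]
      exact Nat.mul_le_mul_right _ hL
  have h0' : (prep0 c (pre, x, L, lx, U)).length = L.length := by
    rcases lx with _ | X
    · simp [prep0, length_dropL]
    · simp [prep0, length_stripL]
  have h1 : (prepE c K (pre, x, L, lx, U)).length ≤ R * T + R * (2 * n) * T := by
    rw [prepE, List.length_append]
    refine add_le_add h0 ((length_stripE hc hK U _).trans ?_)
    rw [h0', mul_assoc]
    exact Nat.mul_le_mul hL (Nat.mul_le_mul_right _ hU)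
  have h2 : (popE c K (pre, x, L, lx, U)).length ≤ n * (4 * R) * T + 2 * n * T := by
    rw [popE, List.length_append]
    refine add_le_add ((length_search hc hK hpre x _ L).trans ?_) ?_
    · rw [mul_assoc n]
      exact Nat.mul_le_mul_left _ (Nat.mul_le_mul_right _ (Nat.mul_le_mul_left _ hL))
    · refine (length_flatMap_le fun u _ => length_strip hc hpre _ _).trans ?_
      rw [List.length_singleton, one_mul]
      exact Nat.mul_le_mul_right _ hU
  rw [stepFrameE, List.length_append, stepBound, ← hT]
  have h3 : (bif canSet c K (pre, x, L, lx, U) || hasConf c K (pre, x, L, lx, U) then []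
      else popE c K (pre, x, L, lx, U)).length ≤ n * (4 * R) * T + 2 * n * T := by
    cases canSet c K (pre, x, L, lx, U) || hasConf c K (pre, x, L, lx, U)
    · exact h2
    · simp
  rw [add_mul, add_mul, add_mul]
  omega

end length

/-! ### Correctness of the algorithm -/

section main
variable {n : ℕ} {π : Equiv.Perm (Fin n)} {τ : CNF n} {c : Ctx} {pre : List ℕ} {x : ℕ}
  {L : List Ln} {lx : Option Cl} {U : List Fact} {G : List Raw}

/-- The variables of some facts. -/
def fvars (U : List Fact) : Finset ℕ := (U.map Prod.fst).toFinset

theorem mem_fvars {U : List Fact} {i : ℕ} : i ∈ fvars U ↔ ∃ u ∈ U, u.1 = i := by simp [fvars]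

/-- The variables of a task. -/
def fvar (n : ℕ) (pre : List ℕ) (L : List Ln) : Finset ℕ :=
  (Finset.range n).filter fun v => v ∉ pre ∧ occ L v = true

/-- The invariant of a task. -/
structure FrameOK (n : ℕ) (c : Ctx) (G : List Raw) (pre : List ℕ) (x : ℕ) (L : List Ln)
    (lx : Option Cl) (U : List Fact) : Prop where
  preOK : pre <+: c.2
  all : upto c x <+: c.2
  sub : pre ⊆ upto c x
  notMem : x ∉ pre
  occ : occ L x = true
  gap : ∀ i ∈ upto c x, CDCL.occ L i = true → i ∈ pre ∨ i = x
  skel : ∃ val, Skel pre L val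
  der : ∀ C, (some (.inl C) : Ln) ∈ L → Der n G (fun v => CDCL.occ L v = true) pre C
  facts : ∀ u ∈ U, FactOK n G (fun v => CDCL.occ L v = true) (upto c x) u
  pair : ∀ u ∈ U, ∀ b, ∃ A, (u.1, b, A) ∈ U
  lxOK : ∀ X, lx = some X → FactOK n G (fun v => CDCL.occ L v = true) pre (x, true, X)
  card : U.length = 2 * (fvars U).card

theorem FrameOK.mono (h : FrameOK n c G pre x L lx U) {G' : List Raw} (hG : G ⊆ G') :
    FrameOK n c G' pre x L lx U :=
  { h with
    der := fun C hC => (h.der C hC).mono hG fun _ h => h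
    facts := fun u hu => (h.facts u hu).mono hG fun _ h => h
    lxOK := fun X hX => (h.lxOK X hX).mono hG fun _ h => h }

theorem mem_upto : x ∈ upto c x := by simp [upto]

theorem FrameOK.mem_fvar (h : FrameOK n c G pre x L lx U) {i : ℕ} :
    i ∈ fvar n pre L ↔ i ∉ pre ∧ CDCL.occ L i = true := by
  rw [fvar, Finset.mem_filter, Finset.mem_range]
  refine ⟨fun h => h.2, fun h' => ⟨?_, h'⟩⟩
  obtain ⟨C, hC, hn⟩ := occ_iff.1 h'.2
  exact lt_of_lit (h.der C hC).len hn

theorem FrameOK.mem_var (h : FrameOK n c G pre x L lx U) : x ∈ fvar n pre L :=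
  h.mem_fvar.2 ⟨h.notMem, h.occ⟩

theorem FrameOK.fvars_subset (h : FrameOK n c G pre x L lx U) :
    fvars U ⊆ (fvar n pre L).erase x := by
  intro i hi
  obtain ⟨u, hu, rfl⟩ := mem_fvars.1 hi
  have hf := h.facts u hu
  rw [Finset.mem_erase, h.mem_fvar]
  exact ⟨fun e => hf.notMem (e ▸ mem_upto), fun h' => hf.notMem (h.sub h'),
    hf.sup _ (by rw [hf.lit_eq]; simp)⟩

theorem FrameOK.length_le (h : FrameOK n c G pre x L lx U) : U.length ≤ 2 * n := by
  rw [h.card]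
  refine Nat.mul_le_mul_left _ ?_
  have h1 : fvars U ⊆ Finset.range n :=
    (h.fvars_subset.trans (Finset.erase_subset _ _)).trans (Finset.filter_subset _ _)
  simpa using Finset.card_le_card h1

/-- The number of variables for which facts are still to be learned. -/
def todo (n : ℕ) (pre : List ℕ) (x : ℕ) (L : List Ln) (U : List Fact) : ℕ :=
  ((fvar n pre L).erase x \ fvars U).card

/-- A new task is correct. -/
theorem frameOK_mkFrame (hc : CtxOK π c) {K : List ℕ} (hK : K <+: c.2) {val : ℕ → Cl}
    (hS : Skel K L val)
    (hd : ∀ C, (some (.inl C) : Ln) ∈ L → Der n G (fun v => occ L v = true) K C)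
    (hz : ∃ z ∉ K, occ L z = true) :
    ∃ x, mkFrame c K L = (K, x, L, none, []) ∧ FrameOK n c G K x L none [] := by
  obtain ⟨z, hzK, hz⟩ := hz
  have hzn : z < n := by
    obtain ⟨C, hC, hn⟩ := occ_iff.1 hz
    exact lt_of_lit (hd C hC).len hn
  have hmem : z ∈ c.2.filter fun v => !decide (v ∈ K) && occ L v := by
    simp [hc.mem, hzn, hzK, hz]
  cases hfl : c.2.filter fun v => !decide (v ∈ K) && occ L v with
  | nil => rw [hfl] at hmem; simp at hmem
  | cons x t =>
    refine ⟨x, by rw [mkFrame, hfl]; rfl, ?_⟩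
    obtain ⟨l₁, l₂, e, h1, h2, -⟩ := List.filter_eq_cons_iff.1 hfl
    simp only [Bool.and_eq_true, Bool.not_eq_eq_eq_not, Bool.not_true, decide_eq_false_iff_not]
      at h1 h2
    have hnd := hc.nodup
    rw [e] at hnd
    have hxl : x ∉ l₁ := fun h => (List.nodup_append.1 hnd).2.2 x h x (by simp) rfl
    have hup : upto c x = l₁ ++ [x] := by
      rw [upto, e, List.takeWhile_append_of_pos (by
        intro v hv
        simp only [Bool.not_eq_eq_eq_not, Bool.not_true, decide_eq_false_iff_not]
        rintro rfl
        exact hxl hv)]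
      simp
    have hall : upto c x <+: c.2 := ⟨l₂, by rw [hup, e]; simp⟩
    -- Two initial segments of the order are comparable, and `x` lies in only one of them.
    have hsub : K ⊆ upto c x := by
      rcases List.prefix_or_prefix_of_prefix hK hall with h | h
      · exact h.subset
      · exact absurd (h.subset mem_upto) h2.1
    refine ⟨hK, hall, hsub, h2.1, h2.2, ?_, ⟨val, hS⟩, hd, by simp, by simp, by simp, by
      simp [fvars]⟩
    intro i hi ho
    rw [hup, List.mem_append, List.mem_singleton] at hi
    rcases hi with hi | hi
    · left
      by_contra hiK
      exact h1 i hi ⟨hiK, ho⟩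
    · exact Or.inr hi

/-- The effect of stripping all facts of a task. -/
theorem FrameOK.strip_all (hc : CtxOK π c) (h : FrameOK n c G pre x L lx U) (hG : Good π τ G)
    {C : Cl} (hC : Der n G (fun v => CDCL.occ L v = true) (upto c x) C) (i : ℕ)
    (hi : i ∉ upto c x) :
    (i ∈ fvars U → lit (strip c (upto c x) U C).1 i = none) ∧
      (i ∉ fvars U → lit (strip c (upto c x) U C).1 i = lit C i) := by
  obtain ⟨-, -, s3, -⟩ := strip_spec hc h.all hG h.facts hC
  rw [s3 i hi]
  constructor
  · intro hiU
    obtain ⟨u, hu, rfl⟩ := mem_fvars.1 hiU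
    cases hl : lit C u.1 with
    | none => simp
    | some b =>
      obtain ⟨A, hA⟩ := h.pair u hu (!b)
      rw [if_pos ⟨_, hA, rfl, by simp⟩]
  · intro hiU
    rw [if_neg]
    rintro ⟨u, hu, rfl, -⟩
    exact hiU (mem_fvars.2 ⟨u, hu, rfl⟩)

/-- Both phases make the clauses usable under trails with `x = 0`. Before `x ^ 1` is known, the
axioms with `x ^ 0` are dropped, being satisfied by such trails; afterwards they are kept and `x ^
0` is resolved away. This is the difference between the two forms of `Reduct`. -/
theorem FrameOK.prep_spec (hc : CtxOK π c) (h : FrameOK n c G pre x L lx U) (hG : Good π τ G) :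
    Good π τ (G ++ prepE c (upto c x) (pre, x, L, lx, U)) ∧
    (∀ C, (some (.inl C) : Ln) ∈ prep c (upto c x) (pre, x, L, lx, U) →
      Der n (G ++ prepE c (upto c x) (pre, x, L, lx, U)) (fun v => CDCL.occ L v = true)
        (upto c x) C) ∧
    (lx = none → units c (upto c x) x true (prep c (upto c x) (pre, x, L, lx, U)) = [] →
      Reduct n (upto c x) x True false (fun i => i ∈ fvars U) L
        (prep c (upto c x) (pre, x, L, lx, U))) ∧
    (lx ≠ none → Reduct n (upto c x) x False false (fun i => i ∈ fvars U) L
        (prep c (upto c x) (pre, x, L, lx, U))) := by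
  set K := upto c x with hK
  rcases lx with _ | X
  · have e0 : prep0E c (pre, x, L, none, U) = [] := rfl
    have e1 : prep0 c (pre, x, L, none, U) = dropL x false L := rfl
    have e2 : prepE c K (pre, x, L, none, U) = stripE c K U (dropL x false L) := by
      rw [prepE, e0, e1]; rfl
    have e3 : prep c K (pre, x, L, none, U) = stripL c K U (dropL x false L) := by
      rw [prep, e1]
    rw [e2, e3]
    have hd : ∀ C, (some (.inl C) : Ln) ∈ dropL x false L →
        Der n G (fun v => CDCL.occ L v = true) K C := fun C hC =>
      (h.der C (mem_dropL.1 hC).1).raise h.gap (mem_dropL.1 hC).2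
    obtain ⟨g, d⟩ := stripE_spec hc h.all hG h.facts hd
    refine ⟨g, ?_, ?_, fun h' => absurd rfl h'⟩
    · intro C hC
      obtain ⟨C', h1, rfl⟩ := mem_stripL.1 hC
      exact d C' h1
    · intro _ hu
      refine ⟨?_, ?_, ?_, ?_⟩
      · rw [length_stripL, length_dropL]
      · exact fun v hv => getElem?_stripL_none (getElem?_dropL_none hv)
      · exact fun v q hv => getElem?_stripL_inr (getElem?_dropL_inr hv)
      · intro v C hv
        by_cases hx : lit C x = some false
        · exact Or.inl ⟨getElem?_stripL_none (getElem?_dropL_pos hv hx), trivial, hx⟩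
        · have hv' := getElem?_stripL_ax (c := c) (K := K) (us := U) (getElem?_dropL_neg hv hx)
          have hdC := hd C (List.mem_of_getElem? (getElem?_dropL_neg hv hx))
          obtain ⟨-, s2, -, s4⟩ := strip_spec hc h.all hG h.facts hdC
          refine Or.inr ⟨_, hv', fun _ => hx, fun _ hb hl => ?_, s2.len, h.strip_all hc hG hdC⟩
          -- Stripping loses no literal on `K` and produces no negative one there. So an axiom with
          -- `x ^ 1` that becomes blank still contains `x ^ 1`, and would be a unit.
          have : (strip c K U C).1 ∈ units c K x true (stripL c K U (dropL x false L)) := by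
            rw [mem_units, blank_iff hc s2.len]
            refine ⟨List.mem_of_getElem? hv', hb, ?_⟩
            have h1 := s4 x mem_upto (by rw [hl]; simp)
            have h2 := s2.nn x mem_upto
            cases h3 : lit (strip c K U C).1 x with
            | none => exact absurd h3 h1
            | some b =>
              rw [h3] at h2
              cases b <;> simp_all
          rw [hu] at this
          simp at this
  · have e0 : prep0E c (pre, x, L, some X, U) = stripE c pre [(x, true, X)] L := rfl
    have e1 : prep0 c (pre, x, L, some X, U) = stripL c pre [(x, true, X)] L := rfl
    have e2 : prepE c K (pre, x, L, some X, U) = stripE c pre [(x, true, X)] L ++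
        stripE c K U (stripL c pre [(x, true, X)] L) := by
      rw [prepE, e0, e1]
    have e3 : prep c K (pre, x, L, some X, U) = stripL c K U (stripL c pre [(x, true, X)] L) := by
      rw [prep, e1]
    rw [e2, e3]
    have hX := h.lxOK X rfl
    obtain ⟨g, d⟩ := stripE_spec hc h.preOK hG (singleton_fact hX) h.der
    have hlx : ∀ C, (some (.inl C) : Ln) ∈ L → ∀ i ∉ pre,
        lit (strip c pre [(x, true, X)] C).1 i =
          if i = x ∧ lit C i = some false then none else lit C i := by
      intro C hC i hi
      rw [(strip_spec hc h.preOK hG (singleton_fact hX) (h.der C hC)).2.2.1 i hi]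
      simp
    have hd : ∀ C, (some (.inl C) : Ln) ∈ stripL c pre [(x, true, X)] L →
        Der n (G ++ stripE c pre [(x, true, X)] L) (fun v => CDCL.occ L v = true) K C := by
      intro C hC
      obtain ⟨C', h1, rfl⟩ := mem_stripL.1 hC
      refine (d C' h1).raise h.gap ?_
      rw [hlx C' h1 x h.notMem]
      split_ifs with h'
      · simp
      · exact fun h2 => h' ⟨rfl, h2⟩
    have h' := h.mono (List.subset_append_left G (stripE c pre [(x, true, X)] L))
    obtain ⟨g', d'⟩ := stripE_spec hc h.all g h'.facts hd
    rw [← List.append_assoc]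
    refine ⟨g', ?_, fun h' => by simp at h', fun _ => ?_⟩
    · intro C hC
      obtain ⟨C', h1, rfl⟩ := mem_stripL.1 hC
      exact d' C' h1
    · refine ⟨?_, ?_, ?_, ?_⟩
      · rw [length_stripL, length_stripL]
      · exact fun v hv => getElem?_stripL_none (getElem?_stripL_none hv)
      · exact fun v q hv => getElem?_stripL_inr (getElem?_stripL_inr hv)
      · intro v C hv
        have hv1 := getElem?_stripL_ax (c := c) (K := pre) (us := [(x, true, X)]) hv
        have hv2 := getElem?_stripL_ax (c := c) (K := K) (us := U) hv1
        have hdC := hd _ (List.mem_of_getElem? hv1)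
        obtain ⟨-, s2, -, -⟩ := strip_spec hc h.all g h'.facts hdC
        refine Or.inr ⟨_, hv2, False.elim, False.elim, s2.len, fun i hi => ?_⟩
        have hix : i ≠ x := fun e => hi (e ▸ mem_upto)
        have hip : i ∉ pre := fun e => hi (h.sub e)
        have := h'.strip_all hc g hdC i hi
        refine ⟨this.1, fun hiU => (this.2 hiU).trans ?_⟩
        rw [hlx C (List.mem_of_getElem? hv) i hip, if_neg fun e => hix e.1]

end main

/-! ### One step of the algorithm and the number of steps of a task. -/

section main
variable {n : ℕ} {π : Equiv.Perm (Fin n)} {τ : CNF n} {c : Ctx} {pre : List ℕ} {x : ℕ}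
  {L : List Ln} {lx : Option Cl} {U : List Fact} {G : List Raw}

/-- A number of steps of the algorithm. -/
def steps (c : Ctx) (k : ℕ) (st : List Frame) : List Frame × List Raw :=
  foldEmit (fun st (_ : ℕ) => step c st) (fun st _ => stepE c st) (List.replicate k 0) st

theorem steps_zero (st : List Frame) : steps c 0 st = (st, []) := rfl

theorem steps_succ (k : ℕ) (st : List Frame) : steps c (k + 1) st =
    ((steps c k (step c st)).1, stepE c st ++ (steps c k (step c st)).2) := by
  rw [steps, List.replicate_succ, foldEmit_cons]; rfl

theorem steps_add (j k : ℕ) (st : List Frame) : steps c (j + k) st =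
    ((steps c k (steps c j st).1).1, (steps c j st).2 ++ (steps c k (steps c j st).1).2) := by
  induction j generalizing st with
  | zero => simp [steps_zero]
  | succ j ih =>
    rw [show j + 1 + k = j + k + 1 by omega, steps_succ, ih, steps_succ]
    simp

theorem foldEmit_steps (l : List ℕ) (st : List Frame) :
    foldEmit (fun st (_ : ℕ) => step c st) (fun st _ => stepE c st) l st = steps c l.length st := by
  induction l generalizing st with
  | nil => rfl
  | cons x l ih => rw [foldEmit_cons, ih, List.length_cons, steps_succ]

theorem steps_nil (k : ℕ) : steps c k [] = ([], []) := by
  induction k with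
  | zero => rfl
  | succ k ih =>
    have h1 : step c [] = [] := rfl
    have h2 : stepE c [] = [] := rfl
    rw [steps_succ, h1, h2, ih]
    rfl

/-- A blank axiom with `x ^ 1` only has variables in `K`, and by the gap condition these are `x` and
variables of `pre`. So it is a fact over `pre`. -/
theorem FrameOK.learnFirst (hc : CtxOK π c) (h : FrameOK n c G pre x L none U) (hG : Good π τ G)
    (hu : canSet c (upto c x) (pre, x, L, none, U) = true) :
    ∃ X, stepFrame c (upto c x) (pre, x, L, none, U) = (fun rest => (pre, x, L, some X, U) :: rest) ∧
      FrameOK n c (G ++ stepFrameE c (upto c x) (pre, x, L, none, U)) pre x L (some X) U ∧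
      Good π τ (G ++ stepFrameE c (upto c x) (pre, x, L, none, U)) := by
  obtain ⟨g, d, -, -⟩ := h.prep_spec hc hG
  have e : stepFrameE c (upto c x) (pre, x, L, none, U) =
      prepE c (upto c x) (pre, x, L, none, U) := by simp [stepFrameE, hu]
  rw [e]
  refine ⟨(units c (upto c x) x true (prep c (upto c x) (pre, x, L, none, U))).headD [], ?_, ?_, g⟩
  · funext rest
    simp [stepFrame, hu]
  · refine { h.mono (List.subset_append_left _ _) with lxOK := ?_ }
    intro X hX
    obtain rfl := Option.some.inj hX
    have hmem : (units c (upto c x) x true (prep c (upto c x) (pre, x, L, none, U))).headD [] ∈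
        units c (upto c x) x true (prep c (upto c x) (pre, x, L, none, U)) := by
      cases h : units c (upto c x) x true (prep c (upto c x) (pre, x, L, none, U)) with
      | nil => simp [canSet, h] at hu
      | cons a l => simp
    obtain ⟨h1, h2, h3⟩ := mem_units.1 hmem
    have hd := d _ h1
    rw [blank_iff hc hd.len] at h2
    refine factOK_of_der hd h.gap h.notMem h3 fun v hv hn => ⟨?_, hv⟩
    by_contra hvK
    exact hn (h2 v hvK)

/-- The subtask has variables of the current task only, and none of those with known facts, because
these have been stripped from the axioms it inherits. This gives the decrease in the count of steps.
-/
theorem FrameOK.push (hc : CtxOK π c) (h : FrameOK n c G pre x L lx U) (hG : Good π τ G)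
    (hu : canSet c (upto c x) (pre, x, L, lx, U) = false)
    (hcf : hasConf c (upto c x) (pre, x, L, lx, U) = true) :
    ∃ y L', stepFrame c (upto c x) (pre, x, L, lx, U) =
        (fun rest => (upto c x, y, L', none, []) :: (pre, x, L, lx, U) :: rest) ∧
      FrameOK n c (G ++ stepFrameE c (upto c x) (pre, x, L, lx, U)) (upto c x) y L' none [] ∧
      Good π τ (G ++ stepFrameE c (upto c x) (pre, x, L, lx, U)) ∧
      (∀ i : ℕ, CDCL.occ L' i = true → CDCL.occ L i = true) ∧
      fvar n (upto c x) L' ⊆ (fvar n pre L).erase x \ fvars U ∧ L'.length ≤ L.length := by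
  obtain ⟨g, d, r1, r2⟩ := h.prep_spec hc hG
  set K := upto c x with hK
  set P := prep c K (pre, x, L, lx, U) with hP
  have e : stepFrameE c K (pre, x, L, lx, U) = prepE c K (pre, x, L, lx, U) := by
    simp [stepFrameE, hu, hcf]
  rw [e]
  obtain ⟨val, hS⟩ := h.skel
  have hR : ∃ N, Reduct n K x N false (fun i => i ∈ fvars U) L P := by
    by_cases hlx : lx = none
    · refine ⟨True, r1 hlx ?_⟩
      rw [canSet, hlx] at hu
      rw [hlx] at hP
      simpa [hP] using hu
    · exact ⟨False, r2 hlx⟩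
  obtain ⟨N, hR⟩ := hR
  obtain ⟨hS', hax, hlen, q, hq, hne⟩ := hS.sub hc h.sub hR hcf
  set L' := prune ((before c K (evalAll c K P)).map fun e => e.1) (conf c K (evalAll c K P)).1
    with hL'
  have hocc : ∀ i, CDCL.occ L' i = true → CDCL.occ P i = true := by
    intro i hi
    obtain ⟨C, hC, hn⟩ := occ_iff.1 hi
    exact occ_iff.2 ⟨C, hax C hC, hn⟩
  have hocc' : ∀ i, CDCL.occ L' i = true → CDCL.occ L i = true := by
    intro i hi
    obtain ⟨C, hC, hn⟩ := occ_iff.1 (hocc i hi)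
    exact (d C hC).sup i hn
  -- The conflict is a genuine resolution step, so its pivot is a variable of the subtask outside
  -- `K`; the subtask is not empty.
  have hr := (hS'.inf _ q hq).resolve_left fun h => hne h.1
  have hz : ∃ z ∉ K, CDCL.occ L' z = true :=
    ⟨q.2.2.1, hr.notMem, hS'.occ q.1 (hS'.used _ q hq).1 _ (by rw [hr.litP]; simp)⟩
  obtain ⟨y, hy, hF⟩ := frameOK_mkFrame hc h.all hS' (L := L')
    (G := G ++ prepE c K (pre, x, L, lx, U)) (fun C hC =>
      ⟨(d C (hax C hC)).mem, (d C (hax C hC)).len, fun v hv => occ_iff.2 ⟨C, hC, hv⟩,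
        (d C (hax C hC)).nn⟩) hz
  refine ⟨y, L', ?_, hF, g, hocc', ?_, ?_⟩
  · funext rest
    simp only [stepFrame, hu, hcf, cond_true, cond_false, subFrame]
    rw [hy]
  · intro i hi
    obtain ⟨h1, h2⟩ := hF.mem_fvar.1 hi
    rw [Finset.mem_sdiff, Finset.mem_erase, h.mem_fvar]
    refine ⟨⟨fun e => h1 (e ▸ mem_upto), fun e => h1 (h.sub e), hocc' i h2⟩, ?_⟩
    intro hiU
    obtain ⟨C, hC, hn⟩ := occ_iff.1 h2
    exact hn (hR.lit_eq_none (hax C hC) h1 hiU)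
  · exact hlen

/-- Absence of a conflict means that the work over `K` is finished: the fact on `x` is known, and so
are facts of both signs for all other variables of the task. This is exactly what the search needs
for its replays. -/
theorem FrameOK.pop (hc : CtxOK π c) (h : FrameOK n c G pre x L lx U) (hG : Good π τ G)
    (hu : canSet c (upto c x) (pre, x, L, lx, U) = false)
    (hcf : hasConf c (upto c x) (pre, x, L, lx, U) = false) :
    ∃ F, stepFrame c (upto c x) (pre, x, L, lx, U) = addFacts F ∧
      Good π τ (G ++ stepFrameE c (upto c x) (pre, x, L, lx, U)) ∧
      (∀ u ∈ F, FactOK n (G ++ stepFrameE c (upto c x) (pre, x, L, lx, U))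
        (fun v => CDCL.occ L v = true) pre u) ∧
      (∀ z ∈ fvar n pre L, ∀ b, ∃ A, (z, b, A) ∈ F) ∧ (∀ u ∈ F, u.1 ∈ fvar n pre L) ∧
      F.length = 2 * (fvar n pre L).card := by
  obtain ⟨g, d, r1, r2⟩ := h.prep_spec hc hG
  set K := upto c x with hK
  set P := prep c K (pre, x, L, lx, U) with hP
  obtain ⟨val, hS⟩ := h.skel
  have hno := no_conf (c := c) (K := K) (L := P) (by
    rw [hasConf] at hcf
    rw [hcf]
    simp)
  have hxK : x ∈ K := mem_upto
  obtain ⟨C₀, hC₀, hn₀⟩ := occ_iff.1 h.occ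
  rcases lx with _ | X
  -- While axioms are being dropped, absence of units and conflicts would mean that `x` does not
  -- occur in the task.
  · exfalso
    have hR := r1 rfl (by simpa [canSet, hP] using hu)
    obtain ⟨v, hv⟩ := List.mem_iff_getElem?.1 hC₀
    exact hn₀ ((hS.of_noconf hc h.sub hxK h.notMem hR hno v C₀ hv).2 trivial)
  have hR := r2 (by simp)
  have hall : ∀ i ∉ K, CDCL.occ L i = true → i ∈ fvars U := by
    intro i hi ho
    obtain ⟨C, hC, hn⟩ := occ_iff.1 ho
    obtain ⟨v, hv⟩ := List.mem_iff_getElem?.1 hC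
    exact (hS.of_noconf hc h.sub hxK h.notMem hR hno v C hv).1 i hi hn
  -- Variables of the task in `K` are excluded by the gap condition, except `x` itself.
  have hvars : fvars U = (fvar n pre L).erase x := by
    refine h.fvars_subset.antisymm fun i hi => ?_
    rw [Finset.mem_erase, h.mem_fvar] at hi
    refine hall i (fun hiK => ?_) hi.2.2
    exact (h.gap i hiK hi.2.2).elim hi.2.1 hi.1
  have e : stepFrameE c K (pre, x, L, some X, U) =
      prepE c K (pre, x, L, some X, U) ++ popE c K (pre, x, L, some X, U) := by
    simp [stepFrameE, hu, hcf]
  set G1 := G ++ prepE c K (pre, x, L, some X, U) with hG1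
  have h1 := h.mono (List.subset_append_left G (prepE c K (pre, x, L, some X, U)))
  obtain ⟨g2, hXb⟩ := search_spec hc h.preOK h.all h.sub hxK h.notMem hS h.gap h.occ
    (h1.lxOK X rfl) (fun w hw hwK b => by
      obtain ⟨u, hu, rfl⟩ := mem_fvars.1 (hall w hwK hw)
      obtain ⟨A, hA⟩ := h.pair u hu b
      exact ⟨A, h1.facts _ hA⟩) g h1.der
  set S := search c pre K x X L with hSd
  have h2 := h1.mono (List.subset_append_left G1 S.2)
  obtain ⟨g3, hF⟩ := newFacts_spec hc h.preOK h.sub hxK h.notMem h.gap (h2.lxOK X rfl) hXb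
    h2.facts g2
  have e' : popE c K (pre, x, L, some X, U) = S.2 ++ newFactsE c pre x (foundCl S) U := rfl
  rw [e, e', ← List.append_assoc, ← List.append_assoc]
  refine ⟨newFacts c pre x X (foundCl S) U, ?_, g3, hF, ?_, ?_, ?_⟩
  · funext rest
    simp only [stepFrame, hu, hcf, cond_false]
    rfl
  · intro z hz b
    by_cases hzx : z = x
    · subst hzx
      cases b
      · exact ⟨foundCl S, by simp [newFacts]⟩
      · exact ⟨X, by simp [newFacts]⟩
    · have : z ∈ fvars U := by rw [hvars]; exact Finset.mem_erase.2 ⟨hzx, hz⟩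
      obtain ⟨u, hu, rfl⟩ := mem_fvars.1 this
      obtain ⟨A, hA⟩ := h.pair u hu b
      exact ⟨_, List.mem_append_left _ (List.mem_map.2 ⟨_, hA, rfl⟩)⟩
  · intro u hu
    simp only [newFacts, List.mem_append, List.mem_map, List.mem_cons, List.not_mem_nil,
      or_false] at hu
    rcases hu with ⟨u, hu, rfl⟩ | rfl | rfl
    · exact Finset.erase_subset _ _ (h.fvars_subset (mem_fvars.2 ⟨u, hu, rfl⟩))
    · exact h.mem_var
    · exact h.mem_var
  · have h3 := Finset.card_erase_add_one h.mem_var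
    rw [← hvars] at h3
    simp only [newFacts, List.length_append, List.length_map, h.card, List.length_cons,
      List.length_nil]
    omega

theorem step_cons (f : Frame) (rest : List Frame) :
    step c (f :: rest) = stepFrame c (upto c f.2.1) f rest := rfl

theorem stepE_cons (f : Frame) (rest : List Frame) :
    stepE c (f :: rest) = stepFrameE c (upto c f.2.1) f := rfl

/-- A task is completed in at most `3 |V| - 1` steps if `V` is the set of its variables. -/
theorem FrameOK.complete (hc : CtxOK π c) {R : ℕ} (μ : ℕ) (h : FrameOK n c G pre x L lx U)
    (hG : Good π τ G) (hL : L.length ≤ R)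
    (hμ : 3 * todo n pre x L U + (if lx = none then 2 else 1) ≤ μ) (rest : List Frame) :
    ∃ k F, k ≤ 3 * todo n pre x L U + (if lx = none then 2 else 1) ∧
      (steps c k ((pre, x, L, lx, U) :: rest)).1 = addFacts F rest ∧
      Good π τ (G ++ (steps c k ((pre, x, L, lx, U) :: rest)).2) ∧
      (∀ u ∈ F, FactOK n (G ++ (steps c k ((pre, x, L, lx, U) :: rest)).2)
        (fun v => CDCL.occ L v = true) pre u) ∧
      (∀ z ∈ fvar n pre L, ∀ b, ∃ A, (z, b, A) ∈ F) ∧ (∀ u ∈ F, u.1 ∈ fvar n pre L) ∧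
      F.length = 2 * (fvar n pre L).card ∧
      (steps c k ((pre, x, L, lx, U) :: rest)).2.length ≤ k * stepBound n R := by
  induction μ using Nat.strong_induction_on generalizing G pre x L lx U rest with
  | _ μ ih =>
  have hlen := length_stepFrameE hc h.all h.preOK x L lx U hL h.length_le
  by_cases hu : canSet c (upto c x) (pre, x, L, lx, U) = true
  · have hlx : lx = none := by
      rcases lx with _ | X
      · rfl
      · simp [canSet] at hu
    subst hlx
    obtain ⟨X, e, hF, hG'⟩ := h.learnFirst hc hG hu
    rw [if_pos rfl] at hμ ⊢
    obtain ⟨k, F, p1, p2, p3, p4, p5, p6, p7, p8⟩ := ih (μ - 1) (by omega) hF hG' hL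
      (by rw [if_neg (by simp)]; omega) rest
    rw [if_neg (by simp)] at p1
    refine ⟨k + 1, F, by omega, ?_⟩
    rw [steps_succ, step_cons, stepE_cons]
    simp only [e]
    rw [← List.append_assoc, List.length_append, add_mul]
    exact ⟨p2, p3, p4, p5, p6, p7, by omega⟩
  rw [Bool.not_eq_true] at hu
  by_cases hcf : hasConf c (upto c x) (pre, x, L, lx, U) = true
  · obtain ⟨y, L', e, hF, hG', hocc, hsub, hlL⟩ := h.push hc hG hu hcf
    set f : Frame := (pre, x, L, lx, U) with hf
    have ht1 : todo n (upto c x) y L' [] + 1 = (fvar n (upto c x) L').card := by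
      rw [todo]
      simp only [fvars, List.map_nil, List.toFinset_nil, Finset.sdiff_empty]
      exact Finset.card_erase_add_one hF.mem_var
    have ht2 : (fvar n (upto c x) L').card ≤ todo n pre x L U := Finset.card_le_card hsub
    have hlx : 1 ≤ (if lx = none then 2 else 1) := by split_ifs <;> omega
    obtain ⟨k, F, p1, p2, p3, p4, p5, p6, p7, p8⟩ :=
      ih (3 * todo n (upto c x) y L' [] + 2) (by omega) hF hG' (hlL.trans hL) (by simp)
        (f :: rest)
    rw [if_pos rfl] at p1
    set s₁ := steps c k ((upto c x, y, L', none, []) :: f :: rest) with hs₁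
    set G₁ := G ++ stepFrameE c (upto c x) f ++ s₁.2 with hG₁
    have hsub₁ : G ⊆ G₁ := fun a ha => by simp [hG₁, ha]
    have hst : addFacts F (f :: rest) = (pre, x, L, lx, F ++ U) :: rest := rfl
    have hfv : fvars (F ++ U) = fvar n (upto c x) L' ∪ fvars U := by
      ext i
      simp only [Finset.mem_union, mem_fvars, List.mem_append]
      constructor
      · rintro ⟨u, hu | hu, rfl⟩
        · exact Or.inl (p6 u hu)
        · exact Or.inr ⟨u, hu, rfl⟩
      · rintro (hi | ⟨u, hu, rfl⟩)
        · obtain ⟨A, hA⟩ := p5 i hi true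
          exact ⟨_, Or.inl hA, rfl⟩
        · exact ⟨u, Or.inr hu, rfl⟩
    have hdisj : Disjoint (fvar n (upto c x) L') (fvars U) :=
      Finset.disjoint_of_subset_left hsub Finset.sdiff_disjoint
    have hF' : FrameOK n c G₁ pre x L lx (F ++ U) :=
      { h.mono hsub₁ with
        facts := fun u hu => by
          rcases List.mem_append.1 hu with hu | hu
          · exact (p4 u hu).mono (fun _ h => h) hocc
          · exact (h.facts u hu).mono hsub₁ fun _ h => h
        pair := fun u hu b => by
          rcases List.mem_append.1 hu with hu | hu
          · obtain ⟨A, hA⟩ := p5 u.1 (p6 u hu) b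
            exact ⟨A, List.mem_append_left _ hA⟩
          · obtain ⟨A, hA⟩ := h.pair u hu b
            exact ⟨A, List.mem_append_right _ hA⟩
        card := by
          rw [List.length_append, p7, h.card, hfv, Finset.card_union_of_disjoint hdisj]
          ring }
    have ht3 : todo n pre x L (F ++ U) + (fvar n (upto c x) L').card = todo n pre x L U := by
      rw [todo, todo, hfv, Finset.union_comm, ← Finset.sup_eq_union, ← sdiff_sdiff,
        Finset.card_sdiff_add_card_eq_card hsub]
    -- The same task goes on with more facts; `V'` is nonempty, so the measure has dropped.
    obtain ⟨k', F', q1, q2, q3, q4, q5, q6, q7, q8⟩ :=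
      ih (3 * todo n pre x L (F ++ U) + (if lx = none then 2 else 1)) (by omega) hF' p3 hL le_rfl
        rest
    have e1 : steps c (k + k' + 1) (f :: rest) =
        ((steps c k' ((pre, x, L, lx, F ++ U) :: rest)).1,
          stepFrameE c (upto c x) f ++ (s₁.2 ++
            (steps c k' ((pre, x, L, lx, F ++ U) :: rest)).2)) := by
      rw [steps_succ, steps_add, step_cons, stepE_cons, ← hst, ← p2, hs₁]
      simp only [hf] at e ⊢
      rw [e]
    have e2 : G ++ (steps c (k + k' + 1) (f :: rest)).2 =
        G₁ ++ (steps c k' ((pre, x, L, lx, F ++ U) :: rest)).2 := by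
      rw [e1, hG₁]
      simp
    refine ⟨k + k' + 1, F', by omega, by rw [e1]; exact q2, by rw [e2]; exact q3,
      by rw [e2]; exact q4, q5, q6, q7, ?_⟩
    rw [e1]
    simp only [List.length_append]
    rw [add_mul, add_mul]
    omega
  · rw [Bool.not_eq_true] at hcf
    obtain ⟨F, e, p1, p2, p3, p4, p5⟩ := h.pop hc hG hu hcf
    refine ⟨1, F, by split_ifs <;> omega, ?_⟩
    rw [steps_succ, steps_zero, step_cons, stepE_cons]
    simp only [e, List.append_nil, one_mul]
    exact ⟨trivial, p1, p2, p3, p4, p5, hlen⟩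

end main

/-! ### The number of variables -/

section graph
variable {n : ℕ} {τ : CNF n} {Pf : ResProof n}

theorem IsParent.lt (h : IsResProof τ Pf) {u v : ℕ} (huv : IsParent Pf u v) :
    u < v ∧ v < Pf.length := by
  obtain ⟨C, j, k, hv, hu⟩ := huv
  have := h v C _ hv
  refine ⟨?_, (List.getElem?_eq_some_iff.1 hv).1⟩
  rcases hu with rfl | rfl
  · exact this.1
  · exact this.2.1

theorem NodeLT.lt (h : IsResProof τ Pf) {u v : ℕ} (huv : NodeLT Pf u v) :
    u < v ∧ v < Pf.length := by
  induction huv with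
  | single h' => exact h'.lt h
  | tail _ h' ih => exact ⟨ih.1.trans (h'.lt h).1, (h'.lt h).2⟩

/-- Edges go forward, so the last line is a sink. By uniqueness it is the only one, and every other
line is used somewhere. -/
theorem exists_isParent (h : IsResProof τ Pf) (hc : IsConnected Pf) {v : ℕ}
    (hv : v < Pf.length - 1) : ∃ w, IsParent Pf v w := by
  have h1 : Pf.length - 1 ∈ maxNodes Pf :=
    ⟨by omega, fun u hu h' => by have := (h'.lt h).1; omega⟩
  obtain ⟨s, -, hs⟩ := hc
  have h2 : v ∉ maxNodes Pf := fun h' => by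
    have := (hs v h').trans (hs _ h1).symm
    omega
  have h3 : ∃ u, NodeLT Pf v u := by
    by_contra h'
    push Not at h'
    exact h2 ⟨by omega, fun u _ => h' u⟩
  obtain ⟨u, hu⟩ := h3
  rcases Relation.TransGen.head'_iff.1 hu with ⟨w, hw, -⟩
  exact ⟨w, hw⟩

/-- In a connected proof, all lines are used for the last one. -/
theorem connected_induction (h : IsResProof τ Pf) (hc : IsConnected Pf) (S : ℕ → Prop)
    (h0 : S (Pf.length - 1)) (hS : ∀ u v, S v → IsParent Pf u v → S u) (v : ℕ)
    (hv : v < Pf.length) : S v := by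
  obtain ⟨d, hd⟩ : ∃ d, Pf.length - 1 - v = d := ⟨_, rfl⟩
  induction d using Nat.strong_induction_on generalizing v with
  | _ d ih =>
  rcases (by omega : v = Pf.length - 1 ∨ v < Pf.length - 1) with rfl | h'
  · exact h0
  · obtain ⟨w, hw⟩ := exists_isParent h hc h'
    have := hw.lt h
    exact hS v w (ih _ (by omega) w (by omega) rfl) hw

/-- The empty clause contains no pivot and hence is never a premise, whereas every line but the last
one is. -/
theorem last_eq_empty (h : IsRefutation τ Pf) (hc : IsConnected Pf) :
    ∃ jst, Pf[Pf.length - 1]? = some (Clause.empty n, jst) := by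
  obtain ⟨h, ⟨C, jst⟩, hL, rfl⟩ := h
  obtain ⟨v, hv⟩ := List.mem_iff_getElem?.1 hL
  have hvl := (List.getElem?_eq_some_iff.1 hv).1
  rcases (by omega : v = Pf.length - 1 ∨ v < Pf.length - 1) with rfl | h'
  · exact ⟨jst, hv⟩
  · exfalso
    obtain ⟨w, D, j, k, hw, hjk⟩ := exists_isParent h hc h'
    obtain ⟨-, -, P, Q, jP, jQ, i, a, hP, hQ, h1, h2, -⟩ := h w D _ hw
    rcases hjk with rfl | rfl
    · rw [hP] at hv
      rw [(Prod.mk.inj (Option.some.inj hv)).1] at h1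
      simp [Clause.empty] at h1
    · rw [hQ] at hv
      rw [(Prod.mk.inj (Option.some.inj hv)).1] at h2
      simp [Clause.empty] at h2

/-- The clause contains one of the literals in `Λ`. -/
def Clause.Sat (Λ : Set (Lit n)) (C : Clause n) : Prop := ∃ l ∈ C.1, l ∈ Λ

/-- The clause contains no variable of the literals in `Λ`. -/
def Clause.Untouched (Λ : Set (Lit n)) (C : Clause n) : Prop := ∀ l ∈ C.1, ∀ a, (l.1, a) ∉ Λ

/-- If a satisfied premise loses its true literal, this was the pivot. Then the other premise is
touched, hence satisfied, and not by the complementary pivot literal, so its true literal survives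
in the resolvent. -/
theorem autarky_resolvent {Λ : Set (Lit n)} (hΛ : ∀ i a, (i, a) ∈ Λ → (i, !a) ∉ Λ)
    {P Q R : Clause n} {i : Fin n} {a : Bool} (h : IsResolvent i a P Q R)
    (hP : P.Sat Λ ∨ P.Untouched Λ) (hQ : Q.Sat Λ ∨ Q.Untouched Λ) :
    (R.Sat Λ ∨ R.Untouched Λ) ∧ (¬ R.Sat Λ → ¬ P.Sat Λ ∧ ¬ Q.Sat Λ) := by
  obtain ⟨h1, h2, h3⟩ := h
  have memP : ∀ l ∈ P.1, l ≠ (i, a) → l ∈ R.1 := fun l hl hn => by simp [h3, hl, hn]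
  have memQ : ∀ l ∈ Q.1, l ≠ (i, !a) → l ∈ R.1 := fun l hl hn => by simp [h3, hl, hn]
  have hPR : P.Sat Λ → R.Sat Λ := by
    rintro ⟨l, hl, hlΛ⟩
    by_cases e : l = (i, a)
    · subst e
      rcases hQ with ⟨m, hm, hmΛ⟩ | hQ
      · exact ⟨m, memQ m hm fun e => hΛ i a hlΛ (e ▸ hmΛ), hmΛ⟩
      · exact absurd hlΛ (hQ _ h2 a)
    · exact ⟨l, memP l hl e, hlΛ⟩
  have hQR : Q.Sat Λ → R.Sat Λ := by
    rintro ⟨l, hl, hlΛ⟩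
    by_cases e : l = (i, !a)
    · subst e
      rcases hP with ⟨m, hm, hmΛ⟩ | hP
      · refine ⟨m, memP m hm fun e => ?_, hmΛ⟩
        have := hΛ i (!a) hlΛ
        rw [Bool.not_not] at this
        exact this (e ▸ hmΛ)
      · exact absurd hlΛ (hP _ h1 _)
    · exact ⟨l, memQ l hl e, hlΛ⟩
  refine ⟨?_, fun hR => ⟨fun h => hR (hPR h), fun h => hR (hQR h)⟩⟩
  by_cases hR : R.Sat Λ
  · exact Or.inl hR
  · right
    have hP' := hP.resolve_left fun h => hR (hPR h)
    have hQ' := hQ.resolve_left fun h => hR (hQR h)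
    intro l hl
    rw [h3, Finset.mem_union] at hl
    rcases hl with hl | hl
    · exact hP' l (Finset.mem_of_mem_erase hl)
    · exact hQ' l (Finset.mem_of_mem_erase hl)

/-- In a connected refutation, no axiom is satisfied by an assignment that satisfies all axioms that
it touches. -/
theorem not_sat_of_autarky (h : IsRefutation τ Pf) (hc : IsConnected Pf) {Λ : Set (Lit n)}
    (hΛ : ∀ i a, (i, a) ∈ Λ → (i, !a) ∉ Λ)
    (hax : ∀ C : Clause n, (C, none) ∈ Pf → C.Sat Λ ∨ C.Untouched Λ) (C : Clause n)
    (hC : (C, none) ∈ Pf) : ¬ C.Sat Λ := by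
  have key : ∀ (v : ℕ) (D : Clause n) (jst : Option (ℕ × ℕ)), Pf[v]? = some (D, jst) → D.Sat Λ ∨ D.Untouched Λ := by
    intro v
    induction v using Nat.strong_induction_on with
    | _ v ih =>
    intro D jst hv
    have := h.1 v D jst hv
    rcases jst with _ | ⟨j, k⟩
    · exact hax D (List.mem_of_getElem? hv)
    · obtain ⟨hj, hk, P, Q, jP, jQ, i, a, hP, hQ, hr⟩ := this
      exact (autarky_resolvent hΛ hr (ih j hj P jP hP) (ih k hk Q jQ hQ)).1
  have hall := connected_induction h.1 hc
    (fun v => ∀ (D : Clause n) (jst : Option (ℕ × ℕ)), Pf[v]? = some (D, jst) → ¬ D.Sat Λ) (by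
      obtain ⟨jst, hl⟩ := last_eq_empty h hc
      intro D jst' hD
      rw [hl] at hD
      rw [← (Prod.mk.inj (Option.some.inj hD)).1]
      rintro ⟨l, hl, -⟩
      simp [Clause.empty] at hl) (by
      rintro u v hv ⟨D, j, k, hD, hu⟩ E jst hE
      obtain ⟨hj, hk, P, Q, jP, jQ, i, a, hP, hQ, hr⟩ := h.1 v D _ hD
      have := (autarky_resolvent hΛ hr (key j P jP hP) (key k Q jQ hQ)).2 (hv D _ hD)
      rcases hu with rfl | rfl
      · rw [hP] at hE
        rw [← (Prod.mk.inj (Option.some.inj hE)).1]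
        exact this.1
      · rw [hQ] at hE
        rw [← (Prod.mk.inj (Option.some.inj hE)).1]
        exact this.2)
  obtain ⟨v, hv⟩ := List.mem_iff_getElem?.1 hC
  exact hall v (List.getElem?_eq_some_iff.1 hv).1 C none hv

theorem mem_clause_vars {C : Clause n} {i : Fin n} : i ∈ C.vars ↔ ∃ a, (i, a) ∈ C.1 := by
  simp [Clause.vars]

/-- The axioms of a connected refutation have at least as many elements as variables. -/
theorem card_biUnion_vars_le (h : IsRefutation τ Pf) (hc : IsConnected Pf) (A : Finset (Clause n))
    (hA : ∀ C, C ∈ A ↔ (C, none) ∈ Pf) : (A.biUnion Clause.vars).card ≤ A.card := by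
  classical
  -- A largest set of axioms with at least as many clauses as variables. If it were not all of `A`,
  -- the rest could be satisfied without touching it.
  obtain ⟨S, hS, hmax⟩ := Finset.exists_max_image
    (A.powerset.filter fun S => (S.biUnion Clause.vars).card ≤ S.card) Finset.card
    ⟨∅, by simp⟩
  rw [Finset.mem_filter, Finset.mem_powerset] at hS
  obtain ⟨hSA, hS⟩ := hS
  by_cases hB : A \ S = ∅
  · rwa [Finset.Subset.antisymm hSA (Finset.sdiff_eq_empty_iff_subset.1 hB)] at hS
  exfalso
  -- Hall's condition for matching the remaining axioms with variables outside `S`. A set `T` that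
  -- violates it could be added to `S`, against maximality.
  have hall : ∀ T : Finset {C // C ∈ A \ S},
      T.card ≤ (T.biUnion fun C => Clause.vars C.1 \ S.biUnion Clause.vars).card := by
    intro T
    rcases T.eq_empty_or_nonempty with rfl | ⟨C₀, hC₀⟩
    · simp
    set T' : Finset (Clause n) := T.map (Function.Embedding.subtype _) with hT'
    have hT'B : T' ⊆ A \ S := by
      intro C hC
      obtain ⟨D, -, rfl⟩ := Finset.mem_map.1 hC
      exact D.2
    have hdisj : Disjoint S T' :=
      (Finset.disjoint_of_subset_left hT'B Finset.sdiff_disjoint).symm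
    have hcard : T'.card = T.card := Finset.card_map _
    have hpos : 0 < T.card := Finset.card_pos.2 ⟨C₀, hC₀⟩
    by_contra hlt
    push Not at hlt
    have hsub : (S ∪ T').biUnion Clause.vars ⊆ S.biUnion Clause.vars ∪
        T.biUnion fun C => Clause.vars C.1 \ S.biUnion Clause.vars := by
      intro i hi
      rw [Finset.union_biUnion, Finset.mem_union] at hi
      by_cases hiS : i ∈ S.biUnion Clause.vars
      · exact Finset.mem_union_left _ hiS
      · refine Finset.mem_union_right _ ?_
        obtain ⟨C, hC, hiC⟩ := Finset.mem_biUnion.1 (hi.resolve_left hiS)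
        obtain ⟨D, hD, rfl⟩ := Finset.mem_map.1 hC
        exact Finset.mem_biUnion.2 ⟨D, hD, Finset.mem_sdiff.2 ⟨hiC, hiS⟩⟩
    have h1 := (Finset.card_le_card hsub).trans (Finset.card_union_le _ _)
    have h2 : (S ∪ T').card = S.card + T'.card := Finset.card_union_of_disjoint hdisj
    have h3 := hmax (S ∪ T') (by
      rw [Finset.mem_filter, Finset.mem_powerset]
      exact ⟨Finset.union_subset hSA (hT'B.trans Finset.sdiff_subset), by omega⟩)
    omega
  obtain ⟨g, hg, hgm⟩ := (Finset.all_card_le_biUnion_card_iff_exists_injective _).1 hall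
  -- Each remaining clause has its matched variable set so as to satisfy it. Distinct clauses have
  -- distinct variables, so the assignment is consistent; it does not touch the clauses in `S`.
  set Λ : Set (Lit n) := {l | ∃ C, g C = l.1 ∧ l ∈ C.1.1} with hΛd
  have hΛ : ∀ i a, (i, a) ∈ Λ → (i, !a) ∉ Λ := by
    rintro i a ⟨C, h1, h2⟩ ⟨D, h3, h4⟩
    have : C = D := hg (h1.trans h3.symm)
    subst this
    have := C.1.2 i
    cases a <;> simp_all
  have hsat : ∀ C, ∀ hC : C ∈ A \ S, C.Sat Λ := by
    intro C hC
    have h1 := hgm ⟨C, hC⟩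
    rw [Finset.mem_sdiff, mem_clause_vars] at h1
    obtain ⟨⟨a, ha⟩, -⟩ := h1
    exact ⟨_, ha, ⟨C, hC⟩, rfl, ha⟩
  obtain ⟨C, hC⟩ := Finset.nonempty_iff_ne_empty.2 hB
  refine not_sat_of_autarky h hc hΛ ?_ C ((hA C).1 (Finset.mem_sdiff.1 hC).1) (hsat C hC)
  intro D hD
  by_cases hDS : D ∈ S
  · right
    rintro ⟨i, b⟩ hl a ⟨C, h1, -⟩
    have := (Finset.mem_sdiff.1 (hgm C)).2
    rw [h1] at this
    exact this (Finset.mem_biUnion.2 ⟨D, hDS, mem_clause_vars.2 ⟨b, hl⟩⟩)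
  · exact Or.inl (hsat D (Finset.mem_sdiff.2 ⟨(hA D).2 hD, hDS⟩))

end graph

/-! ### The given refutation -/

section input
variable {n : ℕ} {π : Equiv.Perm (Fin n)} {τ : CNF n} {Pf : ResProof n} {c : Ctx}

/-- The list of the signs of the variables in a clause. -/
def signs (C : Clause n) : Cl := List.ofFn fun i : Fin n =>
  if (i, true) ∈ C.1 then some true else if (i, false) ∈ C.1 then some false else none

theorem length_signs (C : Clause n) : (signs C).length = n := by simp [signs]

theorem lit_signs {C : Clause n} {i : Fin n} {a : Bool} :
    lit (signs C) i = some a ↔ (i, a) ∈ C.1 := by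
  have h := C.2 i
  rw [lit, List.getD_eq_getElem _ _ (by simp [signs])]
  simp only [signs, List.getElem_ofFn, Fin.eta]
  cases a
  · by_cases h1 : (i, true) ∈ C.1 <;> by_cases h2 : (i, false) ∈ C.1 <;> simp_all
  · by_cases h1 : (i, true) ∈ C.1 <;> by_cases h2 : (i, false) ∈ C.1 <;> simp_all

theorem lit_signs_ne_none {C : Clause n} {i : Fin n} :
    lit (signs C) i ≠ none ↔ i ∈ C.vars := by
  rw [mem_clause_vars, Option.ne_none_iff_exists']
  exact exists_congr fun a => lit_signs

theorem toClause_signs (C : Clause n) : toClause n (signs C) = C := by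
  ext ⟨i, a⟩
  rw [mem_toClause, lit_signs]

theorem getElem?_enum {α : Type} (l : List α) (v : ℕ) :
    (enum l)[v]? = l[v]?.map fun x => (v, x) := by
  induction l using List.reverseRecOn with
  | nil => rfl
  | append_singleton l x ih =>
    have hl : (enum l).length = l.length := by
      have := congrArg List.length (enum_map_fst l)
      simpa using this
    rw [enum_append_singleton]
    rcases lt_trichotomy v l.length with h | rfl | h
    · rw [List.getElem?_append_left (by omega), List.getElem?_append_left h, ih]
    · rw [List.getElem?_append_right (by omega), List.getElem?_append_right le_rfl]
      simp [hl]
    · rw [List.getElem?_eq_none (by simp; omega), List.getElem?_eq_none (by simp; omega)]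
      rfl

/-- The second list contains, for each position in turn, the variable at that position; so it lists
the values of the inverse permutation. -/
theorem mkCtx_ok (π : Equiv.Perm (Fin n)) :
    CtxOK π (mkCtx (List.ofFn fun i : Fin n => (π i : ℕ))) := by
  set ps := List.ofFn fun i : Fin n => (π i : ℕ) with hps
  have hlen : ps.length = n := by simp [hps]
  have hfst : (enum ps).map (fun p => p.1) = List.range n := by rw [← hlen]; exact enum_map_fst ps
  have hmem : ∀ r, r ∈ enum ps ↔ ∃ i : Fin n, r = ((i : ℕ), (π i : ℕ)) := by
    rintro ⟨v, p⟩
    rw [List.mem_iff_getElem?]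
    simp only [getElem?_enum, Option.map_eq_some_iff, Prod.mk.injEq]
    constructor
    · rintro ⟨w, q, hq, rfl, rfl⟩
      obtain ⟨hw, rfl⟩ := List.getElem?_eq_some_iff.1 hq
      exact ⟨⟨w, hlen ▸ hw⟩, rfl, by simp [hps]⟩
    · rintro ⟨i, rfl, rfl⟩
      exact ⟨i, _, by simp [hps], rfl, rfl⟩
  have hinv : ∀ p : Fin n, (((enum ps).filter fun r => decide (r.2 = (p : ℕ))).map
      fun r => r.1).headD 0 = (π.symm p : ℕ) := by
    intro p
    set l := ((enum ps).filter fun r => decide (r.2 = (p : ℕ))).map fun r => r.1 with hl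
    have h1 : ∀ v, v ∈ l ↔ v = (π.symm p : ℕ) := by
      intro v
      simp only [hl, List.mem_map, List.mem_filter, hmem, decide_eq_true_eq]
      constructor
      · rintro ⟨_, ⟨⟨i, rfl⟩, h⟩, rfl⟩
        rw [← Fin.ext (a := π i) (b := p) h]
        simp
      · rintro rfl
        exact ⟨_, ⟨⟨π.symm p, rfl⟩, by simp⟩, rfl⟩
    cases h : l with
    | nil => have := (h1 (π.symm p : ℕ)).2 rfl; rw [h] at this; simp at this
    | cons a t => exact (h1 a).1 (by rw [h]; simp)
  have h2 : (mkCtx ps).2 = List.ofFn fun p : Fin n => (π.symm p : ℕ) := by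
    change (enum ps).map (fun p => _) = _
    have : (enum ps).map (fun p => (((enum ps).filter fun r => decide (r.2 = p.1)).map
        fun r => r.1).headD 0) = ((enum ps).map fun p => p.1).map fun p =>
        (((enum ps).filter fun r => decide (r.2 = p)).map fun r => r.1).headD 0 := by
      rw [List.map_map]; rfl
    rw [this, hfst]
    refine List.ext_getElem (by simp) fun i h1 h2 => ?_
    simp only [List.getElem_map, List.getElem_range, List.getElem_ofFn]
    exact hinv ⟨i, by simpa using h1⟩
  refine ⟨hfst, ?_, ?_⟩
  · intro v
    rw [h2, List.mem_ofFn]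
    constructor
    · rintro ⟨p, rfl⟩
      exact (π.symm p).2
    · intro hv
      exact ⟨π ⟨v, hv⟩, by simp⟩
  · rw [h2, List.pairwise_ofFn]
    intro i j hij
    simpa [pos] using hij

/-- The skeleton of a proof. -/
def skeleton (c : Ctx) (Pf : ResProof n) : List Ln :=
  mkLines c (Pf.map fun l => (signs l.1, l.2))

theorem length_skeleton : (skeleton c Pf).length = Pf.length := by simp [skeleton, mkLines]

theorem skeleton_ax {v : ℕ} {C : Clause n} (h : Pf[v]? = some (C, none)) :
    (skeleton c Pf)[v]? = some (some (.inl (signs C))) := by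
  simp [skeleton, mkLines, h]

/-- The input does not name the pivot. It can be recovered because the resolvent is a clause: two
premises clashing on a second variable would put both of its literals into the resolvent. -/
theorem skeleton_inf (hc : CtxOK π c) {v j k : ℕ} {C P Q : Clause n} {jP jQ : Option (ℕ × ℕ)}
    {i : Fin n} {a : Bool} (h : Pf[v]? = some (C, some (j, k))) (hP : Pf[j]? = some (P, jP))
    (hQ : Pf[k]? = some (Q, jQ)) (hr : IsResolvent i a P Q C) :
    (skeleton c Pf)[v]? = some (some (.inr (j, k, (i : ℕ), a))) := by
  have e : ∀ {u : ℕ} {D : Clause n} {jD}, Pf[u]? = some (D, jD) →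
      (Pf.map fun l => (signs l.1, l.2)).getD u ([], none) = (signs D, jD) := by
    intro u D jD hu
    rw [List.getD_eq_getElem?_getD, List.getElem?_map, hu]
    rfl
  have hp : pivot c (signs P) (signs Q) = i := by
    rw [pivot]
    set l := c.1.filter fun i => (decide (lit (signs P) i = some true) &&
      decide (lit (signs Q) i = some false)) || (decide (lit (signs P) i = some false) &&
      decide (lit (signs Q) i = some true)) with hl
    have h1 : ∀ v, v ∈ l ↔ v = (i : ℕ) := by
      intro v
      simp only [hl, hc.vs, List.mem_filter, List.mem_range, Bool.or_eq_true, Bool.and_eq_true,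
        decide_eq_true_eq]
      constructor
      · rintro ⟨hv, hh⟩
        by_contra hne
        have hne' : (⟨v, hv⟩ : Fin n) ≠ i := fun e => hne (congrArg Fin.val e)
        have hR : ∀ b, (lit (signs P) v = some b ∨ lit (signs Q) v = some b) →
            ((⟨v, hv⟩ : Fin n), b) ∈ C.1 := by
          intro b hb
          rw [hr.2.2, Finset.mem_union, Finset.mem_erase, Finset.mem_erase]
          refine hb.imp (fun h => ⟨?_, lit_signs.1 h⟩) fun h => ⟨?_, lit_signs.1 h⟩
          · exact fun e => hne' (congrArg Prod.fst e)
          · exact fun e => hne' (congrArg Prod.fst e)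
        apply C.2 ⟨v, hv⟩
        rcases hh with ⟨h1, h2⟩ | ⟨h1, h2⟩
        · exact ⟨hR _ (Or.inl h1), hR _ (Or.inr h2)⟩
        · exact ⟨hR _ (Or.inr h2), hR _ (Or.inl h1)⟩
      · rintro rfl
        refine ⟨i.2, ?_⟩
        have h1 := lit_signs.2 hr.1
        have h2 := lit_signs.2 hr.2.1
        cases a
        · exact Or.inr ⟨h1, h2⟩
        · exact Or.inl ⟨h1, h2⟩
    cases h : l with
    | nil => have := (h1 i).2 rfl; rw [h] at this; simp at this
    | cons a t => exact (h1 a).1 (by rw [h]; simp)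
  rw [skeleton, mkLines, List.getElem?_map, List.getElem?_map, h]
  simp only [Option.map_some, Option.elim_some, e hP, e hQ, hp]
  have h1 := lit_signs.2 hr.1
  rw [h1]
  cases a <;> simp

/-- The clause number `v`. -/
def clauseAt (Pf : ResProof n) (v : ℕ) : Cl :=
  (Pf[v]?.map fun l => signs l.1).getD []

theorem clauseAt_eq {v : ℕ} {C : Clause n} {jst : Option (ℕ × ℕ)} (h : Pf[v]? = some (C, jst)) :
    clauseAt Pf v = signs C := by simp [clauseAt, h]

theorem resolves_signs {P Q R : Clause n} {i : Fin n} {a : Bool} (h : IsResolvent i a P Q R) :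
    Resolves [] (signs P) (signs Q) i a (signs R) := by
  have hR : ∀ v : Fin n, v ≠ i → ∀ b, (v, b) ∈ R.1 ↔ (v, b) ∈ P.1 ∨ (v, b) ∈ Q.1 := by
    intro v hv b
    rw [h.2.2, Finset.mem_union, Finset.mem_erase, Finset.mem_erase]
    simp [hv]
  have hcompat : ∀ v : Fin n, v ≠ i → ∀ b b', (v, b) ∈ P.1 → (v, b') ∈ Q.1 → b = b' := by
    intro v hv b b' h1 h2
    have h3 := (hR v hv b).2 (Or.inl h1)
    have h4 := (hR v hv b').2 (Or.inr h2)
    have := R.2 v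
    cases b <;> cases b' <;> simp_all
  refine ⟨lit_signs.2 h.1, lit_signs.2 h.2.1, by simp, ?_, ?_⟩
  · intro v _ hv b b' h1 h2
    have hvn : v < n := lt_of_lit (length_signs P) (by simp [h1])
    exact hcompat ⟨v, hvn⟩ (fun e => hv (congrArg Fin.val e)) b b'
      (lit_signs (i := ⟨v, hvn⟩).1 h1) (lit_signs (i := ⟨v, hvn⟩).1 h2)
  · intro v
    rcases lt_or_ge v n with hv | hv
    · have key : ∀ b, lit (signs R) v = some b ↔
          (if v = (i : ℕ) then none else if lit (signs P) v = none then lit (signs Q) v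
            else lit (signs P) v) = some b := by
        intro b
        rw [lit_signs (i := ⟨v, hv⟩)]
        by_cases e : v = (i : ℕ)
        · subst e
          rw [if_pos rfl, h.2.2, Finset.mem_union, Finset.mem_erase, Finset.mem_erase]
          simp only [Fin.eta, reduceCtorEq, iff_false]
          have h1 := h.1
          have h2 := h.2.1
          have h3 := P.2 i
          have h4 := Q.2 i
          cases a <;> cases b <;> simp_all
        · have e' : (⟨v, hv⟩ : Fin n) ≠ i := fun e' => e (congrArg Fin.val e')
          rw [if_neg e, hR _ e' b, ← lit_signs (C := P), ← lit_signs (C := Q)]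
          change lit (signs P) v = _ ∨ lit (signs Q) v = _ ↔ _
          split_ifs with h1
          · simp [h1]
          · constructor
            · rintro (h2 | h2)
              · exact h2
              · obtain ⟨b', hb'⟩ := Option.ne_none_iff_exists'.1 h1
                rw [hb', hcompat _ e' b' b (lit_signs (i := ⟨v, hv⟩).1 hb')
                  (lit_signs (i := ⟨v, hv⟩).1 h2)]
            · exact Or.inl
      exact Option.ext fun b => key b
    · rw [lit_eq_none (length_signs R) hv, lit_eq_none (length_signs P) hv,
        lit_eq_none (length_signs Q) hv]
      simp

theorem skel_skeleton (hc : CtxOK π c) (h : IsRefutation τ Pf) (hcon : IsConnected Pf) :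
    Skel [] (skeleton c Pf) (clauseAt Pf) := by
  have hinf : ∀ (v : ℕ) (q : Just), (skeleton c Pf)[v]? = some (some (.inr q)) →
      q.1 < v ∧ q.2.1 < v ∧ IsParent Pf q.1 v ∧ IsParent Pf q.2.1 v ∧
        Resolves [] (clauseAt Pf q.1) (clauseAt Pf q.2.1) q.2.2.1 q.2.2.2 (clauseAt Pf v) := by
    intro v q hv
    have hvl : v < Pf.length := by
      rw [← length_skeleton (c := c)]
      exact (List.getElem?_eq_some_iff.1 hv).1
    obtain ⟨⟨C, jst⟩, hl⟩ : ∃ l, Pf[v]? = some l := ⟨_, List.getElem?_eq_getElem hvl⟩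
    rcases jst with _ | ⟨j, k⟩
    · rw [skeleton_ax hl] at hv
      simp at hv
    · obtain ⟨hj, hk, P, Q, jP, jQ, i, a, hP, hQ, hr⟩ := h.1 v C _ hl
      rw [skeleton_inf hc hl hP hQ hr] at hv
      obtain rfl := Sum.inr.inj (Option.some.inj (Option.some.inj hv))
      refine ⟨hj, hk, ⟨C, j, k, hl, Or.inl rfl⟩, ⟨C, j, k, hl, Or.inr rfl⟩, ?_⟩
      rw [clauseAt_eq hl, clauseAt_eq hP, clauseAt_eq hQ]
      exact resolves_signs hr
  have hused : ∀ v, v < Pf.length → Used (skeleton c Pf) v := by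
    intro v hvl
    obtain ⟨⟨C, jst⟩, hl⟩ : ∃ l, Pf[v]? = some l := ⟨_, List.getElem?_eq_getElem hvl⟩
    rcases jst with _ | ⟨j, k⟩
    · exact ⟨_, skeleton_ax hl⟩
    · obtain ⟨hj, hk, P, Q, jP, jQ, i, a, hP, hQ, hr⟩ := h.1 v C _ hl
      exact ⟨_, skeleton_inf hc hl hP hQ hr⟩
  obtain ⟨jst, hlast⟩ := last_eq_empty h hcon
  have hpos := (List.getElem?_eq_some_iff.1 hlast).1
  refine ⟨?_, ?_, ?_, ?_, ?_, ?_, ?_⟩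
  · intro v C hv
    have hvl : v < Pf.length := by
      rw [← length_skeleton (c := c)]
      exact (List.getElem?_eq_some_iff.1 hv).1
    obtain ⟨⟨D, jst⟩, hl⟩ : ∃ l, Pf[v]? = some l := ⟨_, List.getElem?_eq_getElem hvl⟩
    rcases jst with _ | ⟨j, k⟩
    · rw [skeleton_ax hl] at hv
      rw [clauseAt_eq hl]
      exact Sum.inl.inj (Option.some.inj (Option.some.inj hv))
    · obtain ⟨hj, hk, P, Q, jP, jQ, i, a, hP, hQ, hr⟩ := h.1 v D _ hl
      rw [skeleton_inf hc hl hP hQ hr] at hv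
      simp at hv
  · exact fun v q hv => ⟨(hinf v q hv).1, (hinf v q hv).2.1⟩
  · intro v q hv
    have hvl : v < Pf.length := by
      rw [← length_skeleton (c := c)]
      exact (List.getElem?_eq_some_iff.1 hv).1
    have := hinf v q hv
    exact ⟨hused _ (by omega), hused _ (by omega)⟩
  · exact fun v q hv => Or.inr (hinf v q hv).2.2.2.2
  · rw [length_skeleton]
    exact hused _ hpos
  · intro i _
    rw [length_skeleton, clauseAt_eq hlast]
    rcases lt_or_ge i n with hi | hi
    · by_contra hn
      rw [← ne_eq, lit_signs_ne_none (i := ⟨i, hi⟩), mem_clause_vars] at hn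
      simp [Clause.empty] at hn
    · exact lit_eq_none (length_signs _) hi
  · intro S h0 hS v hv
    rw [length_skeleton] at h0
    have hvl := hv.lt
    rw [length_skeleton] at hvl
    refine connected_induction h.1 hcon S h0 ?_ v hvl
    rintro u v hSv ⟨C, j, k, hl, hu⟩
    obtain ⟨hj, hk, P, Q, jP, jQ, i, a, hP, hQ, hr⟩ := h.1 v C _ hl
    obtain ⟨s1, s2⟩ := hS v _ hSv (skeleton_inf hc hl hP hQ hr)
    rcases hu with rfl | rfl
    · exact s1
    · exact s2

theorem mem_skeleton_ax (hc : CtxOK π c) (h : IsRefutation τ Pf) {A : Cl} :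
    (some (.inl A) : Ln) ∈ skeleton c Pf ↔ ∃ C : Clause n, (C, none) ∈ Pf ∧ signs C = A := by
  constructor
  · intro hA
    obtain ⟨v, hv⟩ := List.mem_iff_getElem?.1 hA
    have hvl : v < Pf.length := by
      rw [← length_skeleton (c := c)]
      exact (List.getElem?_eq_some_iff.1 hv).1
    obtain ⟨⟨D, jst⟩, hl⟩ : ∃ l, Pf[v]? = some l := ⟨_, List.getElem?_eq_getElem hvl⟩
    rcases jst with _ | ⟨j, k⟩
    · rw [skeleton_ax hl] at hv
      exact ⟨D, List.mem_of_getElem? hl, Sum.inl.inj (Option.some.inj (Option.some.inj hv))⟩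
    · obtain ⟨hj, hk, P, Q, jP, jQ, i, a, hP, hQ, hr⟩ := h.1 v D _ hl
      rw [skeleton_inf hc hl hP hQ hr] at hv
      simp at hv
  · rintro ⟨C, hC, rfl⟩
    obtain ⟨v, hv⟩ := List.mem_iff_getElem?.1 hC
    exact List.mem_of_getElem? (skeleton_ax hv)

theorem mem_ax (h : IsResProof τ Pf) {C : Clause n} (hC : (C, none) ∈ Pf) : C ∈ τ := by
  obtain ⟨v, hv⟩ := List.mem_iff_getElem?.1 hC
  exact h v C none hv

theorem length_varList_le (hc : CtxOK π c) (h : IsRefutation τ Pf) (hcon : IsConnected Pf) :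
    (varList c (skeleton c Pf)).length ≤ τ.card := by
  classical
  set A : Finset (Clause n) := τ.filter fun C => (C, none) ∈ Pf with hA
  have hmem : ∀ C, C ∈ A ↔ (C, none) ∈ Pf := fun C => by
    rw [hA, Finset.mem_filter]
    exact ⟨fun h => h.2, fun h' => ⟨mem_ax h.1 h', h'⟩⟩
  have h1 := card_biUnion_vars_le h hcon A hmem
  have h2 : A.card ≤ τ.card := Finset.card_le_card (Finset.filter_subset _ _)
  have hnd : (varList c (skeleton c Pf)).Nodup := by
    rw [varList, hc.vs]
    exact List.nodup_range.filter _
  have h3 : (varList c (skeleton c Pf)).toFinset ⊆ (A.biUnion Clause.vars).map Fin.valEmbedding := by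
    intro v hv
    rw [List.mem_toFinset, varList, hc.vs, List.mem_filter, List.mem_range] at hv
    obtain ⟨B, hB, hn⟩ := occ_iff.1 hv.2
    obtain ⟨C, hC, rfl⟩ := (mem_skeleton_ax hc h).1 hB
    rw [lit_signs_ne_none (i := ⟨v, hv.1⟩)] at hn
    exact Finset.mem_map.2 ⟨⟨v, hv.1⟩, Finset.mem_biUnion.2 ⟨C, (hmem C).2 hC, hn⟩, rfl⟩
  have h4 := Finset.card_le_card h3
  rw [Finset.card_map, List.toFinset_card_of_nodup hnd] at h4
  omega

theorem good_axioms (cls : List (Clause n)) (hcls : ∀ C ∈ cls, C ∈ τ) :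
    Good π τ ((cls.map signs).map fun C => .inl C) := by
  induction cls using List.reverseRecOn with
  | nil => exact ⟨fun v L h => by simp at h, by simp⟩
  | append_singleton cls C ih =>
    rw [List.map_append, List.map_append]
    refine (ih fun D hD => hcls D (by simp [hD])).snoc ?_ (length_signs C)
    rw [toLine, toClause_signs]
    exact .axiomClause C (hcls C (by simp))

theorem stepBound_le {n R : ℕ} (hn : 1 ≤ n) (hR : 1 ≤ R) : stepBound n R ≤ 54 * (n ^ 2 * R) := by
  rw [stepBound]
  -- The coefficients 1, 2, 4 and 2 add up to 9, each summand being at most its coefficient times `n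
  -- * R`.
  have h1 : R + R * (2 * n) + n * (4 * R) + 2 * n ≤ 9 * (n * R) := by nlinarith
  have h2 : 3 * n + 3 ≤ 6 * n := by omega
  calc _ ≤ (9 * (n * R)) * (6 * n) := Nat.mul_le_mul h1 h2
    _ = _ := by ring

/-- Correctness of the algorithm. -/
theorem output_spec (hc : CtxOK π c) (h : IsRefutation τ Pf) (hcon : IsConnected Pf)
    {cls : List (Clause n)} (hnd : cls.Nodup) (hcls : cls.toFinset = τ) :
    Good π τ (output c (skeleton c Pf) (cls.map signs)) ∧
    (output c (skeleton c Pf) (cls.map signs)).length ≤ 163 * (n ^ 2 * τ.card * Pf.length) ∧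
    ∀ i ∈ ResProof.vars Pf, ∀ a : Bool, P0Line.clause (Clause.unit (i, a)) ∈
      (output c (skeleton c Pf) (cls.map signs)).map (toLine n) := by
  set L := skeleton c Pf with hL
  have hS : Skel [] L (clauseAt Pf) := skel_skeleton hc h hcon
  have hmemcls : ∀ C, C ∈ cls ↔ C ∈ τ := fun C => by rw [← hcls, List.mem_toFinset]
  have hvars : ∀ i ∈ ResProof.vars Pf, (i : ℕ) ∈ varList c L := by
    rintro i ⟨⟨C, jst⟩, hl, hi⟩
    obtain ⟨v, hv⟩ := List.mem_iff_getElem?.1 hl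
    rw [varList, hc.vs, List.mem_filter, List.mem_range]
    have hused : Used L v := by
      have hvl := (List.getElem?_eq_some_iff.1 hv).1
      rcases jst with _ | ⟨j, k⟩
      · exact ⟨_, skeleton_ax hv⟩
      · obtain ⟨hj, hk, P, Q, jP, jQ, i, a, hP, hQ, hr⟩ := h.1 v C _ hv
        exact ⟨_, skeleton_inf hc hv hP hQ hr⟩
    refine ⟨i.2, hS.occ v hused i ?_⟩
    rw [clauseAt_eq hv]
    exact lit_signs_ne_none.2 hi
  -- Without variables nothing has to be learned. This case is separate because for `n = 0` the
  -- bound on the length is zero, so not even the axioms may be listed.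
  by_cases hV : varList c L = []
  · have e : output c L (cls.map signs) = [] := by simp [output, hV]
    rw [e]
    refine ⟨⟨fun v L h => by simp at h, by simp⟩, by simp, fun i hi => ?_⟩
    have := hvars i hi
    rw [hV] at this
    simp at this
  have e : output c L (cls.map signs) = ((cls.map signs).map fun C => .inl C) ++ (run c L).2 := by
    have : (varList c L).isEmpty = false := by
      rw [← Bool.not_eq_true, List.isEmpty_iff]
      exact hV
    simp [output, this]
  have hG := good_axioms (π := π) (τ := τ) cls fun C hC => (hmemcls C).1 hC
  set G : List Raw := (cls.map signs).map fun C => .inl C with hGd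
  obtain ⟨z, t, hzt⟩ := List.exists_cons_of_ne_nil hV
  have hz : z ∈ varList c L := by rw [hzt]; simp
  obtain ⟨y, hy, hF⟩ := frameOK_mkFrame (G := G) hc (List.nil_prefix) hS (by
    intro A hA
    obtain ⟨C, hC, rfl⟩ := (mem_skeleton_ax hc h).1 hA
    refine ⟨?_, length_signs C, fun v hv => occ_iff.2 ⟨_, hA, hv⟩, by simp⟩
    exact List.mem_map_of_mem (List.mem_map_of_mem ((hmemcls C).2 (mem_ax h.1 hC))))
    ⟨z, by simp, by rw [varList, List.mem_filter] at hz; exact hz.2⟩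
  have hfv : ∀ i, i ∈ fvar n [] L ↔ i ∈ varList c L := by
    intro i
    rw [fvar, varList, hc.vs]
    simp
  have hcard : (fvar n [] L).card = (varList c L).length := by
    have hnd : (varList c L).Nodup := by
      rw [varList, hc.vs]
      exact List.nodup_range.filter _
    rw [← List.toFinset_card_of_nodup hnd]
    congr 1
    ext i
    rw [hfv, List.mem_toFinset]
  obtain ⟨k, F, p1, p2, p3, p4, p5, p6, p7, p8⟩ :=
    hF.complete hc _ hG (le_of_eq length_skeleton) le_rfl []
  rw [if_pos rfl] at p1
  have ht : todo n [] y L [] + 1 = (fvar n [] L).card := by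
    rw [todo]
    simp only [fvars, List.map_nil, List.toFinset_nil, Finset.sdiff_empty]
    exact Finset.card_erase_add_one hF.mem_var
  have hrun : (run c L).2 = (steps c k [([], y, L, none, [])]).2 := by
    rw [run, foldEmit_steps, hy]
    -- The loop may run longer than the task needs. The remaining rounds find an empty stack and
    -- emit nothing.
    obtain ⟨d, hd⟩ : ∃ d, (varList c L ++ (varList c L ++ varList c L)).length = k + d :=
      ⟨_, (Nat.add_sub_cancel' (by simp only [List.length_append]; omega)).symm⟩
    rw [hd, steps_add, p2]
    have : addFacts F [] = [] := rfl
    rw [this, steps_nil]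
    simp
  rw [e, hrun]
  refine ⟨p3, ?_, ?_⟩
  · have hk : k ≤ 3 * τ.card := by
      have := length_varList_le hc h hcon
      rw [← hL] at this
      omega
    have hn : 1 ≤ n := by
      rw [varList, hc.vs, List.mem_filter, List.mem_range] at hz
      omega
    have hτ : cls.length = τ.card := by rw [← hcls, List.toFinset_card_of_nodup hnd]
    have hR : 1 ≤ Pf.length := by
      have := hS.last.lt
      rw [hL, length_skeleton] at this
      omega
    have h1 : (steps c k [([], y, L, none, [])]).2.length ≤
        3 * τ.card * (54 * (n ^ 2 * Pf.length)) :=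
      p8.trans (Nat.mul_le_mul hk (stepBound_le hn hR))
    have h2 : τ.card ≤ n ^ 2 * τ.card * Pf.length := by
      calc τ.card = 1 * τ.card * 1 := by ring
        _ ≤ _ := Nat.mul_le_mul (Nat.mul_le_mul_right _ (Nat.one_le_pow _ _ hn)) hR
    rw [List.length_append, hGd, List.length_map, List.length_map, hτ]
    -- The constant is `163 = 1 + 3 * 54`: the axioms, and three steps per variable with the bound
    -- on a single step.
    calc _ ≤ n ^ 2 * τ.card * Pf.length + 3 * τ.card * (54 * (n ^ 2 * Pf.length)) :=
          add_le_add h2 h1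
      _ = _ := by ring
  · intro i hi a
    obtain ⟨A, hA⟩ := p5 i ((hfv i).2 (hvars i hi)) a
    have hf := p4 _ hA
    refine List.mem_map.2 ⟨_, hf.mem, ?_⟩
    rw [toLine]
    congr 1
    ext ⟨j, b⟩
    rw [mem_toClause]
    simp only [Clause.unit, Finset.mem_singleton, Prod.mk.injEq]
    constructor
    · intro hj
      have hji : j = i := by
        -- The first task has the empty segment, so its facts have no further literals: they are
        -- unit clauses.
        by_contra hne
        have := (hf.other j (fun e => hne (Fin.ext e)) (by rw [hj]; simp)).1
        simp at this
      subst hji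
      have := hf.lit_eq
      simp only at this
      rw [hj] at this
      exact ⟨rfl, Option.some.inj this⟩
    · rintro ⟨rfl, rfl⟩
      exact hf.lit_eq

end input

/-! ### The size of the state of the algorithm -/

/-- All numbers and lengths in a line of a skeleton are at most `M`. -/
def LnLe (M : ℕ) (l : Ln) : Prop :=
  (∀ C, axOf l = some C → C.length ≤ M) ∧
    ∀ q, justOf l = some q → q.1 ≤ M ∧ q.2.1 ≤ M ∧ q.2.2.1 ≤ M

/-- All numbers and lengths in a fact are at most `M`. -/
def FactLe (M : ℕ) (u : Fact) : Prop := u.1 ≤ M ∧ u.2.2.length ≤ M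

/-- All numbers and lengths in a task, except the number of facts, are at most `M`. -/
structure FrameLe (M : ℕ) (f : Frame) : Prop where
  pre_length : f.1.length ≤ M
  pre : ∀ v ∈ f.1, v ≤ M
  var : f.2.1 ≤ M
  lines_length : f.2.2.1.length ≤ M
  lines : ∀ l ∈ f.2.2.1, LnLe M l
  learned : ∀ C ∈ f.2.2.2.1, C.length ≤ M
  facts : ∀ u ∈ f.2.2.2.2, FactLe M u

/-- All numbers and lengths in an evaluated line are at most `M`. -/
def EntryLe (M : ℕ) (e : Entry) : Prop := LnLe M e.1 ∧ e.2.length ≤ M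

/-- All numbers and lengths in the lists of the variables are at most `M`. -/
structure CtxLe (M : ℕ) (c : Ctx) : Prop where
  fst : c.1.length ≤ M
  snd : c.2.length + 1 ≤ M
  mem : ∀ v ∈ c.2, v ≤ M

theorem lnLe_none (M : ℕ) : LnLe M none := by
  constructor <;> intro _ h <;> simp [axOf, justOf] at h

theorem lnLe_inl {M : ℕ} {C : Cl} : LnLe M (some (.inl C)) ↔ C.length ≤ M := by
  simp [LnLe, axOf, justOf]

theorem lnLe_inr {M : ℕ} {q : Just} :
    LnLe M (some (.inr q)) ↔ q.1 ≤ M ∧ q.2.1 ≤ M ∧ q.2.2.1 ≤ M := by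
  obtain ⟨j, k, z, a⟩ := q
  simp [LnLe, axOf, justOf]

section
variable {M : ℕ} {c : Ctx} (hc : CtxLe M c)
include hc

theorem length_res_le (P Q : Cl) (z : ℕ) : (res c P Q z).length ≤ M := by
  simpa [res] using hc.fst

theorem length_strip_le {C : Cl} (hC : C.length ≤ M) (K : List ℕ) (us : List Fact) :
    (strip c K us C).1.length ≤ M := by
  rw [strip, foldEmit_fst]
  induction us generalizing C with
  | nil => exact hC
  | cons u us ih =>
    refine ih ?_
    unfold strip1
    cases decide (lit C u.1 = some (!u.2.1))
    · exact hC
    · exact length_res_le hc _ _ _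

theorem lnLe_stripL (K : List ℕ) (us : List Fact) {L : List Ln} (hL : ∀ l ∈ L, LnLe M l) :
    ∀ l ∈ stripL c K us L, LnLe M l := by
  intro l hl
  obtain ⟨l, h, rfl⟩ := List.mem_map.1 hl
  have := hL l h
  rcases l with _ | C | q
  · exact this
  · exact lnLe_inl.2 (length_strip_le hc (lnLe_inl.1 this) _ _)
  · exact this

omit hc in
theorem lnLe_dropL (x : ℕ) (s : Bool) {L : List Ln} (hL : ∀ l ∈ L, LnLe M l) :
    ∀ l ∈ dropL x s L, LnLe M l := by
  intro l hl
  obtain ⟨l, h, rfl⟩ := List.mem_map.1 hl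
  have := hL l h
  rcases l with _ | C | q
  · exact this
  · change LnLe M (bif decide (lit C x = some s) then none else some (.inl C))
    cases decide (lit C x = some s)
    · exact this
    · exact lnLe_none M
  · exact this

omit hc in
theorem length_units_le (K : List ℕ) (x : ℕ) (s : Bool) {L : List Ln} (hL : ∀ l ∈ L, LnLe M l) :
    ∀ C ∈ units c K x s L, C.length ≤ M := by
  intro C hC
  obtain ⟨l, h, hl⟩ := List.mem_flatMap.1 hC
  have := hL l h
  rcases l with _ | D | q
  · simp [axOf] at hl
  · change C ∈ (bif blank c K D && decide (lit D x = some s) then [D] else []) at hl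
    cases hb : (blank c K D && decide (lit D x = some s))
    · simp [hb] at hl
    · simp only [hb, cond_true, List.mem_singleton] at hl
      exact hl ▸ lnLe_inl.1 this
  · simp [axOf] at hl

theorem entryLe_evalJust (K : List ℕ) {P Q : Entry} (hP : EntryLe M P) (hQ : EntryLe M Q)
    {q : Just} (hq : LnLe M (some (.inr q))) : EntryLe M (evalJust c K P Q q) := by
  have h := lnLe_inr.1 hq
  unfold evalJust
  simp only [Bool.cond_eq_ite]
  split_ifs
  · exact ⟨lnLe_inr.2 ⟨h.1, h.1, h.2.2⟩, hP.2⟩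
  · exact ⟨lnLe_inr.2 ⟨h.2.1, h.2.1, h.2.2⟩, hQ.2⟩
  · exact ⟨hq, length_res_le hc _ _ _⟩
  · exact ⟨lnLe_inr.2 ⟨h.1, h.1, h.2.2⟩, hP.2⟩
  · exact ⟨lnLe_none M, Nat.zero_le _⟩

omit hc in
theorem entryLe_getD {E : List Entry} (hE : ∀ e ∈ E, EntryLe M e) (k : ℕ) :
    EntryLe M (E.getD k (none, [])) := by
  rw [List.getD_eq_getElem?_getD]
  rcases h : E[k]? with _ | e
  · exact ⟨lnLe_none M, Nat.zero_le _⟩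
  · exact hE e (List.mem_of_getElem? h)

theorem entryLe_evalAll (K : List ℕ) {L : List Ln} (hL : ∀ l ∈ L, LnLe M l) :
    ∀ e ∈ evalAll c K L, EntryLe M e := by
  induction L using List.reverseRecOn with
  | nil => simp [evalAll]
  | append_singleton L l ih =>
    have ih := ih fun l h => hL l (by simp [h])
    have hl := hL l (by simp)
    rw [evalAll, List.foldl_append]
    intro e he
    rcases List.mem_append.1 he with he | he
    · exact ih e he
    · obtain rfl := List.mem_singleton.1 he
      rcases l with _ | C | q
      · exact ⟨lnLe_none M, Nat.zero_le _⟩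
      · exact ⟨hl, lnLe_inl.1 hl⟩
      · exact entryLe_evalJust hc K (entryLe_getD ih _) (entryLe_getD ih _) hl

omit hc in
theorem lnLe_prune {T : List Ln} {l : Ln} (hT : ∀ l ∈ T, LnLe M l) (hl : LnLe M l) :
    ∀ l' ∈ prune T l, LnLe M l' := by
  have h1 : ∀ p ∈ (enum (T ++ [l])).reverse, LnLe M p.2 := by
    intro p hp
    have h2 : ∀ (T : List Ln) (p), p ∈ enum T → p.2 ∈ T := by
      intro T p hp
      induction T using List.reverseRecOn with
      | nil => simp [enum] at hp
      | append_singleton T x ih =>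
        rw [enum_append_singleton] at hp
        rcases List.mem_append.1 hp with hp | hp
        · simp [ih hp]
        · simp_all
    have := h2 _ _ (List.mem_reverse.1 hp)
    rcases List.mem_append.1 this with h | h
    · exact hT _ h
    · exact List.mem_singleton.1 h ▸ hl
  have h3 : ∀ (R : List (ℕ × Ln)) (s : List ℕ × List Ln), (∀ p ∈ R, LnLe M p.2) →
      (∀ l ∈ s.2, LnLe M l) → ∀ l ∈ (R.foldl pruneStep s).2, LnLe M l := by
    intro R
    induction R with
    | nil => exact fun s _ h => h
    | cons p R ih =>
      intro s hR hs
      refine ih _ (fun p hp => hR p (by simp [hp])) ?_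
      unfold pruneStep
      cases decide (p.1 ∈ s.1)
      · exact List.forall_mem_cons.2 ⟨lnLe_none M, hs⟩
      · exact List.forall_mem_cons.2 ⟨hR p (by simp), hs⟩
  exact h3 _ ([T.length], []) h1 (by simp)

omit hc in
theorem length_prune (T : List Ln) (l : Ln) : (prune T l).length = T.length + 1 := by
  have h3 : ∀ (R : List (ℕ × Ln)) (s : List ℕ × List Ln),
      (R.foldl pruneStep s).2.length = R.length + s.2.length := by
    intro R
    induction R with
    | nil => simp
    | cons p R ih =>
      intro s
      rw [List.foldl_cons, ih, List.length_cons]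
      unfold pruneStep
      cases decide (p.1 ∈ s.1) <;> simp only [cond_true, cond_false, List.length_cons] <;> omega
  rw [prune, h3]
  have := congrArg List.length (enum_map_fst (T ++ [l]))
  simp at this ⊢
  exact this

theorem frameLe_mkFrame {K : List ℕ} {L : List Ln} (hK : K.length ≤ M) (hK' : ∀ v ∈ K, v ≤ M)
    (hL : L.length ≤ M) (hL' : ∀ l ∈ L, LnLe M l) : FrameLe M (mkFrame c K L) := by
  refine ⟨hK, hK', ?_, hL, hL', by simp [mkFrame], by simp [mkFrame]⟩
  change (List.filter _ _).headD 0 ≤ M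
  rcases h : List.filter (fun v => !decide (v ∈ K) && occ L v) c.2 with _ | ⟨v, l⟩
  · exact Nat.zero_le _
  · exact hc.mem v (List.mem_of_mem_filter (h ▸ List.mem_cons_self))

theorem upto_le {x : ℕ} (hx : x ≤ M) : (upto c x).length ≤ M ∧ ∀ v ∈ upto c x, v ≤ M := by
  constructor
  · have := (List.takeWhile_sublist (l := c.2) fun v => !decide (v = x)).length_le
    have := hc.snd
    rw [upto, List.length_append, List.length_singleton]
    omega
  · intro v hv
    rcases List.mem_append.1 hv with h | h
    · exact hc.mem v ((List.takeWhile_sublist _).subset h)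
    · exact List.mem_singleton.1 h ▸ hx

theorem frameLe_subFrame {K : List ℕ} {E : List Entry} (hK : K.length ≤ M) (hK' : ∀ v ∈ K, v ≤ M)
    (hE : E.length ≤ M) (hE' : ∀ e ∈ E, EntryLe M e) (hconf : isConf c K (conf c K E)) :
    FrameLe M (subFrame c K E) := by
  refine frameLe_mkFrame hc hK hK' ?_ (lnLe_prune ?_ (?_ : LnLe M (conf c K E).1))
  · have h1 : (before c K E).length < E.length := by
      by_contra h
      rw [conf, List.getD_eq_getElem?_getD, List.getElem?_eq_none (not_lt.1 h)] at hconf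
      simp [isConf, justOf] at hconf
    rw [length_prune, List.length_map]
    omega
  · intro l hl
    obtain ⟨e, he, rfl⟩ := List.mem_map.1 hl
    exact (hE' e ((List.takeWhile_sublist _).subset he)).1
  · exact (entryLe_getD hE' _).1

theorem search_le (pre K : List ℕ) (x : ℕ) (X : Cl) {L : List Ln} (hL : ∀ l ∈ L, LnLe M l) :
    (∀ l ∈ (search c pre K x X L).1.1, LnLe M l) ∧
      ∀ C ∈ (search c pre K x X L).1.2, C.length ≤ M := by
  rw [search, foldEmit_fst]
  have : ∀ (R : List ℕ) (s : List Ln × Option Cl), (∀ l ∈ s.1, LnLe M l) →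
      (∀ C ∈ s.2, C.length ≤ M) →
      (∀ l ∈ (R.foldl (fun s _ => round c pre K x X s) s).1, LnLe M l) ∧
        ∀ C ∈ (R.foldl (fun s _ => round c pre K x X s) s).2, C.length ≤ M := by
    intro R
    induction R with
    | nil => exact fun s h1 h2 => ⟨h1, h2⟩
    | cons y R ih =>
      intro s h1 h2
      refine ih _ ?_ ?_
      · unfold round
        simp only [Bool.cond_eq_ite]
        split_ifs
        · exact h1
        · exact lnLe_stripL hc _ _ h1
        · exact h1
      · unfold round
        simp only [Bool.cond_eq_ite]
        split_ifs with h3 h4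
        · exact h2
        · simp
        · intro C hC
          obtain rfl := Option.some.inj hC
          rcases h5 : units c K x false s.1 with _ | ⟨D, l⟩
          · exact Nat.zero_le _
          · exact length_units_le _ _ _ h1 D (h5 ▸ List.mem_cons_self)
  exact this c.1 (L, none) hL (by simp)

theorem lnLe_prep (K : List ℕ) {f : Frame} (hf : FrameLe M f) :
    (prep c K f).length ≤ M ∧ ∀ l ∈ prep c K f, LnLe M l := by
  have h : (prep0 c f).length ≤ M ∧ ∀ l ∈ prep0 c f, LnLe M l := by
    unfold prep0
    rcases f.2.2.2.1 with _ | X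
    · exact ⟨by simpa [dropL] using hf.lines_length, lnLe_dropL _ _ hf.lines⟩
    · exact ⟨by simpa [stripL] using hf.lines_length, lnLe_stripL hc _ _ hf.lines⟩
  exact ⟨by simpa [prep, stripL] using h.1, lnLe_stripL hc _ _ h.2⟩

/-- The size of the state after some steps. -/
structure StackLe (M k : ℕ) (st : List Frame) : Prop where
  frames : ∀ f ∈ st, FrameLe M f
  length : st.length ≤ k + 1
  facts : (st.map fun f => f.2.2.2.2.length).sum ≤ 2 * k

omit hc in
theorem stackLe_nil (k : ℕ) : StackLe M k [] := ⟨by simp, by simp, by simp⟩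

/-- Facts are moved to the task below, not copied, and two are added for the completed variable. So
the total number of facts grows by at most two per step, which prevents growth by repeated doubling.
-/
theorem stackLe_pop (K : List ℕ) {k : ℕ} {f : Frame} {rest : List Frame}
    (h : StackLe M k (f :: rest)) : StackLe M (k + 1) (pop c K f rest) := by
  unfold pop
  rcases rest with _ | ⟨g, rest⟩
  · exact stackLe_nil _
  have hf := h.frames f (by simp)
  have hg := h.frames g (by simp)
  refine ⟨List.forall_mem_cons.2 ⟨⟨hg.pre_length, hg.pre, hg.var, hg.lines_length, hg.lines,
    hg.learned, ?_⟩, fun g' hg' => h.frames g' (by simpa using Or.inr (Or.inr hg'))⟩, ?_, ?_⟩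
  · intro u hu
    rcases List.mem_append.1 hu with hu | hu
    · rcases List.mem_append.1 hu with hu | hu
      · obtain ⟨w, hw, rfl⟩ := List.mem_map.1 hu
        have := hf.facts w hw
        exact ⟨this.1, length_strip_le hc this.2 _ _⟩
      · simp only [List.mem_cons, List.not_mem_nil, or_false] at hu
        rcases hu with rfl | rfl
        · refine ⟨hf.var, ?_⟩
          change (f.2.2.2.1.elim [] fun C => C).length ≤ M
          rcases h5 : f.2.2.2.1 with _ | C
          · exact Nat.zero_le _
          · exact hf.learned C h5
        · refine ⟨hf.var, ?_⟩
          have := (search_le hc f.1 K f.2.1 (learnedCl f) hf.lines).2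
          unfold foundCl
          rcases h5 : (search c f.1 K f.2.1 (learnedCl f) f.2.2.1).1.2 with _ | C
          · exact Nat.zero_le _
          · exact this C h5
    · exact hg.facts u hu
  · have := h.length
    simp [addFacts] at this ⊢
    omega
  · have := h.facts
    simp [addFacts, newFacts] at this ⊢
    omega

theorem stackLe_step {k : ℕ} {st : List Frame} (h : StackLe M k st) :
    StackLe M (k + 1) (step c st) := by
  rcases st with _ | ⟨f, rest⟩
  · exact stackLe_nil _
  change StackLe M (k + 1) (stepFrame c (upto c f.2.1) f rest)
  have hf := h.frames f (by simp)
  have hK := upto_le hc hf.var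
  have hp := lnLe_prep hc (upto c f.2.1) hf
  have h1 := h.length
  have h2 := h.facts
  simp only [List.length_cons, List.map_cons, List.sum_cons] at h1 h2
  unfold stepFrame
  simp only [Bool.cond_eq_ite]
  split_ifs with hs hconf
  · refine ⟨List.forall_mem_cons.2 ⟨⟨hf.pre_length, hf.pre, hf.var, hf.lines_length, hf.lines,
      ?_, hf.facts⟩, fun g hg => h.frames g (by simp [hg])⟩, ?_, ?_⟩
    · intro C hC
      obtain rfl := Option.some.inj hC
      rcases h5 : units c (upto c f.2.1) f.2.1 true (prep c (upto c f.2.1) f) with _ | ⟨D, l⟩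
      · exact Nat.zero_le _
      · exact length_units_le _ _ _ hp.2 D (h5 ▸ List.mem_cons_self)
    · simp only [List.length_cons]; omega
    · simp only [List.map_cons, List.sum_cons]; omega
  · refine ⟨List.forall_mem_cons.2 ⟨frameLe_subFrame hc hK.1 hK.2 ?_
      (entryLe_evalAll hc _ hp.2) hconf, h.frames⟩, ?_, ?_⟩
    · rw [length_evalAll]; exact hp.1
    · simp only [List.length_cons]; omega
    · simp only [List.map_cons, List.sum_cons, subFrame, mkFrame, List.length_nil]; omega
  · exact stackLe_pop hc _ h

theorem stackLe_foldl {β : Type} (l : List β) {st : List Frame} {k : ℕ} (h : StackLe M k st) :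
    StackLe M (k + l.length) (l.foldl (fun st _ => step c st) st) := by
  induction l generalizing st k with
  | nil => exact h
  | cons x l ih =>
    have := ih (stackLe_step hc h)
    rwa [add_assoc, add_comm 1] at this

end

theorem sz_cl_le {M : ℕ} {C : Cl} (h : C.length ≤ M) : sz C ≤ 6 * M + 1 := by
  have := sz_list_le (l := C) (B := 5) fun o _ => sz_optBool o
  omega

theorem sz_ln_le {M : ℕ} {l : Ln} (h : LnLe M l) : sz l ≤ 6 * M + 20 := by
  rcases l with _ | C | ⟨j, k, z, a⟩
  · rw [sz_none]; omega
  · have := sz_cl_le (lnLe_inl.1 h)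
    rw [sz_some, sz_inl]; omega
  · have h1 := lnLe_inr.1 h
    have := sz_bool a
    simp only at h1
    simp only [sz_some, sz_inr, sz_pair, sz_nat]; omega

theorem sz_fact_le {M : ℕ} {u : Fact} (h : FactLe M u) : sz u ≤ 8 * M + 20 := by
  obtain ⟨z, a, C⟩ := u
  have := sz_cl_le h.2
  have := sz_bool a
  have := h.1
  simp only [sz_pair, sz_nat] at *; omega

theorem sz_frame_le {M k : ℕ} {f : Frame} (h : FrameLe M f) (hk : f.2.2.2.2.length ≤ 2 * k) :
    sz f ≤ M * (2 * M + 2) + M * (6 * M + 21) + 2 * k * (8 * M + 21) + 8 * M + 20 := by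
  obtain ⟨pre, x, L, o, U⟩ := f
  obtain ⟨h1, h2, h3, h4, h5, h6, h7⟩ := h
  simp only at h1 h2 h3 h4 h5 h6 h7 hk
  have e1 := sz_list_le (l := pre) (B := 2 * M + 1) fun v hv => by
    have := h2 v hv; rw [sz_nat]; omega
  have e2 := sz_list_le (l := L) fun l hl => sz_ln_le (h5 l hl)
  have e3 := sz_list_le (l := U) fun u hu => sz_fact_le (h7 u hu)
  have e4 : sz o ≤ 6 * M + 3 := by
    rcases o with _ | C
    · rw [sz_none]; omega
    · have := sz_cl_le (h6 C rfl)
      rw [sz_some]; omega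
  have i1 := Nat.mul_le_mul_right (2 * M + 2) h1
  have i2 := Nat.mul_le_mul_right (6 * M + 21) h4
  have i3 := Nat.mul_le_mul_right (8 * M + 21) hk
  simp only [sz_pair, sz_nat]
  rw [show 2 * M + 1 + 1 = 2 * M + 2 from rfl] at e1
  rw [show 6 * M + 20 + 1 = 6 * M + 21 from rfl] at e2
  rw [show 8 * M + 20 + 1 = 8 * M + 21 from rfl] at e3
  omega

/-- A bound for the size of a task. -/
def frameBound (M : ℕ) : ℕ :=
  M * (2 * M + 2) + M * (6 * M + 21) + 2 * (3 * M) * (8 * M + 21) + 8 * M + 20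

theorem sz_stack_le {M k : ℕ} {st : List Frame} (h : StackLe M k st) (hk : k ≤ 3 * M) :
    sz st ≤ (3 * M + 1) * (frameBound M + 1) + 1 := by
  have h1 : ∀ f ∈ st, sz f ≤ frameBound M := by
    intro f hf
    refine sz_frame_le (h.frames f hf) ?_
    have := List.single_le_sum (l := st.map fun f => f.2.2.2.2.length) (by simp) _
      (List.mem_map_of_mem hf)
    have := h.facts
    omega
  have h2 := sz_list_le h1
  have h3 := Nat.mul_le_mul_right (frameBound M + 1) (show st.length ≤ 3 * M + 1 by
    have := h.length; omega)
  omega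

theorem ctxLe_of_sz {M : ℕ} {c : Ctx} (h : sz c ≤ M) : CtxLe M c := by
  obtain ⟨c1, c2⟩ := c
  rw [sz_pair] at h
  have h1 := length_lt_sz c1
  have h2 := length_lt_sz c2
  refine ⟨by simp only; omega, by simp only; omega, fun v hv => ?_⟩
  have := sz_mem_lt hv
  rw [sz_nat] at this
  simp only at *
  omega

theorem lnLe_of_sz {M : ℕ} {l : Ln} (h : sz l ≤ M) : LnLe M l := by
  rcases l with _ | C | ⟨j, k, z, a⟩
  · exact lnLe_none M
  · have := length_lt_sz C
    rw [sz_some, sz_inl] at h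
    exact lnLe_inl.2 (by omega)
  · simp only [sz_some, sz_inr, sz_pair, sz_nat] at h
    exact lnLe_inr.2 ⟨by simp only; omega, by simp only; omega, by simp only; omega⟩

-- With `M` the size of the input, all indices and all lengths of clauses, segments and skeletons
-- remain at most `M`; only the stack and its lists of facts grow, linearly in the number of steps.
-- So every intermediate state has polynomial size, even for inputs that encode no refutation.
@[fun_prop] theorem PT.run {α : Type} [Enc α] {c : α → Ctx} {L : α → List Ln} (hc : PT c)
    (hL : PT L) : PT fun a => run (c a) (L a) := by
  have hM : PB fun a => sz (c a) + sz (L a) := hc.pb.add hL.pb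
  refine PT.foldEmit_of_prefix (by fun_prop) (by fun_prop) (by fun_prop) (by fun_prop)
    (fun a => (3 * (sz (c a) + sz (L a)) + 1) * (frameBound (sz (c a) + sz (L a)) + 1) + 1) ?_ ?_
  · have t : ∀ k, PB fun a => k * (sz (c a) + sz (L a)) := fun k => (PB.const k).mul hM
    refine ((((t 3).add (PB.const 1)).mul (PB.add ?_ (PB.const 1))).add (PB.const 1))
    exact ((((hM.mul ((t 2).add (PB.const 2))).add (hM.mul ((t 6).add (PB.const 21)))).add
      (((PB.const 2).mul (t 3)).mul ((t 8).add (PB.const 21)))).add (t 8)).add (PB.const 20)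
  · intro a l l' hl
    have hc' := ctxLe_of_sz (show sz (c a) ≤ sz (c a) + sz (L a) by omega)
    have h1 := length_lt_sz (L a)
    have h0 : StackLe (sz (c a) + sz (L a)) 0 [CDCL.mkFrame (c a) [] (L a)] := by
      refine ⟨fun f hf => List.mem_singleton.1 hf ▸ frameLe_mkFrame hc' (by simp) (by simp)
        (by omega) fun l hl => lnLe_of_sz ?_, by simp, by simp [CDCL.mkFrame]⟩
      have := sz_mem_lt hl
      omega
    -- The loop counter is three copies of a sublist of the variables, hence at most `3 * M` steps.
    refine sz_stack_le (stackLe_foldl hc' l h0) ?_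
    have h2 : (CDCL.varList (c a) (L a)).length ≤ (c a).1.length := List.length_filter_le _ _
    have h3 := congrArg List.length hl
    have h4 := hc'.fst
    simp only [List.length_append] at h3
    omega

@[fun_prop] theorem PT.output {α : Type} [Enc α] {c : α → Ctx} {L : α → List Ln}
    {cls : α → List Cl} (hc : PT c) (hL : PT L) (hcls : PT cls) :
    PT fun a => output (c a) (L a) (cls a) := by
  unfold CDCL.output
  fun_prop

/-! ### Inputs and outputs -/

/-- A justification in the input. -/
structure InJust where
  val : Option (ℕ × ℕ)

instance : Enc InJust := ⟨fun j => encJust j.val⟩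

-- Justifications in the input are encoded without the tag that the generic encoding of an option
-- carries; this program inserts it.
@[fun_prop] theorem PT.inJust {α : Type} [Enc α] {f : α → InJust} (hf : PT f) :
    PT fun a => (f a).val := by
  refine PT.comp (f := InJust.val) (PT.of_expr
    (.case (.var 0) .nil (.cons .nil (.cons (.var 0) (.var 1)))) (2 * Polynomial.X + 10) ?_) hf
  rintro prog ⟨_ | ⟨j, k⟩⟩
  · exact ⟨_, by simp [sz, enc, encJust, Data.size], .caseNil (.var rfl) .nil⟩
  · refine ⟨_, ?_, .caseCons (.var rfl) (.cons .nil (.cons (.var rfl) (.var rfl)))⟩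
    simp only [sz, enc, encJust, Data.size, Polynomial.eval_add, Polynomial.eval_mul,
      Polynomial.eval_ofNat, Polynomial.eval_X]
    omega

/-- The whole algorithm. -/
def algorithm (p : List ℕ × List Cl × List (Cl × InJust)) : List Raw :=
  output (mkCtx p.1) (mkLines (mkCtx p.1) (p.2.2.map fun l => (l.1, l.2.val))) p.2.1

theorem PT.algorithm : PT algorithm := by
  unfold CDCL.algorithm
  fun_prop

theorem PT.program {α β : Type} [Enc α] [Enc β] {f : α → β} (hf : PT f) :
    ∃ (prog : Program) (p : Polynomial ℕ), ∀ a, ∃ t,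
      prog.RunsTo (enc a) (enc (f a)) t ∧ t ≤ p.eval (enc a).size := by
  obtain ⟨code, len, q, -, h⟩ := hf
  refine ⟨code 0, Polynomial.X + q + 2, fun a => ?_⟩
  obtain ⟨t, ht, body, hb, hev⟩ := h (code 0) 0 (fun i b hb => by simpa using hb) a
  refine ⟨_, .call (.var rfl) hb hev, ?_⟩
  simp only [Polynomial.eval_add, Polynomial.eval_X, Polynomial.eval_ofNat]
  simp only [sz] at ht
  omega

section
variable {n : ℕ}

theorem enc_signs (C : Clause n) : enc (signs C) = encClause C := by
  change encList ((signs C).map enc) = _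
  rw [signs, List.map_ofFn, encClause]
  congr 2
  funext i
  simp only [Function.comp_apply]
  split_ifs <;> rfl

/-- The input of the algorithm. -/
def input (π : Equiv.Perm (Fin n)) (cls : List (Clause n)) (Pf : ResProof n) :
    List ℕ × List Cl × List (Cl × InJust) :=
  (List.ofFn fun i => (π i : ℕ), cls.map signs, Pf.map fun l => (signs l.1, ⟨l.2⟩))

theorem enc_input (π : Equiv.Perm (Fin n)) (cls : List (Clause n)) (Pf : ResProof n) :
    enc (input π cls Pf) = encInput π cls Pf := by
  rw [input, enc_pair, enc_pair, encInput]
  congr 1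
  · change encList (List.map enc _) = _
    rw [List.map_ofFn]
    rfl
  · congr 1
    · change encList (List.map enc _) = _
      rw [List.map_map]
      congr 2
      funext C
      exact enc_signs C
    · change encList (List.map enc _) = _
      rw [List.map_map, encResProof]
      congr 2
      funext l
      rw [Function.comp_apply, enc_pair, enc_signs]
      rfl

theorem algorithm_input (π : Equiv.Perm (Fin n)) (cls : List (Clause n)) (Pf : ResProof n) :
    algorithm (input π cls Pf) = output (mkCtx (List.ofFn fun i => (π i : ℕ)))
      (skeleton (mkCtx (List.ofFn fun i => (π i : ℕ))) Pf) (cls.map signs) := by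
  simp only [algorithm, input, skeleton, List.map_map, Function.comp_def]

theorem signs_toClause {C : Cl} (hC : C.length = n) : signs (toClause n C) = C := by
  refine List.ext_getElem (by rw [length_signs, hC]) fun v h1 h2 => ?_
  have hv : v < n := by rwa [length_signs] at h1
  have h3 : ∀ D : Cl, ∀ h : v < D.length, lit D v = D[v] := fun D h => by
    rw [lit, List.getD_eq_getElem _ _ h]
  rw [← h3, ← h3]
  ext a
  exact (lit_signs (i := ⟨v, hv⟩)).trans mem_toClause

theorem encClause_toClause {C : Cl} (hC : C.length = n) : encClause (toClause n C) = enc C := by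
  rw [← enc_signs, signs_toClause hC]

theorem encP0Line_toLine {r : Raw} (hr : IsLine n r) : encP0Line (toLine n r) = enc r := by
  rcases r with C | t
  · rw [toLine, encP0Line, encClause_toClause hr]; rfl
  · rw [toLine, encP0Line, enc_inr]
    congr 1
    change encList _ = encList (t.map enc)
    congr 1
    induction t with
    | nil => rfl
    | cons s t ih =>
      have hs : s.1 < n := hr s (by simp)
      rw [toTrail, List.filterMap_cons_some (dif_pos hs), List.map_cons, List.map_cons]
      have ih := ih fun s h => hr s (by simp [h])
      rw [toTrail] at ih
      rw [ih]
      congr 1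
      obtain ⟨v, u, a⟩ := s
      cases u <;> rfl

theorem encP0Proof_toLine {G : List Raw} (hG : ∀ r ∈ G, IsLine n r) :
    encP0Proof (G.map (toLine n)) = enc G := by
  change _ = encList (G.map enc)
  rw [encP0Proof, List.map_map]
  congr 1
  exact List.map_congr_left fun r hr => encP0Line_toLine (hG r hr)

end
end CDCL

theorem theorem4p4 :
    ∃ (prog : CDCL.Program) (p : Polynomial ℕ) (c : ℕ),
      ∀ (n : ℕ) (π : Equiv.Perm (Fin n)) (τ : CDCL.CNF n) (cls : List (CDCL.Clause n))
        (Pf : CDCL.ResProof n),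
        cls.Nodup → cls.toFinset = τ →
        CDCL.IsRefutation τ Pf → CDCL.IsConnected Pf →
        ∃ (G : List (CDCL.P0Line n)) (t : ℕ),
          prog.RunsTo (CDCL.encInput π cls Pf) (CDCL.encP0Proof G) t ∧
          t ≤ p.eval (CDCL.encInput π cls Pf).size ∧
          CDCL.IsP0Proof π τ G ∧
          G.length ≤ c * (n ^ 2 * τ.card * Pf.length) ∧
          ∀ i ∈ CDCL.ResProof.vars Pf, ∀ a : Bool,
            CDCL.P0Line.clause (CDCL.Clause.unit (i, a)) ∈ G := by
  obtain ⟨prog, p, hp⟩ := CDCL.PT.algorithm.program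
  refine ⟨prog, p, 163, fun n π τ cls Pf hnd hcls h hcon => ?_⟩
  obtain ⟨t, ht, htp⟩ := hp (CDCL.input π cls Pf)
  obtain ⟨hG, hlen, hmem⟩ := CDCL.output_spec (CDCL.mkCtx_ok π) h hcon hnd hcls
  rw [CDCL.enc_input, CDCL.algorithm_input] at ht
  rw [CDCL.enc_input] at htp
  exact ⟨_, t, by rwa [CDCL.encP0Proof_toLine hG.isLine], htp, hG.isProof,
    by rwa [List.length_map], hmem⟩
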